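/- **Turn-halving lemma.** A *unitary logspace verifier* with $m(n)$ messages for a promise problem $\mathcal I=(\mathcal I_{\rm yes},\mathcal I_{\rm no})$ over $\{0,1\}^*$ assigns to each input $x\in\mathcal I_{\rm yes}\cup\mathcal I_{\rm no}$, $|x|=n$, a tuple $V_1,\dots,V_k$ of $k=\lfloor m(n)/2+1\rfloor$ unitary quantum circuits over the gate set $\{\mathrm H,\mathrm{CNOT},\mathrm T\}$, each acting on a message register $\mathsf M$ and a private register $\mathsf W$ whose sizes $q_{\mathsf M}(n),q_{\mathsf W}(n)$ depend only on $n$ and satisfy $1\le q_{\mathsf M}(n)+q_{\mathsf W}(n)\le O(\log n)$, such that a single deterministic logspace Turing machine, on input $x$, outputs the classical description of the whole tuple (including the register sizes). A *prover* on input $x$ consists of a private register $\mathsf Q$ of arbitrary finite size and arbitrary unitaries $P_1,\dots,P_l$ on $(\mathsf Q,\mathsf M)$, $l=\lfloor (m(n)+1)/2\rfloor$. Starting with all qubits of $(\mathsf Q,\mathsf M,\mathsf W)$ in the state $|0\rangle$, the actions are applied alternately, in the order $P_1,V_1,\dots,P_l,V_l$ if $m(n)$ is odd and $V_1,P_1,\dots,V_l,P_l,V_{l+1}$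 if $m(n)$ is even; the verifier accepts if measuring the first qubit of $(\mathsf M,\mathsf W)$ at the end yields $1$. For $c,s:\mathbb N\to\mathbb R$, the class $\mathsf{QIP_UL}_m[c,s]$ consists of all promise problems having an $m(n)$-message unitary logspace verifier such that for every $x\in\mathcal I_{\rm yes}$ some prover makes it accept with probability at least $c(|x|)$, and for every $x\in\mathcal I_{\rm no}$ every prover makes it accept with probability at most $s(|x|)$. Let $m:\mathbb N\to\mathbb N$ be logspace computable with $1\le m(n)\le \mathrm{poly}(n)$, and let $s:\mathbb N\to[0,1]$ be any function (in particular, any logspace-computable one). Then $$\mathsf{QIP_UL}_{4m+1}[1,s]\subseteq \mathsf{QIP_UL}_{2m+1}\!\left[1,\tfrac{1+\sqrt{s}}{2}\right].$$ -/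

import Mathlib

open scoped Kronecker

noncomputable section

namespace UQIP

/-! ### Logspace transducers

Deterministic Turing machines with a two-way read-only input tape over `{0,1}` (with end markers),
finitely many one-way infinite work tapes, and a write-only output tape. -/

/-- The content of a cell of the input tape: an end marker or an input bit. -/
inductive InSym where
  | leftEnd
  | bit (b : Bool)
  | rightEnd

/-- Head movements. -/
inductive Move where
  | left
  | stay
  | right

/-- The effect of a movement on a head position (a head in cell `0` cannot move further left). -/
def Move.apply : Move → ℕ → ℕ
  | .left, p => p - 1
  | .stay, p => p
  | .right, p => p + 1

/-- The content of cell `p` of the input tape: the left end marker in cell `0`, the input `x` in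
the cells `1, …, |x|`, and the right end marker in cell `|x| + 1`. -/
def inputCell (x : List Bool) : ℕ → InSym
  | 0 => .leftEnd
  | p + 1 => match x[p]? with
    | some b => .bit b
    | none => .rightEnd

/-- A deterministic Turing machine with `k` work tapes and output alphabet `Ω`. From the state, the
scanned input cell, and the scanned work cells, the transition function either halts (`none`) or
yields the next state, the input head's movement, the symbol written and the movement on each work
tape, and optionally one symbol appended to the output. -/
structure Transducer (Ω : Type) where
  /-- states -/
  Q : Type
  finQ : Finite Q
  /-- work tape alphabet -/
  Γ : Type
  finΓ : Finite Γ
  blank : Γ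
  /-- number of work tapes -/
  k : ℕ
  start : Q
  δ : Q → InSym → (Fin k → Γ) → Option (Q × Move × (Fin k → Γ × Move) × Option Ω)

namespace Transducer

variable {Ω : Type} (M : Transducer Ω)

/-- A configuration. -/
structure Cfg where
  state : M.Q
  inPos : ℕ
  tape : Fin M.k → ℕ → M.Γ
  head : Fin M.k → ℕ
  out : List Ω

/-- The initial configuration. -/
def init : M.Cfg where
  state := M.start
  inPos := 0
  tape := fun _ _ => M.blank
  head := fun _ => 0
  out := []

/-- One step on input `x`; `none` if the machine has halted. The input head cannot move past the
right end marker. -/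
def step (x : List Bool) (c : M.Cfg) : Option M.Cfg :=
  match M.δ c.state (inputCell x c.inPos) (fun i => c.tape i (c.head i)) with
  | none => none
  | some (q, mv, w, o) => some
    { state := q
      inPos := min (mv.apply c.inPos) (x.length + 1)
      tape := fun i => Function.update (c.tape i) (c.head i) (w i).1
      head := fun i => (w i).2.apply (c.head i)
      out := c.out ++ o.toList }

/-- On input `x`, the machine halts with output `y`. -/
def Outputs (x : List Bool) (y : List Ω) : Prop :=
  ∃ c, StateTransition.Reaches (M.step x) M.init c ∧ M.step x c = none ∧ c.out = y

/-- On input `x`, the machine only ever visits the first `S` cells of each work tape. -/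
def RunsInSpace (x : List Bool) (S : ℕ) : Prop :=
  ∀ c, StateTransition.Reaches (M.step x) M.init c → ∀ i, c.head i < S

end Transducer

/-- The map `f` is computed in deterministic logarithmic space on the inputs in `D`. -/
def LogspaceComputableOn {Ω : Type} (D : Set (List Bool)) (f : List Bool → List Ω) : Prop :=
  ∃ (M : Transducer Ω) (C : ℕ), ∀ x ∈ D,
    M.Outputs x (f x) ∧ M.RunsInSpace x (C * (Nat.log 2 x.length + 1))

/-- A number-theoretic function is logspace computable: on input `1ⁿ` its value is written in
binary by a logspace machine. -/
def LogspaceComputable (f : ℕ → ℕ) : Prop :=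
  LogspaceComputableOn {x | ∃ n, x = List.replicate n true} (fun x => (f x.length).bits)

/-! ### Unitary quantum circuits over `{H, T, CNOT}` -/

/-- A gate acting on the qubits labelled by `ι`. -/
inductive Gate (ι : Type) where
  | H (i : ι)
  | T (i : ι)
  | CNOT (control target : ι) (h : control ≠ target)

/-- The unitary of a gate, in the computational basis `ι → Bool`. -/
def Gate.mat {ι : Type} [DecidableEq ι] [Fintype ι] :
    Gate ι → Matrix (ι → Bool) (ι → Bool) ℂ
  | .H i => Matrix.of fun v w =>
      if ∀ j, j ≠ i → v j = w j then
        (if v i = true ∧ w i = true then -1 else 1) / ((Real.sqrt 2 : ℝ) : ℂ)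
      else 0
  | .T i => Matrix.diagonal fun v =>
      if v i = true then Complex.exp (Real.pi / 4 * Complex.I) else 1
  | .CNOT a t _ => Matrix.of fun v w =>
      if v = Function.update w t (xor (w a) (w t)) then 1 else 0

/-- A circuit: the first gate of the list is applied first. -/
abbrev Circuit (ι : Type) := List (Gate ι)

/-- The unitary of a circuit. -/
def Circuit.mat {ι : Type} [DecidableEq ι] [Fintype ι] :
    Circuit ι → Matrix (ι → Bool) (ι → Bool) ℂ
  | [] => 1
  | g :: C => Circuit.mat C * g.mat

/-! ### Verifiers -/

/-- The verifier's actions on one input: a tuple of circuits acting on the message register `𝖬`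
(`qM` qubits) and the private register `𝖶` (`qW` qubits). -/
structure Actions where
  qM : ℕ
  qW : ℕ
  pos : 0 < qM + qW
  circuits : List (Circuit (Fin qM ⊕ Fin qW))

/-- The symbols in which the verifier's actions are written down. -/
inductive Tok where
  | tally | endM | endW | turn | gateH | gateT | gateCNOT | wireM | wireW

/-- A qubit is written as the name of its register, followed by its position in unary. -/
def encodeWire {a b : ℕ} : Fin a ⊕ Fin b → List Tok
  | .inl i => .wireM :: List.replicate i .tally
  | .inr i => .wireW :: List.replicate i .tally

def encodeGate {a b : ℕ} : Gate (Fin a ⊕ Fin b) → List Tok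
  | .H i => .gateH :: encodeWire i
  | .T i => .gateT :: encodeWire i
  | .CNOT i j _ => .gateCNOT :: (encodeWire i ++ encodeWire j)

/-- The classical description of the whole tuple of circuits, together with the sizes of the two
registers. -/
def Actions.encode (A : Actions) : List Tok :=
  List.replicate A.qM .tally ++ .endM :: (List.replicate A.qW .tally ++ .endW ::
    A.circuits.flatMap fun C => .turn :: C.flatMap encodeGate)

/-- The output qubit: the first qubit of `(𝖬, 𝖶)`. -/
def Actions.outQubit (A : Actions) : Fin A.qM ⊕ Fin A.qW :=
  finSumFinEquiv.symm ⟨0, A.pos⟩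

/-! ### Provers and their interaction with the verifier -/

/-- Computational basis states of `n` qubits. -/
abbrev Bits (n : ℕ) := Fin n → Bool

/-- A prover's behaviour on one input: a private register `𝖰` of any size, and `l` arbitrary
unitaries on `(𝖰, 𝖬)`. -/
structure Prover (qM l : ℕ) where
  qQ : ℕ
  act : Fin l → Matrix.unitaryGroup (Bits qQ × Bits qM) ℂ

/-- Operators on the joint register `(𝖰, 𝖬, 𝖶)`. -/
abbrev JointOp (qQ qM qW : ℕ) :=
  Matrix (Bits qQ × Bits qM × Bits qW) (Bits qQ × Bits qM × Bits qW) ℂ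

/-- `U ⊗ 1` for a prover's action `U` on `(𝖰, 𝖬)`. -/
def liftProver {qQ qM : ℕ} (qW : ℕ) (U : Matrix (Bits qQ × Bits qM) (Bits qQ × Bits qM) ℂ) :
    JointOp qQ qM qW :=
  (U ⊗ₖ (1 : Matrix (Bits qW) (Bits qW) ℂ)).submatrix
    (fun r => ((r.1, r.2.1), r.2.2)) (fun r => ((r.1, r.2.1), r.2.2))

/-- `1 ⊗ V` for a verifier's action `V` on `(𝖬, 𝖶)`. -/
def liftVerifier (qQ : ℕ) {qM qW : ℕ} (C : Circuit (Fin qM ⊕ Fin qW)) : JointOp qQ qM qW :=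
  (1 : Matrix (Bits qQ) (Bits qQ) ℂ) ⊗ₖ
    (C.mat.submatrix (fun r => Sum.elim r.1 r.2) (fun r => Sum.elim r.1 r.2))

/-- Apply `P₁, V₁, P₂, V₂, …` in this order. -/
def alternate {ι : Type} [Fintype ι] :
    List (Matrix ι ι ℂ) → List (Matrix ι ι ℂ) → (ι → ℂ) → (ι → ℂ)
  | P :: Ps, V :: Vs, ψ => alternate Ps Vs (V.mulVec (P.mulVec ψ))
  | _, _, ψ => ψ

/-- The all-zero state of `(𝖰, 𝖬, 𝖶)`. -/
def zeroState (qQ qM qW : ℕ) : Bits qQ × Bits qM × Bits qW → ℂ :=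
  Pi.single (fun _ => false, fun _ => false, fun _ => false) 1

/-- The final state of the `m`-message interaction. For odd `m = 2l + 1` the actions
`P₁, V₁, …, P_{l+1}, V_{l+1}` are applied in sequence, for even `m = 2l` the actions
`V₁, P₁, …, V_l, P_l, V_{l+1}`. -/
def finalState (m : ℕ) (A : Actions) (P : Prover A.qM ((m + 1) / 2)) :
    Bits P.qQ × Bits A.qM × Bits A.qW → ℂ :=
  let Ps : List (JointOp P.qQ A.qM A.qW) := List.ofFn fun j => liftProver A.qW (P.act j).1
  let Vs : List (JointOp P.qQ A.qM A.qW) := A.circuits.map (liftVerifier P.qQ)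
  if Odd m then alternate Ps Vs (zeroState _ _ _)
  else match Vs with
    | [] => zeroState _ _ _
    | V :: Vs => alternate Ps Vs (V.mulVec (zeroState _ _ _))

/-- The probability that measuring the output qubit of the final state yields `1`. -/
def acceptProb (m : ℕ) (A : Actions) (P : Prover A.qM ((m + 1) / 2)) : ℝ :=
  ∑ r : Bits P.qQ × Bits A.qM × Bits A.qW,
    if Sum.elim r.2.1 r.2.2 A.outQubit = true then ‖finalState m A P r‖ ^ 2 else 0

/-! ### The complexity classes -/

/-- A promise problem. -/
structure PromiseProblem where
  yes : Set (List Bool)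
  no : Set (List Bool)
  disjoint : Disjoint yes no

/-- `V` is an `m(n)`-message space-bounded unitary quantum verifier for `I`: on the inputs `x` in
the promise, the description of the whole tuple `V(x)₁, …, V(x)_k`, `k = ⌊m/2 + 1⌋`, is produced by
one deterministic logspace machine, the sizes of the registers depend on `|x|` only, and they hold
`O(log |x|)` qubits in total. -/
structure IsLogspaceVerifier (I : PromiseProblem) (m : ℕ → ℕ) (V : List Bool → Actions) :
    Prop where
  uniform : LogspaceComputableOn (I.yes ∪ I.no) fun x => (V x).encode
  registers : ∃ qM qW : ℕ → ℕ, ∀ x ∈ I.yes ∪ I.no,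
    (V x).qM = qM x.length ∧ (V x).qW = qW x.length
  qubits : ∃ C : ℕ, ∀ x ∈ I.yes ∪ I.no,
    (V x).qM + (V x).qW ≤ C * (Nat.log 2 x.length + 1)
  messages : ∀ x ∈ I.yes ∪ I.no, (V x).circuits.length = m x.length / 2 + 1

/-- The class of promise problems with `m(n)`-message space-bounded unitary quantum interactive
proofs of completeness `c(n)` and soundness `s(n)`. -/
def QIPUL (m : ℕ → ℕ) (c s : ℕ → ℝ) : Set PromiseProblem :=
  {I | ∃ V : List Bool → Actions, IsLogspaceVerifier I m V ∧
    (∀ x ∈ I.yes, ∃ P : Prover (V x).qM ((m x.length + 1) / 2),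
      c x.length ≤ acceptProb (m x.length) (V x) P) ∧
    (∀ x ∈ I.no, ∀ P : Prover (V x).qM ((m x.length + 1) / 2),
      acceptProb (m x.length) (V x) P ≤ s x.length)}

end UQIP

end

/-! The original verifier has 2m+1 circuits V_1, …, V_{2m+1}, each preceded by a move of the prover.
The new verifier asks for a snapshot of the message and private registers at the moment just before
the middle circuit V_{m+1}, tosses a coin and reveals it. On 0 it plays V_{m+1} and then the last m
rounds, and accepts if the original output qubit is 1. On 1 it rewinds with V_m†, …, V_1†, the
prover moving before each, and accepts if the original private register is back at zero. Either way
there is one first message followed by m rounds.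

Completeness (`le_acceptProb_halve`): the honest prover sends the true intermediate state and then,
according to the coin, goes on with its moves or undoes them. Forwards the original run is
completed; backwards the state after the very first move is recovered, where the private register is
zero. Both branches succeed with certainty.

Soundness (`acceptProb_halve_le`): let X₀ and X₁ be the products of all operators in the two
branches. They contain the same moves of the prover and act on the same snapshot φ; the revealed
coin is only a bit flip in X₁. If ξ has zero private register, then X₀X₁†ξ is the final state of an
original interaction: prepare ξ with the first move, undo the backward branch, run the forward
branch. Hence its accepting weight is at most s times the squared norm of ξ. The geometric estimate
`weight_add_weight_le` turns this into a bound 1 + √s for the sum of the two success probabilities,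
and the acceptance probability is half of that sum (`acceptProb_halve`).

To stay within unitary circuits over {H, T, CNOT}, the coin is H applied to a zero qubit and is
kept, with its negation, as a control for the original gates. Controlled gates are exact because T
has order 8: T† is T⁷, and controlled H, T and CNOT have exact implementations with one ancilla.
States of the new protocol are described by `lifted`, one original state for each value of the coin.

Uniformity (`logspaceComputableOn_halve`): a program with finitely many counters, reading the old
description as a random-access word, prints the new one (`exec_halveProgram`). Such programs are
compiled to transducers that never store the old description: each symbol is recomputed by rerunning
the old machine. A space-bounded machine has an output of polynomial length (`exists_output_bound`),
so the counters fit in logarithmic space (`LogspaceComputableOn.comp_cprog`). -/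

open scoped Kronecker

noncomputable section

namespace UQIP

/-! ### While programs -/

/-- While programs with primitive actions `A` and tests `T`. -/
inductive Prog (A T : Type) where
  | skip
  | act (a : A)
  | seq (p q : Prog A T)
  | ite (t : T) (p q : Prog A T)
  | loop (t : T) (p : Prog A T)

/-- Big-step semantics of while programs, over a relational semantics of the actions. -/
inductive Exec {A T D : Type} (act : A → D → D → Prop) (test : T → D → Bool) :
    Prog A T → D → D → Prop where
  | skip (s) : Exec act test .skip s s
  | act {a s s'} (h : act a s s') : Exec act test (.act a) s s'
  | seq {p q s s' s''} (h : Exec act test p s s') (h' : Exec act test q s' s'') :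
      Exec act test (.seq p q) s s''
  | iteTrue {t p q s s'} (ht : test t s = true) (h : Exec act test p s s') :
      Exec act test (.ite t p q) s s'
  | iteFalse {t p q s s'} (ht : test t s = false) (h : Exec act test q s s') :
      Exec act test (.ite t p q) s s'
  | loopTrue {t p s s' s''} (ht : test t s = true) (h : Exec act test p s s')
      (h' : Exec act test (.loop t p) s' s'') : Exec act test (.loop t p) s s''
  | loopFalse {t p s} (ht : test t s = false) : Exec act test (.loop t p) s s

namespace Prog

variable {A T A' T' : Type}

/-- Translate a program, given implementations of its actions and of its tests: before each test
a program is run that prepares the test. -/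
def translate (tr : A → Prog A' T') (pre : T → Prog A' T') (flag : T → T') :
    Prog A T → Prog A' T'
  | .skip => .skip
  | .act a => tr a
  | .seq p q => .seq (p.translate tr pre flag) (q.translate tr pre flag)
  | .ite t p q => .seq (pre t) (.ite (flag t) (p.translate tr pre flag) (q.translate tr pre flag))
  | .loop t p => .seq (pre t) (.loop (flag t) (.seq (p.translate tr pre flag) (pre t)))

end Prog

/-- A forward simulation along `R`. Tests of the source may be costly computations in the target;
`pre` carries one out and leaves the outcome where `flag` can inspect it. -/
theorem Exec.translate {A T D A' T' D' : Type} {act : A → D → D → Prop} {test : T → D → Bool}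
    {act' : A' → D' → D' → Prop} {test' : T' → D' → Bool}
    {tr : A → Prog A' T'} {pre : T → Prog A' T'} {flag : T → T'} (R : D → D' → Prop)
    (hact : ∀ a s s' d, act a s s' → R s d → ∃ d', Exec act' test' (tr a) d d' ∧ R s' d')
    (htest : ∀ t s d, R s d →
      ∃ d', Exec act' test' (pre t) d d' ∧ R s d' ∧ test' (flag t) d' = test t s)
    {p : Prog A T} {s s' : D} (h : Exec act test p s s') {d : D'} (hd : R s d) :
    ∃ d', Exec act' test' (p.translate tr pre flag) d d' ∧ R s' d' := by
  induction h generalizing d with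
  | skip s => exact ⟨d, .skip d, hd⟩
  | act h => exact hact _ _ _ _ h hd
  | seq _ _ ih₁ ih₂ =>
    obtain ⟨d₁, e₁, r₁⟩ := ih₁ hd
    obtain ⟨d₂, e₂, r₂⟩ := ih₂ r₁
    exact ⟨d₂, .seq e₁ e₂, r₂⟩
  | iteTrue ht _ ih =>
    obtain ⟨d₁, e₁, r₁, t₁⟩ := htest _ _ _ hd
    obtain ⟨d₂, e₂, r₂⟩ := ih r₁
    exact ⟨d₂, .seq e₁ (.iteTrue (t₁.trans ht) e₂), r₂⟩
  | iteFalse ht _ ih =>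
    obtain ⟨d₁, e₁, r₁, t₁⟩ := htest _ _ _ hd
    obtain ⟨d₂, e₂, r₂⟩ := ih r₁
    exact ⟨d₂, .seq e₁ (.iteFalse (t₁.trans ht) e₂), r₂⟩
  | loopTrue ht _ _ ih₁ ih₂ =>
    obtain ⟨d₁, e₁, r₁, t₁⟩ := htest _ _ _ hd
    obtain ⟨d₂, e₂, r₂⟩ := ih₁ r₁
    obtain ⟨d₃, e₃, r₃⟩ := ih₂ r₂
    -- The translated remainder of the loop begins with its own preparation of the test; that run is
    -- the one which the translated body performs at its end.
    cases e₃ with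
    | seq f₁ f₂ => exact ⟨d₃, .seq e₁ (.loopTrue (t₁.trans ht) (.seq e₂ f₁) f₂), r₃⟩
  | loopFalse ht =>
    obtain ⟨d₁, e₁, r₁, t₁⟩ := htest _ _ _ hd
    exact ⟨d₁, .seq e₁ (.loopFalse (t₁.trans ht)), r₁⟩

/-! ### Tape programs and their compilation to transducers -/

/-- The data manipulated by a tape program: a finite register, the position of the input head, the
work tapes and their heads, and the output. -/
structure TData (Ω F Γ ι : Type) where
  fin : F
  inPos : ℕ
  tape : ι → ℕ → Γ
  head : ι → ℕ
  out : List Ω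

/-- What a tape program sees. -/
structure Obs (F Γ ι : Type) where
  fin : F
  sym : InSym
  cell : ι → Γ

/-- The effect of a step. -/
structure Effect (Ω F Γ ι : Type) where
  fin : F
  mv : Move
  wr : ι → Γ × Move
  emit : Option Ω

section Compile

variable {Ω F Γ ι : Type}

def TData.obs (x : List Bool) (d : TData Ω F Γ ι) : Obs F Γ ι :=
  ⟨d.fin, inputCell x d.inPos, fun i => d.tape i (d.head i)⟩

def TData.apply (x : List Bool) (d : TData Ω F Γ ι) (a : Effect Ω F Γ ι) : TData Ω F Γ ι where
  fin := a.fin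
  inPos := min (a.mv.apply d.inPos) (x.length + 1)
  tape := fun i => Function.update (d.tape i) (d.head i) (a.wr i).1
  head := fun i => (a.wr i).2.apply (d.head i)
  out := d.out ++ a.emit.toList

/-- Tape programs. -/
abbrev TProg (Ω F Γ ι : Type) := Prog (Obs F Γ ι → Effect Ω F Γ ι) (Obs F Γ ι → Bool)

/-- Big-step semantics of tape programs using `S` cells of each tape. -/
abbrev TExec (x : List Bool) (S : ℕ) (p : TProg Ω F Γ ι) (d d' : TData Ω F Γ ι) : Prop :=
  Exec (fun a d d' => d' = d.apply x (a (d.obs x)) ∧ ∀ i, d'.head i < S)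
    (fun t d => t (d.obs x)) p d d'

/-- The effect that changes nothing. -/
def Obs.idle (o : Obs F Γ ι) : Effect Ω F Γ ι :=
  ⟨o.fin, .stay, fun i => (o.cell i, .stay), none⟩

/-- Every step clamps the input head to the right end marker, so an idle step is neutral only for
heads already in range. -/
theorem TData.apply_idle (x : List Bool) (d : TData Ω F Γ ι) (h : d.inPos ≤ x.length + 1) :
    d.apply x (d.obs x).idle = d := by
  obtain ⟨fin, inPos, tape, head, out⟩ := d
  simp only [TData.apply, TData.obs, Obs.idle, Move.apply, Function.update_eq_self,
    Option.toList_none, List.append_nil]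
  congr 1
  exact min_eq_left h

theorem TData.apply_inPos (x : List Bool) (d : TData Ω F Γ ι) (e) :
    (d.apply x e).inPos ≤ x.length + 1 := min_le_right _ _

/-- The initial data of a tape program. -/
def TData.init (b : Γ) (f₀ : F) : TData Ω F Γ ι := ⟨f₀, 0, fun _ _ => b, fun _ => 0, []⟩

/-- The effect of the first step of a stack of programs. -/
def stackEffect : List (TProg Ω F Γ ι) → Obs F Γ ι → Effect Ω F Γ ι
  | .act a :: _, o => a o
  | _, o => o.idle

/-- The rest of a stack of programs after its first step. -/
def stackNext : List (TProg Ω F Γ ι) → Obs F Γ ι → List (TProg Ω F Γ ι)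
  | [], _ => []
  | .skip :: K, _ => K
  | .act _ :: K, _ => K
  | .seq p q :: K, _ => p :: q :: K
  | .ite t p q :: K, o => bif t o then p :: K else q :: K
  | .loop t p :: K, o => bif t o then p :: .loop t p :: K else K

/-- The stacks of programs met when the program `p` is run on top of the stack `K`. -/
def progStacks : TProg Ω F Γ ι → List (TProg Ω F Γ ι) → Set (List (TProg Ω F Γ ι))
  | .skip, K => {.skip :: K}
  | .act a, K => {.act a :: K}
  | .seq p q, K => insert (.seq p q :: K) (progStacks p (q :: K) ∪ progStacks q K)
  | .ite t p q, K => insert (.ite t p q :: K) (progStacks p K ∪ progStacks q K)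
  | .loop t p, K => insert (.loop t p :: K) (progStacks p (.loop t p :: K))

/-- A loop reappears under its own body instead of being copied ever deeper, so the continuations
are indexed by positions in the program text. Finiteness allows them to be control states of a
machine. -/
theorem progStacks_finite (p : TProg Ω F Γ ι) (K) : (progStacks p K).Finite := by
  induction p generalizing K with
  | skip => exact Set.finite_singleton _
  | act a => exact Set.finite_singleton _
  | seq p q ihp ihq => exact ((ihp _).union (ihq _)).insert _
  | ite t p q ihp ihq => exact ((ihp _).union (ihq _)).insert _
  | loop t p ih => exact (ih _).insert _

theorem mem_progStacks_self (p : TProg Ω F Γ ι) (K) : p :: K ∈ progStacks p K := by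
  cases p <;> simp [progStacks]

/-- The continuations of `p` are closed under a step, except that finishing `p` uncovers `K`. -/
theorem stackNext_mem {p : TProg Ω F Γ ι} {K l} (hl : l ∈ progStacks p K) (o) :
    stackNext l o ∈ insert K (progStacks p K) := by
  induction p generalizing K l with
  | skip => simp only [progStacks, Set.mem_singleton_iff] at hl; subst hl; simp [stackNext]
  | act a => simp only [progStacks, Set.mem_singleton_iff] at hl; subst hl; simp [stackNext]
  | seq p q ihp ihq =>
    rcases hl with rfl | hl | hl
    · exact .inr (.inr (.inl (mem_progStacks_self _ _)))
    · rcases ihp hl with h | h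
      · rw [h]; exact .inr (.inr (.inr (mem_progStacks_self _ _)))
      · exact .inr (.inr (.inl h))
    · rcases ihq hl with h | h
      · rw [h]; exact .inl rfl
      · exact .inr (.inr (.inr h))
  | ite t p q ihp ihq =>
    rcases hl with rfl | hl | hl
    · simp only [stackNext]
      cases t o
      · exact .inr (.inr (.inr (mem_progStacks_self _ _)))
      · exact .inr (.inr (.inl (mem_progStacks_self _ _)))
    · rcases ihp hl with h | h
      · rw [h]; exact .inl rfl
      · exact .inr (.inr (.inl h))
    · rcases ihq hl with h | h
      · rw [h]; exact .inl rfl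
      · exact .inr (.inr (.inr h))
  | loop t p ih =>
    rcases hl with rfl | hl
    · simp only [stackNext]
      cases t o
      · exact .inl rfl
      · exact .inr (.inr (mem_progStacks_self _ _))
    · rcases ih hl with h | h
      · rw [h]; exact .inr (.inl rfl)
      · exact .inr (.inr h)

/-- The stacks of programs met when `p` is run. -/
def Stacks (p : TProg Ω F Γ ι) : Type := ↥(insert [] (progStacks p []))

instance (p : TProg Ω F Γ ι) : Finite (Stacks p) :=
  ((progStacks_finite p []).insert []).to_subtype

def Stacks.next {p : TProg Ω F Γ ι} (l : Stacks p) (o : Obs F Γ ι) : Stacks p :=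
  ⟨stackNext l.1 o, by
    obtain ⟨l, rfl | hl⟩ := l
    · exact .inl rfl
    · exact stackNext_mem hl o⟩

open Classical in
/-- The transducer that runs a tape program. -/
def compile [Finite F] [Finite Γ] [Finite ι] (b : Γ) (f₀ : F) (p : TProg Ω F Γ ι) :
    Transducer Ω where
  Q := Stacks p × F
  finQ := inferInstance
  Γ := Γ
  finΓ := inferInstance
  blank := b
  k := Nat.card ι
  start := (⟨[p], .inr (mem_progStacks_self _ _)⟩, f₀)
  δ q sym cells :=
    let o : Obs F Γ ι := ⟨q.2, sym, fun i => cells (Finite.equivFin ι i)⟩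
    if q.1.1 = [] then none else
      let e := stackEffect q.1.1 o
      some ((q.1.next o, e.fin), e.mv, fun j => e.wr ((Finite.equivFin ι).symm j), e.emit)

/-- Determinism: every configuration reachable from the initial one lies on the given halting path,
so bounding the heads along this single path bounds the space. -/
theorem Transducer.outputs_of_path (M : Transducer Ω) {x : List Bool} {S : ℕ} {c : M.Cfg}
    (hS : ∀ i, M.init.head i < S)
    (h : Relation.ReflTransGen (fun a b => M.step x a = some b ∧ ∀ i, b.head i < S) M.init c)
    (hc : M.step x c = none) : M.Outputs x c.out ∧ M.RunsInSpace x S := by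
  refine ⟨⟨c, Relation.ReflTransGen.mono (fun a b hab => hab.1) _ _ h, hc, rfl⟩, ?_⟩
  have key : ∀ a, Relation.ReflTransGen
      (fun a b => M.step x a = some b ∧ ∀ i, b.head i < S) a c → (∀ i, a.head i < S) →
      ∀ b, StateTransition.Reaches (M.step x) a b → ∀ i, b.head i < S := by
    intro a ha
    induction ha using Relation.ReflTransGen.head_induction_on with
    | refl =>
      intro h b hb
      rcases Relation.ReflTransGen.cases_head hb with rfl | ⟨d, hd, _⟩
      · exact h
      · rw [hc] at hd; cases hd
    | head h' _ ih =>
      intro h b hb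
      rcases Relation.ReflTransGen.cases_head hb with rfl | ⟨d, hd, hdb⟩
      · exact h
      · rw [h'.1, Option.mem_some_iff] at hd
        subst hd
        exact ih h'.2 b hdb
  exact key _ h hS

section

variable [Finite F] [Finite Γ] [Finite ι] (b : Γ) (f₀ : F) (p : TProg Ω F Γ ι)

/-- The configuration of the compiled transducer for a stack of programs and data. -/
def toCfg (l : Stacks p) (d : TData Ω F Γ ι) : (compile b f₀ p).Cfg where
  state := (l, d.fin)
  inPos := d.inPos
  tape := fun j => d.tape ((Finite.equivFin ι).symm j)
  head := fun j => d.head ((Finite.equivFin ι).symm j)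
  out := d.out

theorem step_toCfg (x : List Bool) (l : Stacks p) (hl : l.1 ≠ []) (d : TData Ω F Γ ι) :
    (compile b f₀ p).step x (toCfg b f₀ p l d) =
      some (toCfg b f₀ p (l.next (d.obs x)) (d.apply x (stackEffect l.1 (d.obs x)))) := by
  simp only [Transducer.step, compile, toCfg, if_neg hl, Equiv.symm_apply_apply]
  rfl

theorem step_toCfg_nil (x : List Bool) (l : Stacks p) (hl : l.1 = []) (d : TData Ω F Γ ι) :
    (compile b f₀ p).step x (toCfg b f₀ p l d) = none := by
  simp only [Transducer.step, compile, toCfg, if_pos hl]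

/-- Unfolding a control construct costs the machine one idle step, and an action costs one proper
step; a big-step derivation thus becomes a path that removes `q` from the top of the stack. -/
theorem exec_path {x : List Bool} {S : ℕ} {q : TProg Ω F Γ ι} {d d' : TData Ω F Γ ι}
    (h : TExec x S q d d') (hd : d.inPos ≤ x.length + 1) (hS : ∀ i, d.head i < S) :
    (d'.inPos ≤ x.length + 1 ∧ ∀ i, d'.head i < S) ∧
    ∀ (l : Stacks p) (K), l.1 = q :: K → ∃ l' : Stacks p, l'.1 = K ∧ Relation.ReflTransGen
      (fun a c => (compile b f₀ p).step x a = some c ∧ ∀ i, c.head i < S)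
      (toCfg b f₀ p l d) (toCfg b f₀ p l' d') := by
  have one : ∀ (l : Stacks p) (d : TData Ω F Γ ι) (K : List (TProg Ω F Γ ι)), l.1 ≠ [] →
      stackNext l.1 (d.obs x) = K → d.inPos ≤ x.length + 1 → (∀ i, d.head i < S) →
      stackEffect l.1 (d.obs x) = (d.obs x).idle →
      ∃ l' : Stacks p, l'.1 = K ∧ ((compile b f₀ p).step x (toCfg b f₀ p l d) =
        some (toCfg b f₀ p l' d) ∧ ∀ i, (toCfg b f₀ p l' d).head i < S) := by
    intro l d K hl hK hd hS he
    refine ⟨l.next (d.obs x), hK, ?_, fun i => hS _⟩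
    rw [step_toCfg b f₀ p x l hl d, he, TData.apply_idle x d hd]
  induction h with
  | skip s =>
    refine ⟨⟨hd, hS⟩, fun l K hl => ?_⟩
    obtain ⟨l', h, hs⟩ := one l s K (by simp [hl]) (by rw [hl]; rfl) hd hS (by rw [hl]; rfl)
    exact ⟨l', h, .single hs⟩
  | @act a s s' h =>
    obtain ⟨rfl, h⟩ := h
    refine ⟨⟨TData.apply_inPos _ _ _, h⟩, fun l K hl => ⟨l.next (s.obs x), ?_, .single ⟨?_, ?_⟩⟩⟩
    · simp [Stacks.next, hl, stackNext]
    · rw [step_toCfg b f₀ p x l (by simp [hl]) s, hl]; rfl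
    · exact fun i => h _
  | seq _ _ ih₁ ih₂ =>
    obtain ⟨⟨a₁, b₁⟩, c₁⟩ := ih₁ hd hS
    obtain ⟨⟨a₂, b₂⟩, c₂⟩ := ih₂ a₁ b₁
    refine ⟨⟨a₂, b₂⟩, fun l K hl => ?_⟩
    obtain ⟨l₀, h₀, p₀⟩ := one l _ _ (by simp [hl]) rfl hd hS (by rw [hl]; rfl)
    rw [hl] at h₀
    obtain ⟨l₁, h₁, p₁⟩ := c₁ l₀ _ h₀
    obtain ⟨l₂, h₂, p₂⟩ := c₂ l₁ _ h₁
    exact ⟨l₂, h₂, .head p₀ (p₁.trans p₂)⟩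
  | iteTrue ht _ ih =>
    obtain ⟨⟨a₁, b₁⟩, c₁⟩ := ih hd hS
    refine ⟨⟨a₁, b₁⟩, fun l K hl => ?_⟩
    obtain ⟨l₀, h₀, p₀⟩ := one l _ _ (by simp [hl]) rfl hd hS (by rw [hl]; rfl)
    simp only [hl, stackNext, ht, cond_true] at h₀
    obtain ⟨l₁, h₁, p₁⟩ := c₁ l₀ _ h₀
    exact ⟨l₁, h₁, .head p₀ p₁⟩
  | iteFalse ht _ ih =>
    obtain ⟨⟨a₁, b₁⟩, c₁⟩ := ih hd hS
    refine ⟨⟨a₁, b₁⟩, fun l K hl => ?_⟩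
    obtain ⟨l₀, h₀, p₀⟩ := one l _ _ (by simp [hl]) rfl hd hS (by rw [hl]; rfl)
    simp only [hl, stackNext, ht, cond_false] at h₀
    obtain ⟨l₁, h₁, p₁⟩ := c₁ l₀ _ h₀
    exact ⟨l₁, h₁, .head p₀ p₁⟩
  | loopTrue ht _ _ ih₁ ih₂ =>
    obtain ⟨⟨a₁, b₁⟩, c₁⟩ := ih₁ hd hS
    obtain ⟨⟨a₂, b₂⟩, c₂⟩ := ih₂ a₁ b₁
    refine ⟨⟨a₂, b₂⟩, fun l K hl => ?_⟩
    obtain ⟨l₀, h₀, p₀⟩ := one l _ _ (by simp [hl]) rfl hd hS (by rw [hl]; rfl)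
    simp only [hl, stackNext, ht, cond_true] at h₀
    obtain ⟨l₁, h₁, p₁⟩ := c₁ l₀ _ h₀
    obtain ⟨l₂, h₂, p₂⟩ := c₂ l₁ _ h₁
    exact ⟨l₂, h₂, .head p₀ (p₁.trans p₂)⟩
  | loopFalse ht =>
    refine ⟨⟨hd, hS⟩, fun l K hl => ?_⟩
    obtain ⟨l₀, h₀, p₀⟩ := one l _ _ (by simp [hl]) rfl hd hS (by rw [hl]; rfl)
    simp only [hl, stackNext, ht, cond_false] at h₀
    exact ⟨l₀, h₀, .single p₀⟩

theorem compile_outputs {x : List Bool} {S : ℕ} (hS : 0 < S) {d : TData Ω F Γ ι}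
    (h : TExec x S p (TData.init b f₀) d) :
    (compile b f₀ p).Outputs x d.out ∧ (compile b f₀ p).RunsInSpace x S := by
  obtain ⟨-, hp⟩ := exec_path b f₀ p h (Nat.zero_le _) (fun _ => hS)
  obtain ⟨l', hl', hp⟩ := hp ⟨[p], .inr (mem_progStacks_self _ _)⟩ [] rfl
  exact Transducer.outputs_of_path (c := toCfg b f₀ p l' d) _ (fun _ => hS) hp
    (step_toCfg_nil b f₀ p x l' hl' d)

end

end Compile

/-! ### Programs that act on one work tape, on the finite register, or on the output -/

section SingleTape

variable {Ω F Γ ι : Type} [DecidableEq ι]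

/-- Replace the contents of one tape and the position of its head. -/
def TData.setTape (d : TData Ω F Γ ι) (i : ι) (t : ℕ → Γ) (h : ℕ) : TData Ω F Γ ι :=
  { d with tape := Function.update d.tape i t, head := Function.update d.head i h }

/-- The input head and the work heads are in the allowed range. -/
def TData.InRange (x : List Bool) (S : ℕ) (d : TData Ω F Γ ι) : Prop :=
  d.inPos ≤ x.length + 1 ∧ ∀ i, d.head i < S

omit [DecidableEq ι] in
theorem TExec.inRange {x : List Bool} {S : ℕ} {p : TProg Ω F Γ ι} {d d' : TData Ω F Γ ι}
    (h : TExec x S p d d') (hd : d.InRange x S) : d'.InRange x S := by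
  induction h with
  | skip s => exact hd
  | act h => obtain ⟨rfl, h⟩ := h; exact ⟨TData.apply_inPos _ _ _, h⟩
  | seq _ _ ih₁ ih₂ => exact ih₂ (ih₁ hd)
  | iteTrue _ _ ih => exact ih hd
  | iteFalse _ _ ih => exact ih hd
  | loopTrue _ _ _ ih₁ ih₂ => exact ih₂ (ih₁ hd)
  | loopFalse _ => exact hd

theorem TData.setTape_self (d : TData Ω F Γ ι) (i : ι) :
    d.setTape i (d.tape i) (d.head i) = d := by
  simp [TData.setTape]

theorem TData.InRange.setTape {x : List Bool} {S : ℕ} {d : TData Ω F Γ ι} (hd : d.InRange x S)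
    (i : ι) (t : ℕ → Γ) {h : ℕ} (hh : h < S) : (d.setTape i t h).InRange x S := by
  refine ⟨hd.1, fun j => ?_⟩
  by_cases hj : j = i
  · subst hj; simpa [TData.setTape] using hh
  · simpa [TData.setTape, hj] using hd.2 j

/-- Rewrite the scanned cell of tape `i` and move its head. -/
def onTape (i : ι) (f : Γ → Γ) (mv : Move) : TProg Ω F Γ ι :=
  .act fun o => { (o.idle : Effect Ω F Γ ι) with wr := Function.update (o.idle : Effect Ω F Γ ι).wr i (f (o.cell i), mv) }

theorem exec_onTape {x : List Bool} {S : ℕ} {d : TData Ω F Γ ι} (hd : d.InRange x S) (i : ι)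
    (f : Γ → Γ) (mv : Move) (t : ℕ → Γ) {h : ℕ} (hh : mv.apply h < S) :
    TExec x S (onTape i f mv) (d.setTape i t h)
      (d.setTape i (Function.update t h (f (t h))) (mv.apply h)) := by
  refine .act ⟨?_, (hd.setTape i _ hh).2⟩
  simp only [TData.setTape, TData.apply, TData.obs, Obs.idle, Option.toList_none, List.append_nil]
  congr 1
  · exact (min_eq_left hd.1).symm
  · funext j
    by_cases hj : j = i
    · subst hj; simp
    · simp [hj]
  · funext j
    by_cases hj : j = i
    · subst hj; simp
    · simp [hj, Move.apply]

/-- Change the finite register. -/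
def onFin (f : Obs F Γ ι → F) : TProg Ω F Γ ι := .act fun o => { (o.idle : Effect Ω F Γ ι) with fin := f o }

omit [DecidableEq ι] in
theorem exec_onFin {x : List Bool} {S : ℕ} {d : TData Ω F Γ ι} (hd : d.InRange x S)
    (f : Obs F Γ ι → F) :
    TExec x S (onFin f) d { d with fin := f (d.obs x) } := by
  refine .act ⟨?_, hd.2⟩
  simp only [TData.apply, Obs.idle, Option.toList_none, List.append_nil]
  congr 1
  · exact (min_eq_left hd.1).symm
  · funext j; exact (Function.update_eq_self _ _).symm

/-- Append a symbol to the output. -/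
def emitSym (a : Ω) : TProg Ω F Γ ι := .act fun o => { (o.idle : Effect Ω F Γ ι) with emit := some a }

omit [DecidableEq ι] in
theorem exec_emitSym {x : List Bool} {S : ℕ} {d : TData Ω F Γ ι} (hd : d.InRange x S) (a : Ω) :
    TExec x S (emitSym a) d { d with out := d.out ++ [a] } := by
  refine .act ⟨?_, hd.2⟩
  simp only [TData.apply, Obs.idle, Option.toList_some]
  congr 1
  · exact (min_eq_left hd.1).symm
  · funext j; exact (Function.update_eq_self _ _).symm

end SingleTape

/-! ### Binary counters -/

section Counter

variable {Ω F G ι : Type} [DecidableEq ι]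

/-- The value of a little-endian bit string. -/
def bitsVal : List Bool → ℕ
  | [] => 0
  | b :: l => b.toNat + 2 * bitsVal l

def bitsInc : List Bool → List Bool
  | [] => [true]
  | false :: l => true :: l
  | true :: l => false :: bitsInc l

def bitsDec : List Bool → List Bool
  | [] => []
  | true :: l => false :: l
  | false :: l => true :: bitsDec l

theorem bitsVal_inc (l : List Bool) : bitsVal (bitsInc l) = bitsVal l + 1 := by
  induction l with
  | nil => rfl
  | cons b l ih => cases b <;> simp [bitsInc, bitsVal, ih] <;> ring

theorem bitsVal_dec (l : List Bool) (h : 0 < bitsVal l) :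
    bitsVal (bitsDec l) + 1 = bitsVal l := by
  induction l with
  | nil => simp [bitsVal] at h
  | cons b l ih =>
    cases b
    · simp only [bitsVal, Bool.toNat_false, zero_add, bitsDec, Bool.toNat_true] at h ⊢
      have := ih (by omega)
      omega
    · simp [bitsDec, bitsVal, add_comm]

theorem bitsDec_length (l : List Bool) : (bitsDec l).length = l.length := by
  induction l with
  | nil => rfl
  | cons b l ih => cases b <;> simp [bitsDec, ih]

/-- Leading zeros are allowed, so the length is tracked separately from the value. A carry lengthens
only a string of ones, and at length `L` such a string has the value 2^L − 1, which the hypothesis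
excludes. -/
theorem bitsInc_length (l : List Bool) (L : ℕ) (hl : l.length ≤ L) (h : bitsVal l + 1 < 2 ^ L) :
    (bitsInc l).length ≤ L := by
  induction l generalizing L with
  | nil =>
    rcases L with _ | L
    · simp at h
    · simp [bitsInc]
  | cons b l ih =>
    cases b
    · simpa [bitsInc] using hl
    · rcases L with _ | L
      · simp at hl
      · simp only [bitsVal, Bool.toNat_true, pow_succ] at h
        simp only [List.length_cons, add_le_add_iff_right] at hl
        simpa [bitsInc] using ih L hl (by omega)

/-- The tape holding a bit string: cell `0` is blank, the bits follow. -/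
def bitsTape (g : G) (l : List Bool) : ℕ → Option (G × Bool)
  | 0 => none
  | p + 1 => l[p]?.map fun b => (g, b)

theorem bitsTape_update (g : G) (pre l : List Bool) (b c : Bool) :
    Function.update (bitsTape g (pre ++ b :: l)) (pre.length + 1) (some (g, c)) =
      bitsTape g (pre ++ c :: l) := by
  funext p
  rcases p with _ | p
  · simp [Function.update, bitsTape]
  · by_cases hp : p = pre.length
    · subst hp; simp [bitsTape]
    · rw [Function.update_of_ne (by omega)]
      simp only [bitsTape]
      congr 1
      rcases lt_or_gt_of_ne hp with h | h
      · rw [List.getElem?_append_left h, List.getElem?_append_left h]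
      · rw [List.getElem?_append_right h.le, List.getElem?_append_right h.le]
        obtain ⟨k, hk⟩ : ∃ k, p - pre.length = k + 1 := ⟨p - pre.length - 1, by omega⟩
        simp [hk]

theorem bitsTape_update_nil (g : G) (pre : List Bool) (c : Bool) :
    Function.update (bitsTape g pre) (pre.length + 1) (some (g, c)) =
      bitsTape g (pre ++ [c]) := by
  funext p
  rcases p with _ | p
  · simp [Function.update, bitsTape]
  · by_cases hp : p = pre.length
    · subst hp; simp [bitsTape]
    · rw [Function.update_of_ne (by omega)]
      simp only [bitsTape]
      congr 1
      rcases lt_or_gt_of_ne hp with h | h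
      · rw [List.getElem?_append_left h]
      · rw [List.getElem?_append_right h.le, List.getElem?_eq_none h.le,
          List.getElem?_eq_none (by simp; omega)]

theorem bitsTape_get (g : G) (pre l : List Bool) (b : Bool) :
    bitsTape g (pre ++ b :: l) (pre.length + 1) = some (g, b) := by
  simp [bitsTape]

/-- Move the head of a counter back to cell `0`. -/
def rewindCounter (i : ι) : TProg Ω F (Option (G × Bool)) ι :=
  .seq (onTape i id .left) (.loop (fun o => (o.cell i).isSome) (onTape i id .left))

variable {x : List Bool} {S : ℕ} {d : TData Ω F (Option (G × Bool)) ι}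

/-- The blank cell 0 serves as left marker. The first, unconditional move takes care of a head on
the blank cell just behind the last bit, where the loop would stop at once. -/
theorem exec_rewindCounter (hd : d.InRange x S) (i : ι) (g : G) (l : List Bool) (h : ℕ)
    (hl : h ≤ l.length + 1) (hS : l.length < S) :
    TExec x S (rewindCounter i) (d.setTape i (bitsTape g l) h)
      (d.setTape i (bitsTape g l) 0) := by
  have key : ∀ k, k ≤ l.length → TExec x S
      (.loop (fun o => (o.cell i).isSome) (onTape i id .left) : TProg Ω F _ ι)
      (d.setTape i (bitsTape g l) k) (d.setTape i (bitsTape g l) 0) := by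
    intro k
    induction k with
    | zero => intro _; exact .loopFalse (by simp [TData.obs, TData.setTape, bitsTape])
    | succ k ih =>
      intro hk
      refine .loopTrue ?_ ?_ (ih (by omega))
      · simp [TData.obs, TData.setTape, bitsTape]; omega
      · have := exec_onTape hd i id .left (bitsTape g l) (h := k + 1)
          (by simp [Move.apply]; omega)
        simpa [Move.apply] using this
  refine .seq (s' := d.setTape i (bitsTape g l) (h - 1)) ?_ (key _ (by omega))
  have := exec_onTape hd i id .left (bitsTape g l) (h := h) (by simp [Move.apply]; omega)
  simpa [Move.apply] using this

/-- Increment a counter. -/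
def incCounter (g : G) (i : ι) : TProg Ω F (Option (G × Bool)) ι :=
  .seq (onTape i id .right)
    (.seq (.seq (.loop (fun o => (o.cell i).any (·.2)) (onTape i (fun _ => some (g, false)) .right))
      (onTape i (fun _ => some (g, true)) .stay))
      (rewindCounter i))

theorem exec_incCounter (hd : d.InRange x S) (i : ι) (g : G) (l : List Bool)
    (hS : (bitsInc l).length + 1 < S) (hS' : l.length + 1 < S) :
    TExec x S (incCounter g i) (d.setTape i (bitsTape g l) 0)
      (d.setTape i (bitsTape g (bitsInc l)) 0) := by
  -- Here `pre` is the part already passed by the carry and `l` the part still to be incremented.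
  have key : ∀ (l pre : List Bool), (pre ++ bitsInc l).length + 1 < S →
      (pre ++ l).length + 1 < S → ∃ h ≤ (pre ++ bitsInc l).length,
      TExec x S (.seq (.loop (fun o => (o.cell i).any (·.2))
          (onTape i (fun _ => some (g, false)) .right))
        (onTape i (fun _ => some (g, true)) .stay))
      (d.setTape i (bitsTape g (pre ++ l)) (pre.length + 1))
      (d.setTape i (bitsTape g (pre ++ bitsInc l)) h) := by
    intro l
    induction l with
    | nil =>
      intro pre h₁ h₂
      refine ⟨pre.length + 1, by simp [bitsInc],
        .seq (.loopFalse ?_) ?_⟩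
      · simp [TData.obs, TData.setTape, bitsTape]
      · have := exec_onTape hd i (fun _ => some (g, true)) .stay (bitsTape g pre)
          (h := pre.length + 1) (by simp [Move.apply] at h₂ ⊢; omega)
        rw [bitsTape_update_nil] at this
        simpa [Move.apply, bitsInc] using this
    | cons b l ih =>
      intro pre h₁ h₂
      have hlt : pre.length + 1 + 1 < S := by
        simp only [List.length_append, List.length_cons] at h₂; omega
      cases b
      · refine ⟨pre.length + 1, by simp [bitsInc], .seq (.loopFalse ?_) ?_⟩
        · simp [TData.obs, TData.setTape, bitsTape_get]
        · have := exec_onTape hd i (fun _ => some (g, true)) .stay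
            (bitsTape g (pre ++ false :: l)) (h := pre.length + 1)
            (by simp [Move.apply] at hlt ⊢; omega)
          rw [bitsTape_update] at this
          simpa [Move.apply, bitsInc] using this
      · obtain ⟨h, hh, e⟩ := ih (pre ++ [false]) (by simpa [bitsInc] using h₁) (by simpa using h₂)
        have hw := exec_onTape hd i (fun _ => some (g, false)) .right
            (bitsTape g (pre ++ true :: l)) (h := pre.length + 1)
            (by simpa [Move.apply] using hlt)
        rw [bitsTape_update] at hw
        simp only [List.append_assoc, List.singleton_append, List.length_append,
          List.length_singleton] at e hh
        refine ⟨h, by simpa [bitsInc] using hh, ?_⟩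
        cases e with
        | seq e₁ e₂ =>
          refine .seq (.loopTrue ?_ hw e₁) e₂
          simp [TData.obs, TData.setTape, bitsTape_get]
  obtain ⟨h, hh, e⟩ := key l [] (by simpa using hS) (by simpa using hS')
  simp only [List.nil_append, List.length_nil, zero_add] at e hh
  refine .seq (s' := d.setTape i (bitsTape g l) 1) ?_ (.seq e ?_)
  · have := exec_onTape hd i id .right (bitsTape g l) (h := 0) (by simp [Move.apply]; omega)
    simpa [Move.apply] using this
  · exact exec_rewindCounter hd i g _ h (by omega) (by omega)

/-- Decrement a positive counter. -/
def decCounter (g : G) (i : ι) : TProg Ω F (Option (G × Bool)) ι :=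
  .seq (onTape i id .right)
    (.seq (.seq (.loop (fun o => (o.cell i).any (! ·.2))
        (onTape i (fun _ => some (g, true)) .right))
      (onTape i (fun _ => some (g, false)) .stay))
      (rewindCounter i))

/-- Positivity provides a digit 1 at which the borrow stops; the length of the string does not
change. -/
theorem exec_decCounter (hd : d.InRange x S) (i : ι) (g : G) (l : List Bool)
    (hS : l.length + 1 < S) (hl : 0 < bitsVal l) :
    TExec x S (decCounter g i) (d.setTape i (bitsTape g l) 0)
      (d.setTape i (bitsTape g (bitsDec l)) 0) := by
  have key : ∀ (l pre : List Bool), 0 < bitsVal l →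
      (pre ++ l).length + 1 < S → ∃ h ≤ (pre ++ l).length,
      TExec x S (.seq (.loop (fun o => (o.cell i).any (! ·.2))
          (onTape i (fun _ => some (g, true)) .right))
        (onTape i (fun _ => some (g, false)) .stay))
      (d.setTape i (bitsTape g (pre ++ l)) (pre.length + 1))
      (d.setTape i (bitsTape g (pre ++ bitsDec l)) h) := by
    intro l
    induction l with
    | nil => intro pre h; simp [bitsVal] at h
    | cons b l ih =>
      intro pre h₁ h₂
      have hlt : pre.length + 1 + 1 < S := by
        simp only [List.length_append, List.length_cons] at h₂; omega
      cases b
      · obtain ⟨h, hh, e⟩ := ih (pre ++ [true]) (by simpa [bitsVal] using h₁) (by simpa using h₂)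
        have hw := exec_onTape hd i (fun _ => some (g, true)) .right
            (bitsTape g (pre ++ false :: l)) (h := pre.length + 1)
            (by simpa [Move.apply] using hlt)
        rw [bitsTape_update] at hw
        simp only [List.append_assoc, List.singleton_append, List.length_append,
          List.length_singleton] at e hh
        refine ⟨h, by simpa using hh, ?_⟩
        cases e with
        | seq e₁ e₂ =>
          refine .seq (.loopTrue ?_ hw e₁) e₂
          simp [TData.obs, TData.setTape, bitsTape_get]
      · refine ⟨pre.length + 1, by simp, .seq (.loopFalse ?_) ?_⟩
        · simp [TData.obs, TData.setTape, bitsTape_get]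
        · have := exec_onTape hd i (fun _ => some (g, false)) .stay
            (bitsTape g (pre ++ true :: l)) (h := pre.length + 1)
            (by simp [Move.apply] at hlt ⊢; omega)
          rw [bitsTape_update] at this
          simpa [Move.apply, bitsDec] using this
  obtain ⟨h, hh, e⟩ := key l [] hl (by simpa using hS)
  simp only [List.nil_append, List.length_nil, zero_add] at e hh
  refine .seq (s' := d.setTape i (bitsTape g l) 1) ?_ (.seq e ?_)
  · have := exec_onTape hd i id .right (bitsTape g l) (h := 0) (by simp [Move.apply]; omega)
    simpa [Move.apply] using this
  · exact exec_rewindCounter hd i g _ h (by rw [bitsDec_length]; omega)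
      (by rw [bitsDec_length]; omega)

/-- Find out whether a counter is zero. -/
def zeroCounter (i : ι) (f : F → Bool → F) : TProg Ω F (Option (G × Bool)) ι :=
  .seq (onTape i id .right)
    (.seq (.seq (.loop (fun o => (o.cell i).any (! ·.2)) (onTape i id .right))
      (onFin fun o => f o.fin (! (o.cell i).any (·.2))))
      (rewindCounter i))

/-- The head skips zeros: it stops on a 1 if the value is positive, and on the blank behind the
string otherwise. -/
theorem exec_zeroCounter (hd : d.InRange x S) (i : ι) (f : F → Bool → F) (g : G) (l : List Bool)
    (hS : l.length + 1 < S) :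
    TExec x S (zeroCounter i f) (d.setTape i (bitsTape g l) 0)
      ({ d with fin := f d.fin (decide (bitsVal l = 0)) }.setTape i (bitsTape g l) 0) := by
  have key : ∀ (l pre : List Bool), (pre ++ l).length + 1 < S → ∃ h ≤ (pre ++ l).length + 1,
      TExec x S (.seq (.loop (fun o => (o.cell i).any (! ·.2)) (onTape i id .right))
        (onFin fun o => f o.fin (! (o.cell i).any (·.2))))
      (d.setTape i (bitsTape g (pre ++ l)) (pre.length + 1))
      ({ d with fin := f d.fin (decide (bitsVal l = 0)) }.setTape i (bitsTape g (pre ++ l)) h) := by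
    intro l
    induction l with
    | nil =>
      intro pre h₁
      refine ⟨pre.length + 1, by simp, .seq (.loopFalse ?_) ?_⟩
      · simp [TData.obs, TData.setTape, bitsTape]
      · have := exec_onFin (hd.setTape i (bitsTape g (pre ++ [])) (h := pre.length + 1)
          (by simpa using h₁)) fun o => f o.fin (! (o.cell i).any (·.2))
        convert this using 1
        simp [TData.obs, TData.setTape, bitsTape, bitsVal]
    | cons b l ih =>
      intro pre h₁
      have hlt : pre.length + 1 + 1 < S := by
        simp only [List.length_append, List.length_cons] at h₁; omega
      cases b
      · obtain ⟨h, hh, e⟩ := ih (pre ++ [false]) (by simpa using h₁)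
        have hw := exec_onTape hd i id .right
            (bitsTape g (pre ++ false :: l)) (h := pre.length + 1)
            (by simpa [Move.apply] using hlt)
        simp only [Function.update_eq_self, id] at hw
        simp only [List.append_assoc, List.singleton_append, List.length_append,
          List.length_singleton] at e hh
        refine ⟨h, by simpa using hh, ?_⟩
        have hv : bitsVal (false :: l) = 0 ↔ bitsVal l = 0 := by simp [bitsVal]
        simp only [hv]
        cases e with
        | seq e₁ e₂ =>
          refine .seq (.loopTrue ?_ hw e₁) e₂
          simp [TData.obs, TData.setTape, bitsTape_get]
      · refine ⟨pre.length + 1, by simp, .seq (.loopFalse ?_) ?_⟩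
        · simp [TData.obs, TData.setTape, bitsTape_get]
        · have := exec_onFin (hd.setTape i (bitsTape g (pre ++ true :: l)) (h := pre.length + 1)
            (by omega)) fun o => f o.fin (! (o.cell i).any (·.2))
          convert this using 1
          simp [TData.obs, TData.setTape, bitsTape, bitsVal]
  obtain ⟨h, hh, e⟩ := key l [] (by simpa using hS)
  simp only [List.nil_append, List.length_nil, zero_add] at e hh
  refine .seq (s' := d.setTape i (bitsTape g l) 1) ?_ (.seq e ?_)
  · have := exec_onTape hd i id .right (bitsTape g l) (h := 0) (by simp [Move.apply]; omega)
    simpa [Move.apply] using this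
  · exact exec_rewindCounter (d := { d with fin := f d.fin (decide (bitsVal l = 0)) }) hd i g _ h
      (by omega) (by omega)

end Counter

/-! ### Rerunning a transducer inside a tape program -/

/-- The finite register of a program that simulates the transducer `M`. -/
structure Ctl {Ω : Type} (M : Transducer Ω) where
  q : M.Q
  pend : Option Ω
  tok : Option Ω
  flag : Bool
  done : Bool

instance {Ω : Type} [Finite Ω] (M : Transducer Ω) : Finite (Ctl M) := by
  have := M.finQ
  refine Finite.of_injective
    (fun c : Ctl M => ((c.q, c.pend, c.tok, c.flag, c.done) :
      M.Q × Option Ω × Option Ω × Bool × Bool)) ?_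
  rintro ⟨a, b, c, d, e⟩ ⟨a', b', c', d', e'⟩ h
  simpa using h

section

variable {Ω Ω' ρ : Type} (M : Transducer Ω)

/-- The data of a program that simulates `M` and has counters `Option ρ`. -/
abbrev SData (Ω' ρ : Type) (M : Transducer Ω) :=
  TData Ω' (Ctl M) (Option (M.Γ × Bool)) (Fin M.k ⊕ Option ρ)

abbrev SProg (Ω' ρ : Type) (M : Transducer Ω) :=
  TProg Ω' (Ctl M) (Option (M.Γ × Bool)) (Fin M.k ⊕ Option ρ)

/-- A simulated tape: the cells visited so far hold the symbol and a mark on cell `0`. -/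
def markedTape {Γ : Type} (t : ℕ → Γ) (v : ℕ) : ℕ → Option (Γ × Bool) :=
  fun p => if p < v then some (t p, decide (p = 0)) else none

/-- The data `d` represent the configuration `cfg` of `M` and the counter values `c`. -/
structure Sim (x : List Bool) (V L : ℕ) (cfg : M.Cfg) (c : Option ρ → ℕ) (d : SData Ω' ρ M) :
    Prop where
  state : d.fin.q = cfg.state
  inPos : d.inPos = cfg.inPos
  inPos_le : cfg.inPos ≤ x.length + 1
  tape : ∀ i, ∃ v, 0 < v ∧ v ≤ V ∧ cfg.head i ≤ v ∧
    d.tape (.inl i) = markedTape (cfg.tape i) v ∧ ∀ p, v ≤ p → cfg.tape i p = M.blank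
  head : ∀ i, d.head (.inl i) = cfg.head i
  ctr : ∀ r, ∃ l, l.length ≤ L ∧ bitsVal l = c r ∧ d.tape (.inr r) = bitsTape M.blank l
  ctrHead : ∀ r, d.head (.inr r) = 0

variable {M} {x : List Bool} {V L S : ℕ} {cfg : M.Cfg} {c : Option ρ → ℕ}
  {d : SData Ω' ρ M}

theorem Sim.inRange (h : Sim M x V L cfg c d) (hV : V < S) (hL : L + 1 < S) :
    d.InRange x S := by
  refine ⟨h.inPos ▸ h.inPos_le, fun i => ?_⟩
  rcases i with i | r
  · obtain ⟨v, -, h₁, h₂, -⟩ := h.tape i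
    rw [h.head i]; omega
  · rw [h.ctrHead r]; omega

theorem Sim.congr (h : Sim M x V L cfg c d) {f : Ctl M} (hf : f.q = d.fin.q)
    (out : List Ω') : Sim M x V L cfg c { d with fin := f, out := out } :=
  ⟨hf.trans h.state, h.inPos, h.inPos_le, h.tape, h.head, h.ctr, h.ctrHead⟩

variable [DecidableEq ρ]

theorem Sim.setCounter (h : Sim M x V L cfg c d) (r : Option ρ) {l : List Bool}
    (hl : l.length ≤ L) : Sim M x V L cfg (Function.update c r (bitsVal l))
      (d.setTape (.inr r) (bitsTape M.blank l) 0) := by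
  refine ⟨h.state, h.inPos, h.inPos_le, fun i => ?_, fun i => ?_, fun r' => ?_, fun r' => ?_⟩
  · simpa [TData.setTape] using h.tape i
  · simpa [TData.setTape] using h.head i
  · by_cases hr : r' = r
    · subst hr; exact ⟨l, hl, by simp, by simp [TData.setTape]⟩
    · simpa [TData.setTape, hr] using h.ctr r'
  · by_cases hr : r' = r
    · subst hr; simp [TData.setTape]
    · simpa [TData.setTape, hr] using h.ctrHead r'

theorem Sim.eq_setTape (h : Sim M x V L cfg c d) (r : Option ρ) :
    ∃ l, l.length ≤ L ∧ bitsVal l = c r ∧ d = d.setTape (.inr r) (bitsTape M.blank l) 0 := by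
  obtain ⟨l, hl, hv, ht⟩ := h.ctr r
  refine ⟨l, hl, hv, ?_⟩
  rw [← ht, ← h.ctrHead r, TData.setTape_self]

theorem Sim.inc (h : Sim M x V L cfg c d) (hV : V < S) (hL : L + 1 < S) (r : Option ρ)
    (hr : c r + 1 < 2 ^ L) : ∃ d', TExec x S (incCounter M.blank (.inr r)) d d' ∧
      Sim M x V L cfg (Function.update c r (c r + 1)) d' ∧ d'.fin = d.fin ∧ d'.out = d.out := by
  obtain ⟨l, hl, hv, hd⟩ := h.eq_setTape r
  have hi := bitsInc_length l L hl (by omega)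
  have e := exec_incCounter (S := S) (h.inRange hV hL) (.inr r) M.blank l (by omega) (by omega)
  rw [← hd] at e
  refine ⟨_, e, ?_, rfl, rfl⟩
  · rw [← hv, ← bitsVal_inc]; exact h.setCounter r hi

theorem Sim.dec (h : Sim M x V L cfg c d) (hV : V < S) (hL : L + 1 < S) (r : Option ρ)
    (hr : 0 < c r) : ∃ d', TExec x S (decCounter M.blank (.inr r)) d d' ∧
      Sim M x V L cfg (Function.update c r (c r - 1)) d' ∧ d'.fin = d.fin ∧ d'.out = d.out := by
  obtain ⟨l, hl, hv, hd⟩ := h.eq_setTape r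
  have hi := bitsVal_dec l (by omega)
  have e := exec_decCounter (S := S) (h.inRange hV hL) (.inr r) M.blank l (by omega) (by omega)
  rw [← hd] at e
  refine ⟨_, e, ?_, rfl, rfl⟩
  · rw [show c r - 1 = bitsVal (bitsDec l) by omega]
    exact h.setCounter r (by rw [bitsDec_length]; exact hl)

/-- Test whether the counter `r` is zero. -/
def testZero (M : Transducer Ω) (r : Option ρ) : SProg Ω' ρ M :=
  zeroCounter (.inr r) fun f b => { f with flag := b }

theorem Sim.zero (h : Sim M x V L cfg c d) (hV : V < S) (hL : L + 1 < S) (r : Option ρ) :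
    ∃ d', TExec x S (testZero M r) d d' ∧ Sim M x V L cfg c d' ∧
      d'.fin = { d.fin with flag := decide (c r = 0) } ∧ d'.out = d.out := by
  obtain ⟨l, hl, hv, hd⟩ := h.eq_setTape r
  have e := exec_zeroCounter (S := S) (h.inRange hV hL) (.inr r)
    (fun (f : Ctl M) b => { f with flag := b }) M.blank l (by omega)
  rw [← hd, hv] at e
  refine ⟨_, e, ?_, rfl, rfl⟩
  have := (h.congr (f := { d.fin with flag := decide (c r = 0) }) rfl d.out).setCounter r hl
  rwa [hv, Function.update_eq_self] at this

/-- One step of the simulated machine. -/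
def simStep (M : Transducer Ω) : SProg Ω' ρ M :=
  .act fun o =>
    match M.δ o.fin.q o.sym fun i => (o.cell (.inl i)).elim M.blank (·.1) with
    | none => { (o.idle : Effect _ _ _ _) with fin := { o.fin with done := true, tok := none } }
    | some (q, mv, w, a) =>
      { fin := { o.fin with q := q, pend := a }
        mv := mv
        wr := Sum.elim (fun i => (some ((w i).1, (o.cell (.inl i)).elim false (·.2)), (w i).2))
          (fun r => (o.cell (.inr r), .stay))
        emit := none }

-- A cell that was never visited holds `none` and is read as a blank, which is right because the
-- simulated tape is blank from `v` on.
omit [DecidableEq ρ] in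
theorem Sim.cell (h : Sim M x V L cfg c d) (i : Fin M.k) :
    (d.tape (.inl i) (d.head (.inl i))).elim M.blank (·.1) = cfg.tape i (cfg.head i) := by
  obtain ⟨v, -, -, -, ht, hb⟩ := h.tape i
  rw [h.head, ht, markedTape]
  split_ifs with hp
  · rfl
  · exact (hb _ (by omega)).symm

omit [DecidableEq ρ] in
theorem Sim.step_none (h : Sim M x V L cfg c d) (hV : V < S) (hL : L + 1 < S)
    (hs : M.step x cfg = none) : ∃ d', TExec x S (simStep M) d d' ∧ Sim M x V L cfg c d' ∧
      d'.fin = { d.fin with done := true, tok := none } ∧ d'.out = d.out := by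
  have hδ : M.δ d.fin.q (inputCell x d.inPos)
      (fun i => (d.tape (.inl i) (d.head (.inl i))).elim M.blank (·.1)) = none := by
    simp only [h.cell, h.state, h.inPos]
    unfold Transducer.step at hs
    split at hs
    · assumption
    · cases hs
  have e := exec_onFin (S := S) (h.inRange hV hL)
    fun o => { o.fin with done := true, tok := none }
  refine ⟨{ d with fin := { d.fin with done := true, tok := none } }, ?_,
    h.congr (f := { d.fin with done := true, tok := none }) rfl d.out, rfl, rfl⟩
  cases e with
  | act ha =>
    refine .act ⟨ha.1.trans ?_, ha.2⟩
    simp only [TData.obs, hδ]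

omit [DecidableEq ρ] in
theorem Sim.step_some (h : Sim M x V L cfg c d) (hV : V < S) (hL : L + 1 < S) {cfg' : M.Cfg}
    (hs : M.step x cfg = some cfg') (hb : ∀ i, cfg.head i < V) (hb' : ∀ i, cfg'.head i < V) :
    ∃ d' a, TExec x S (simStep M) d d' ∧ Sim M x V L cfg' c d' ∧
      d'.fin = { d.fin with q := cfg'.state, pend := a } ∧ d'.out = d.out ∧
      cfg'.out = cfg.out ++ a.toList := by
  unfold Transducer.step at hs
  split at hs
  · cases hs
  rename_i q mv w a hδ
  have hδ' : M.δ d.fin.q (inputCell x d.inPos)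
      (fun i => (d.tape (.inl i) (d.head (.inl i))).elim M.blank (·.1)) = some (q, mv, w, a) := by
    simp only [h.cell, h.state, h.inPos, hδ]
  simp only [Option.some.injEq] at hs
  subst hs
  let E : Effect Ω' (Ctl M) (Option (M.Γ × Bool)) (Fin M.k ⊕ Option ρ) :=
    { fin := { d.fin with q := q, pend := a }
      mv := mv
      wr := Sum.elim (fun i => (some ((w i).1,
          (d.tape (.inl i) (d.head (.inl i))).elim false (·.2)), (w i).2))
        (fun r => (d.tape (.inr r) (d.head (.inr r)), .stay))
      emit := none }
  refine ⟨d.apply x E, a, .act ⟨by simp only [TData.obs, hδ', E], ?_⟩,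
    ⟨rfl, ?_, min_le_right _ _, ?_, ?_, ?_, ?_⟩, rfl, ?_, rfl⟩
  · simp only [E, TData.apply]
    rintro (i | r)
    · simp only [Sum.elim_inl, h.head]; have := hb' i; simp only at this; omega
    · simp only [Sum.elim_inr, h.ctrHead, Move.apply]; omega
  · simp only [E, TData.apply, h.inPos]
  · intro i
    obtain ⟨v, h₀, h₁, h₂, ht, hbl⟩ := h.tape i
    have hlt := hb i
    -- Writing the scanned cell makes it visited. The head was at most at `v`, so the visited cells
    -- still form a prefix, and the head can again be at most one cell beyond it.
    refine ⟨max v (cfg.head i + 1), by omega, by omega, ?_, ?_, ?_⟩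
    · simp only
      cases (w i).2 <;> simp only [Move.apply] <;> omega
    · simp only [E, TData.apply, Sum.elim_inl, h.head, ht]
      funext p
      by_cases hp : p = cfg.head i
      · subst hp
        simp only [Function.update_self, markedTape]
        rw [if_pos (show cfg.head i < max v (cfg.head i + 1) by omega)]
        congr 2
        split_ifs with h₃
        · rfl
        · simp; omega
      · simp only [Function.update_of_ne hp, markedTape]
        congr 1
        simp only [eq_iff_iff]; omega
    · intro p hp
      have h₃ : p ≠ cfg.head i := by omega
      simp only [Function.update_of_ne h₃]
      exact hbl p (by omega)
  · intro i
    simp only [E, TData.apply, Sum.elim_inl, h.head]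
  · intro r
    obtain ⟨l, hl, hv, ht⟩ := h.ctr r
    refine ⟨l, hl, hv, ?_⟩
    simp only [E, TData.apply, Sum.elim_inr, Function.update_eq_self, ht]
  · intro r
    simp only [E, TData.apply, Sum.elim_inr, h.ctrHead, Move.apply]
  · simp only [E, TData.apply, Option.toList_none, List.append_nil]

/-! #### Resetting the simulated machine -/

/-- Erase a simulated tape and move its head to cell `0`. -/
def resetTape {F Γ ι : Type} [DecidableEq ι] (b : Γ) (i : ι) :
    TProg Ω' F (Option (Γ × Bool)) ι :=
  .seq (.loop (fun o => (o.cell i).isSome) (onTape i id .right))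
    (.seq (onTape i id .left)
      (.seq (.loop (fun o => (o.cell i).all (! ·.2)) (onTape i (fun _ => none) .left))
        (onTape i (fun _ => some (b, true)) .stay)))

/-- The visited cells form a prefix, so its right end can be found; from there the tape is erased
leftwards. The mark in cell 0 is needed because a machine cannot otherwise notice the left end of a
tape. -/
theorem exec_resetTape {F Γ ι : Type} [DecidableEq ι] (b : Γ) (i : ι)
    {d : TData Ω' F (Option (Γ × Bool)) ι} (hd : d.InRange x S) (t : ℕ → Γ) {v h : ℕ}
    (hv : 0 < v) (hvS : v < S) (hh : h ≤ v) :
    TExec x S (resetTape b i) (d.setTape i (markedTape t v) h)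
      (d.setTape i (markedTape (fun _ => b) 1) 0) := by
  have right : ∀ k h, k + h = v → TExec x S
      (.loop (fun o => (o.cell i).isSome) (onTape i id .right) : TProg Ω' F _ ι)
      (d.setTape i (markedTape t v) h) (d.setTape i (markedTape t v) v) := by
    intro k
    induction k with
    | zero =>
      intro h hk
      obtain rfl : h = v := by omega
      exact .loopFalse (by simp [TData.obs, TData.setTape, markedTape])
    | succ k ih =>
      intro h hk
      refine .loopTrue ?_ ?_ (ih (h + 1) (by omega))
      · simp [TData.obs, TData.setTape, markedTape]; omega
      · have := exec_onTape hd i id .right (markedTape t v) (h := h)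
          (by simp [Move.apply]; omega)
        simpa [Move.apply] using this
  have left : ∀ k, k < v → TExec x S
      (.seq (.loop (fun o => (o.cell i).all (! ·.2)) (onTape i (fun _ => none) .left))
        (onTape i (fun _ => some (b, true)) .stay) : TProg Ω' F _ ι)
      (d.setTape i (markedTape t (k + 1)) k)
      (d.setTape i (markedTape (fun _ => b) 1) 0) := by
    intro k
    induction k with
    | zero =>
      intro _
      refine .seq (.loopFalse ?_) ?_
      · simp [TData.obs, TData.setTape, markedTape]
      · have := exec_onTape hd i (fun _ => some (b, true)) .stay (markedTape t 1) (h := 0)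
          (by simp [Move.apply]; omega)
        have e : Function.update (markedTape t 1) 0 (some (b, true)) =
            markedTape (fun _ => b) 1 := by
          funext p
          rcases p with _ | p <;> simp [markedTape, Function.update]
        rw [e] at this
        exact this
    | succ k ih =>
      intro hk
      have := exec_onTape hd i (fun _ => none) .left (markedTape t (k + 1 + 1)) (h := k + 1)
        (by simp [Move.apply]; omega)
      have e : Function.update (markedTape t (k + 1 + 1)) (k + 1) none =
          markedTape t (k + 1) := by
        funext p
        by_cases hp : p = k + 1
        · subst hp; simp [markedTape]
        · simp only [Function.update_of_ne hp, markedTape]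
          congr 1
          simp only [eq_iff_iff]; omega
      rw [e] at this
      cases ih (by omega) with
      | seq e₁ e₂ =>
        refine .seq (.loopTrue ?_ this e₁) e₂
        simp [TData.obs, TData.setTape, markedTape]
  obtain ⟨k, rfl⟩ : ∃ k, v = k + 1 := ⟨v - 1, by omega⟩
  refine .seq (right (k + 1 - h) h (by omega)) (.seq ?_ (left k (by omega)))
  have := exec_onTape hd i id .left (markedTape t (k + 1)) (h := k + 1)
    (by simp [Move.apply]; omega)
  simpa [Move.apply] using this

/-- Run a program for every element of a list. -/
def Prog.forList {A T α : Type} (f : α → Prog A T) (l : List α) : Prog A T :=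
  l.foldr (fun a p => .seq (f a) p) .skip

theorem exec_resetTapes (hV : V < S) (l : List (Fin M.k)) (hd : d.InRange x S)
    (ht : ∀ i, ∃ t v, 0 < v ∧ v ≤ V ∧ d.head (.inl i) ≤ v ∧ d.tape (.inl i) = markedTape t v) :
    ∃ d' : SData Ω' ρ M, TExec x S (Prog.forList (fun i => resetTape M.blank (.inl i)) l) d d' ∧
      d'.fin = d.fin ∧ d'.inPos = d.inPos ∧ d'.out = d.out ∧
      (∀ i, i ∈ l ∨ (d.tape (.inl i) = markedTape (fun _ => M.blank) 1 ∧ d.head (.inl i) = 0) →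
        d'.tape (.inl i) = markedTape (fun _ => M.blank) 1 ∧ d'.head (.inl i) = 0) ∧
      ∀ r, d'.tape (.inr r) = d.tape (.inr r) ∧ d'.head (.inr r) = d.head (.inr r) := by
  induction l generalizing d with
  | nil => exact ⟨d, .skip d, rfl, rfl, rfl, fun i hi => by simpa using hi, fun r => ⟨rfl, rfl⟩⟩
  | cons j l ih =>
    obtain ⟨t, v, hv, hvV, hh, hj⟩ := ht j
    have e := exec_resetTape (Ω' := Ω') M.blank (.inl j) hd t hv (hvV.trans_lt hV) hh
    rw [← hj, TData.setTape_self] at e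
    have same : ∀ i, (d.setTape (.inl j) (markedTape (fun _ => M.blank) 1) 0).tape (.inl i) =
          (if i = j then markedTape (fun _ => M.blank) 1 else d.tape (.inl i)) ∧
        (d.setTape (.inl j) (markedTape (fun _ => M.blank) 1) 0).head (.inl i) =
          (if i = j then 0 else d.head (.inl i)) := by
      intro i
      by_cases hi : i = j
      · subst hi; simp [TData.setTape]
      · simp [TData.setTape, hi]
    obtain ⟨d', e', h₁, h₂, h₃, h₄, h₅⟩ := ih
      (d := d.setTape (.inl j) (markedTape (fun _ => M.blank) 1) 0) (e.inRange hd) (by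
        intro i
        rw [(same i).1, (same i).2]
        split_ifs with hi
        · exact ⟨_, 1, one_pos, by omega, by omega, rfl⟩
        · exact ht i)
    refine ⟨d', .seq e e', h₁, h₂, h₃, fun i hi => h₄ i ?_, fun r => ?_⟩
    · rw [(same i).1, (same i).2]
      by_cases hij : i = j
      · simp [hij]
      · simpa [hij] using hi
    · simpa [TData.setTape] using h₅ r

/-- Bring the simulated machine back to its initial configuration. -/
def resetSim (M : Transducer Ω) : SProg Ω' ρ M :=
  .seq (.loop (fun o => match o.sym with | .leftEnd => false | _ => true)
      (.act fun o => { (o.idle : Effect _ _ _ _) with mv := .left }))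
    (.seq (Prog.forList (fun i => resetTape M.blank (.inl i)) (List.finRange M.k))
      (onFin fun o => { o.fin with q := M.start, pend := none, done := false }))

theorem Sim.reset (h : Sim M x V L cfg c d) (hV : V < S) (hL : L + 1 < S) :
    ∃ d', TExec x S (resetSim M) d d' ∧ Sim M x V L M.init c d' ∧
      d'.fin = { d.fin with q := M.start, pend := none, done := false } ∧ d'.out = d.out := by
  have hd := h.inRange hV hL
  have left : ∀ p, p ≤ x.length + 1 → TExec x S
      (.loop (fun o => match o.sym with | .leftEnd => false | _ => true)
        (.act fun o => { (o.idle : Effect _ _ _ _) with mv := .left }) : SProg Ω' ρ M)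
      { d with inPos := p } { d with inPos := 0 } := by
    intro p
    induction p with
    | zero => intro _; exact .loopFalse (by simp [TData.obs, inputCell])
    | succ p ih =>
      intro hp
      refine .loopTrue (s' := { d with inPos := p }) ?_ (.act ⟨?_, hd.2⟩) (ih (by omega))
      · simp only [TData.obs, inputCell]
        cases x[p]? <;> rfl
      · simp only [TData.apply, Obs.idle, TData.obs, Option.toList_none, List.append_nil,
          Move.apply]
        congr 1
        · omega
        · funext i; simp
  have e₁ := left d.inPos (h.inPos ▸ h.inPos_le)
  obtain ⟨d', e₂, h₁, h₂, h₃, h₄, h₅⟩ := exec_resetTapes (M := M) (d := { d with inPos := 0 })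
    (S := S) (V := V) (x := x) hV (List.finRange M.k) ⟨Nat.zero_le _, hd.2⟩ (by
      intro i
      obtain ⟨v, a₁, a₂, a₃, a₄, -⟩ := h.tape i
      exact ⟨_, v, a₁, a₂, (h.head i).symm ▸ a₃, a₄⟩)
  have e₃ := exec_onFin (e₂.inRange ⟨Nat.zero_le _, hd.2⟩) fun o =>
    { o.fin with q := M.start, pend := none, done := false }
  refine ⟨_, .seq e₁ (.seq e₂ e₃), ⟨rfl, h₂, Nat.zero_le _, fun i => ?_, fun i => ?_, fun r => ?_,
    fun r => ?_⟩, ?_, h₃⟩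
  · obtain ⟨v, a₁, a₂, -⟩ := h.tape i
    exact ⟨1, one_pos, by omega, Nat.zero_le _, (h₄ i (.inl (List.mem_finRange i))).1,
      fun _ _ => rfl⟩
  · exact (h₄ i (.inl (List.mem_finRange i))).2
  · obtain ⟨l, a₁, a₂, a₃⟩ := h.ctr r
    exact ⟨l, a₁, a₂, (h₅ r).1.trans a₃⟩
  · exact (h₅ r).2.trans (h.ctrHead r)
  · simp only [TData.obs, h₁]

/-! #### Looking up a symbol of the output of the simulated machine -/

/-- `pend` holds the symbol emitted by the last simulated step. While `r` is positive the symbol is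
skipped and a unit moves from `r` to the auxiliary counter `none`, so that their sum remembers the
sought position; at `r = 0` the symbol is the sought one. -/
def lookupBody (M : Transducer Ω) (r : ρ) : SProg Ω' ρ M :=
  .seq (simStep M) (.ite (fun o => o.fin.pend.isSome)
    (.seq (testZero M (some r)) (.seq
      (.ite (fun o => o.fin.flag)
        (onFin fun o => { o.fin with tok := o.fin.pend, done := true })
        (.seq (decCounter M.blank (.inr (some r))) (incCounter M.blank (.inr none))))
      (onFin fun o => { o.fin with pend := none }))) .skip)

def lookupRestore (M : Transducer Ω) (r : ρ) : SProg Ω' ρ M :=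
  .seq (testZero M none) (.loop (fun o => ! o.fin.flag)
    (.seq (decCounter M.blank (.inr none)) (.seq (incCounter M.blank (.inr (some r)))
      (testZero M none))))

/-- Put the symbol of the output of `M` whose position is the value of the counter `r` into the
register `tok`. -/
def lookup (M : Transducer Ω) (r : ρ) : SProg Ω' ρ M :=
  .seq (resetSim M) (.seq (.loop (fun o => ! o.fin.done) (lookupBody M r)) (lookupRestore M r))

-- Output is never erased: a symbol found in the middle of a run keeps its position in the final
-- output.
omit [DecidableEq ρ] in
theorem Transducer.reaches_out (M : Transducer Ω) {a b : M.Cfg}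
    (h : StateTransition.Reaches (M.step x) a b) : ∃ w, b.out = a.out ++ w := by
  induction h using Relation.ReflTransGen.head_induction_on with
  | refl => exact ⟨[], by simp⟩
  | head h₁ _ ih =>
    obtain ⟨w, hw⟩ := ih
    unfold Transducer.step at h₁
    split at h₁
    · cases h₁
    · simp only [Option.mem_def, Option.some.injEq] at h₁
      subst h₁
      exact ⟨_, by rw [hw, List.append_assoc]⟩

/-- Induction along the remaining run, whose future output is `w`. If the machine halts before
enough symbols were emitted, `tok` becomes `none`, which is also the value of `w[·]?` out of range.
-/
theorem lookup_loop (hV : V < S) (hL : L + 1 < S) {e : M.Cfg} (he : M.step x e = none)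
    (hr : StateTransition.Reaches (M.step x) cfg e)
    (hb : ∀ b, StateTransition.Reaches (M.step x) cfg b → ∀ i, b.head i < V)
    (h : Sim M x V L cfg c d) (hp : d.fin.pend = none) (hdone : d.fin.done = false) (r : ρ)
    (hc : c none + c (some r) < 2 ^ L) :
    ∃ (cfg' : M.Cfg) (c' : Option ρ → ℕ) (d' : SData Ω' ρ M) (w : List Ω),
      TExec x S (.loop (fun o => ! o.fin.done) (lookupBody M r)) d d' ∧
      Sim M x V L cfg' c' d' ∧ e.out = cfg.out ++ w ∧ d'.fin.tok = w[c (some r)]? ∧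
      c' none + c' (some r) = c none + c (some r) ∧ (∀ r', r' ≠ r → c' (some r') = c (some r')) ∧
      d'.out = d.out := by
  induction hr using Relation.ReflTransGen.head_induction_on generalizing c d with
  | refl =>
    obtain ⟨d', e₁, s₁, f₁, o₁⟩ := h.step_none hV hL he
    refine ⟨e, c, d', [], .loopTrue (by simp [TData.obs, hdone]) (.seq e₁ (.iteFalse ?_ (.skip _)))
      (.loopFalse ?_), s₁, by simp, by simp [f₁], rfl, fun _ _ => rfl, o₁⟩
    · simp [TData.obs, f₁, hp]
    · simp [TData.obs, f₁]
  | @head a b hab hbe ih =>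
    obtain ⟨d₁, o, e₁, s₁, f₁, o₁, w₁⟩ := h.step_some hV hL hab
      (hb a .refl) (hb b (.single hab))
    have hb' : ∀ b', StateTransition.Reaches (M.step x) b b' → ∀ i, b'.head i < V :=
      fun b' hb' => hb b' (.head hab hb')
    rcases o with _ | o
    · obtain ⟨cfg', c', d', w, e', s', w', t', q', k', o'⟩ := ih hb' s₁ (by simp [f₁])
        (by simp [f₁, hdone]) hc
      refine ⟨cfg', c', d', w, .loopTrue (by simp [TData.obs, hdone])
        (.seq e₁ (.iteFalse ?_ (.skip _))) e', s', by simp [w', w₁], t', q', k', o'.trans o₁⟩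
      simp [TData.obs, f₁]
    · obtain ⟨d₂, e₂, s₂, f₂, o₂⟩ := s₁.zero hV hL (some r)
      by_cases hz : c (some r) = 0
      -- The simulation is abandoned here, in the middle of the run; the rest of the output is only
      -- known to exist.
      · obtain ⟨w, hw⟩ := M.reaches_out hbe
        have e₃ := exec_onFin (s₂.inRange hV hL) fun o =>
          { o.fin with tok := o.fin.pend, done := true }
        have e₄ := exec_onFin (e₃.inRange (s₂.inRange hV hL)) fun o =>
          { o.fin with pend := none }
        refine ⟨b, c, _, o :: w, .loopTrue (by simp [TData.obs, hdone]) (.seq e₁ (.iteTrue ?_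
          (.seq e₂ (.seq (.iteTrue ?_ e₃) e₄)))) (.loopFalse ?_), s₂.congr ?_ _,
          by simp [hw, w₁], ?_, rfl, fun _ _ => rfl, ?_⟩
        · simp [TData.obs, f₁]
        · simp [TData.obs, f₂, hz]
        · simp [TData.obs]
        · simp [TData.obs]
        · simp [TData.obs, f₂, f₁, hz]
        · simp [o₁, o₂]
      · obtain ⟨d₃, e₃, s₃, f₃, o₃⟩ := s₂.dec hV hL (some r) (by omega)
        obtain ⟨d₄, e₄, s₄, f₄, o₄⟩ := s₃.inc hV hL none (by simp; omega)
        have e₅ := exec_onFin (s₄.inRange hV hL) fun o => { o.fin with pend := none }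
        have s₅ := s₄.congr (f := { d₄.fin with pend := none }) rfl d₄.out
        obtain ⟨cfg', c', d', w, e', s', w', t', q', k', o'⟩ := ih hb' s₅ rfl
          (by simp [f₄, f₃, f₂, f₁, hdone]) (by simp; omega)
        simp only [Function.update_self, ne_eq, reduceCtorEq, not_false_eq_true,
          Function.update_of_ne] at t' q' k'
        refine ⟨cfg', c', d', o :: w, .loopTrue (by simp [TData.obs, hdone]) (.seq e₁ (.iteTrue ?_
          (.seq e₂ (.seq (.iteFalse ?_ (.seq e₃ e₄)) e₅)))) e', s', by simp [w', w₁], ?_,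
          by omega, fun r' hr' => ?_, ?_⟩
        · simp [TData.obs, f₁]
        · simp [TData.obs, f₂, hz]
        · rw [t']
          obtain ⟨k, hk⟩ : ∃ k, c (some r) = k + 1 := ⟨c (some r) - 1, by omega⟩
          simp [hk]
        · rw [k' r' hr', Function.update_of_ne (by simpa using hr')]
        · exact o'.trans (o₄.trans (o₃.trans (o₂.trans o₁)))

theorem lookup_restore (hV : V < S) (hL : L + 1 < S) (h : Sim M x V L cfg c d) (r : ρ)
    (hc : c none + c (some r) < 2 ^ L) :
    ∃ (c' : Option ρ → ℕ) (d' : SData Ω' ρ M), TExec x S (lookupRestore M r) d d' ∧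
      Sim M x V L cfg c' d' ∧ c' none = 0 ∧ c' (some r) = c none + c (some r) ∧
      (∀ r', r' ≠ r → c' (some r') = c (some r')) ∧ d'.fin.tok = d.fin.tok ∧ d'.out = d.out := by
  obtain ⟨k, hk⟩ : ∃ k, c none = k := ⟨_, rfl⟩
  induction k generalizing c d with
  | zero =>
    obtain ⟨d₁, e₁, s₁, f₁, o₁⟩ := h.zero hV hL none
    refine ⟨c, d₁, .seq e₁ (.loopFalse ?_), s₁, hk, by omega, fun _ _ => rfl, by simp [f₁], o₁⟩
    simp [TData.obs, f₁, hk]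
  | succ k ih =>
    obtain ⟨d₁, e₁, s₁, f₁, o₁⟩ := h.zero hV hL none
    obtain ⟨d₂, e₂, s₂, f₂, o₂⟩ := s₁.dec hV hL none (by omega)
    obtain ⟨d₃, e₃, s₃, f₃, o₃⟩ := s₂.inc hV hL (some r) (by simp; omega)
    obtain ⟨c', d', e', s', z', v', k', t', o'⟩ := ih s₃ (by simp; omega) (by simp [hk])
    cases e' with
    | seq e₄ e₅ =>
      refine ⟨c', d', .seq e₁ (.loopTrue ?_ (.seq e₂ (.seq e₃ e₄)) e₅), s', z', ?_,
        fun r' hr' => ?_, ?_, ?_⟩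
      · simp [TData.obs, f₁, hk]
      · simp at v'; omega
      · rw [k' r' hr']; simp [hr']
      · simp [t', f₃, f₂, f₁]
      · simp [o', o₃, o₂, o₁]

/-- Random access to a word that is stored nowhere: the machine is rerun from the start until it
emits the wanted symbol, and the counter is restored afterwards. This is the core of the composition
of logspace computations. -/
theorem Sim.lookup (h : Sim M x V L cfg c d) (hV : V < S) (hL : L + 1 < S) {w : List Ω}
    (ho : M.Outputs x w) (hs : M.RunsInSpace x V) (h0 : c none = 0) (r : ρ)
    (hc : c (some r) < 2 ^ L) :
    ∃ (cfg' : M.Cfg) (d' : SData Ω' ρ M), TExec x S (lookup M r) d d' ∧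
      Sim M x V L cfg' c d' ∧ d'.fin.tok = w[c (some r)]? ∧ d'.out = d.out := by
  obtain ⟨e, hr, he, rfl⟩ := ho
  obtain ⟨d₁, e₁, s₁, f₁, o₁⟩ := h.reset hV hL
  obtain ⟨cfg', c₂, d₂, w', e₂, s₂, w₂, t₂, q₂, k₂, o₂⟩ := lookup_loop hV hL he hr hs s₁
    (by simp [f₁]) (by simp [f₁]) r (by omega)
  obtain ⟨c₃, d₃, e₃, s₃, z₃, v₃, k₃, t₃, o₃⟩ := lookup_restore hV hL s₂ r (by omega)
  have hc₃ : c₃ = c := by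
    funext r'
    rcases r' with _ | r'
    · rw [z₃, h0]
    · by_cases hr' : r' = r
      · subst hr'; omega
      · rw [k₃ r' hr', k₂ r' hr']
  rw [hc₃] at s₃
  refine ⟨cfg', d₃, .seq e₁ (.seq e₂ e₃), s₃, ?_, o₃.trans (o₂.trans o₁)⟩
  rw [t₃, t₂, w₂]
  simp [Transducer.init]

end

/-! ### The length of the output of a space-bounded transducer -/

section OutputLength

variable {Ω : Type} (M : Transducer Ω) (x : List Bool)

/-- The machine halts after exactly `n` steps. -/
def HaltsIn : ℕ → M.Cfg → Prop
  | 0, a => M.step x a = none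
  | n + 1, a => ∃ b, M.step x a = some b ∧ HaltsIn n b

variable {M x}

theorem HaltsIn.unique {n n' : ℕ} {a : M.Cfg} (h : HaltsIn M x n a) (h' : HaltsIn M x n' a) :
    n = n' := by
  induction n generalizing n' a with
  | zero =>
    rcases n' with _ | n'
    · rfl
    · obtain ⟨b, hb, -⟩ := h'
      rw [HaltsIn, hb] at h; cases h
  | succ n ih =>
    obtain ⟨b, hb, hn⟩ := h
    rcases n' with _ | n'
    · rw [HaltsIn, hb] at h'; cases h'
    · obtain ⟨b', hb', hn'⟩ := h'
      rw [hb, Option.some.injEq] at hb'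
      subst hb'
      rw [ih hn hn']

/-- The output tape is write-only and cannot influence the run, so configurations may be compared
without it. -/
theorem HaltsIn.out_irrel {n : ℕ} {a a' : M.Cfg} (h : HaltsIn M x n a)
    (ha : a' = { a with out := a'.out }) : HaltsIn M x n a' := by
  induction n generalizing a a' with
  | zero =>
    rw [ha]
    simp only [HaltsIn, Transducer.step] at h ⊢
    split at h
    · simp only
    · cases h
  | succ n ih =>
    obtain ⟨b, hb, hn⟩ := h
    unfold Transducer.step at hb
    split at hb
    · cases hb
    · rename_i q mv w o hδ
      simp only [Option.some.injEq] at hb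
      subst hb
      refine ⟨{ state := q
                inPos := min (mv.apply a.inPos) (x.length + 1)
                tape := fun i => Function.update (a.tape i) (a.head i) (w i).1
                head := fun i => (w i).2.apply (a.head i)
                out := a'.out ++ o.toList }, ?_, ih hn rfl⟩
      rw [ha]
      simp only [Transducer.step, hδ]

/-- For each `j` up to the running time there is a reachable configuration with exactly `j` steps
left; these are the objects to be counted below. -/
theorem exists_haltsIn {a e : M.Cfg} (h : StateTransition.Reaches (M.step x) a e)
    (he : M.step x e = none) : ∃ n, HaltsIn M x n a ∧ e.out.length ≤ a.out.length + n ∧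
      ∀ j ≤ n, ∃ b, StateTransition.Reaches (M.step x) a b ∧ HaltsIn M x j b := by
  induction h using Relation.ReflTransGen.head_induction_on with
  | refl => exact ⟨0, he, le_rfl, fun j hj => ⟨e, .refl, by rw [Nat.le_zero.1 hj]; exact he⟩⟩
  | @head a b hab _ ih =>
    obtain ⟨n, hn, hl, hj⟩ := ih
    have hn' : HaltsIn M x (n + 1) a := ⟨b, hab, hn⟩
    refine ⟨n + 1, hn', ?_, fun j hj' => ?_⟩
    · unfold Transducer.step at hab
      split at hab
      · cases hab
      · rename_i o _
        simp only [Option.mem_def, Option.some.injEq] at hab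
        subst hab
        simp only [List.length_append] at hl
        have : o.toList.length ≤ 1 := by cases o <;> simp
        omega
    · rcases Nat.lt_or_ge n j with h | h
      · obtain rfl : j = n + 1 := by omega
        exact ⟨a, .refl, hn'⟩
      · obtain ⟨b', hb', h'⟩ := hj j h
        exact ⟨b', .head hab hb', h'⟩

theorem reaches_blank {V : ℕ} (hs : M.RunsInSpace x V) {b : M.Cfg}
    (h : StateTransition.Reaches (M.step x) M.init b) :
    b.inPos ≤ x.length + 1 ∧ ∀ i p, V ≤ p → b.tape i p = M.blank := by
  induction h with
  | refl => exact ⟨Nat.zero_le _, fun _ _ _ => rfl⟩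
  | @tail b c hb hbc ih =>
    have hlt := hs b hb
    unfold Transducer.step at hbc
    split at hbc
    · cases hbc
    · simp only [Option.mem_def, Option.some.injEq] at hbc
      subst hbc
      refine ⟨min_le_right _ _, fun i p hp => ?_⟩
      have := hlt i
      simp only [Function.update_of_ne (show p ≠ b.head i by omega)]
      exact ih.2 i p hp

/-- Pigeonhole on configurations without their outputs: two equal ones would have the same number of
steps left. So the running time is smaller than the number of such configurations, and each step
emits at most one symbol. -/
theorem output_length_le {V : ℕ} (hs : M.RunsInSpace x V) {w : List Ω} (ho : M.Outputs x w) :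
    w.length < Nat.card M.Q * (x.length + 2) * ((Nat.card M.Γ ^ V) ^ M.k * V ^ M.k) := by
  obtain ⟨e, hr, he, rfl⟩ := ho
  obtain ⟨n, -, hl, hj⟩ := exists_haltsIn hr he
  choose b hb hh using fun j : Fin (n + 1) => hj j (Nat.lt_succ_iff.1 j.2)
  have := M.finQ
  have := M.finΓ
  let K := (M.Q × Fin (x.length + 2)) × ((Fin M.k → Fin V → M.Γ) × (Fin M.k → Fin V))
  let core : Fin (n + 1) → K := fun j =>
    (((b j).state, ⟨(b j).inPos, Nat.lt_succ_iff.2 (reaches_blank hs (hb j)).1⟩),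
      (fun i p => (b j).tape i p, fun i => ⟨(b j).head i, hs _ (hb j) i⟩))
  have hinj : Function.Injective core := by
    intro j j' hjj
    have h₁ : (b j).state = (b j').state := congrArg (fun k : K => k.1.1) hjj
    have h₂ : (b j).inPos = (b j').inPos := congrArg (fun k : K => k.1.2.val) hjj
    have h₃ : ∀ i p, (hp : p < V) → (b j).tape i p = (b j').tape i p :=
      fun i p hp => congrArg (fun k : K => k.2.1 i ⟨p, hp⟩) hjj
    have h₄ : ∀ i, (b j).head i = (b j').head i := fun i => congrArg (fun k : K => (k.2.2 i).val) hjj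
    -- The first `V` cells agree by assumption, and all later cells are blank in both
    -- configurations.
    have heq : b j' = { b j with out := (b j').out } := by
      have ht : (b j').tape = (b j).tape := by
        funext i p
        rcases lt_or_ge p V with hp | hp
        · exact (h₃ i p hp).symm
        · rw [(reaches_blank hs (hb j)).2 i p hp, (reaches_blank hs (hb j')).2 i p hp]
      have hd : (b j').head = (b j).head := by
        funext i
        exact (h₄ i).symm
      change b j' = ⟨(b j).state, (b j).inPos, (b j).tape, (b j).head, (b j').out⟩
      rw [h₁, h₂, ← ht, ← hd]
    exact Fin.ext ((hh j).out_irrel heq |>.unique (hh j'))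
  have hc := Nat.card_le_card_of_injective core hinj
  have hK : Nat.card K =
      Nat.card M.Q * (x.length + 2) * ((Nat.card M.Γ ^ V) ^ M.k * V ^ M.k) := by
    simp only [K, Nat.card_prod, Nat.card_fun, Nat.card_fin]
  rw [Nat.card_eq_fintype_card, Fintype.card_fin, hK] at hc
  simp only [Transducer.init, List.length_nil] at hl
  omega

/-- In logarithmic space the number of configurations is polynomial in the input length: each factor
of the count is at most 2 to a constant multiple of log n + 1. -/
theorem exists_output_bound (M : Transducer Ω) (C a : ℕ) : ∃ C', ∀ (x : List Bool) (w : List Ω),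
    M.RunsInSpace x (C * (Nat.log 2 x.length + 1)) → M.Outputs x w →
    a * (w.length + 1) < 2 ^ (C' * (Nat.log 2 x.length + 1)) := by
  -- The exponents add up: `a` and the number of states contribute themselves, the input head 2, the
  -- tape contents and the head positions the last two terms.
  refine ⟨a + (Nat.card M.Q + 2 + (Nat.card M.Γ * C * M.k + C * M.k)), fun x w hs ho => ?_⟩
  have h := output_length_le hs ho
  obtain ⟨N, hN⟩ : ∃ N, Nat.log 2 x.length + 1 = N := ⟨_, rfl⟩
  have hn : x.length < 2 ^ N := hN ▸ Nat.lt_pow_succ_log_self one_lt_two _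
  rw [hN] at h ⊢
  have hN1 : 1 ≤ N := by omega
  have hpow : ∀ k, k < 2 ^ (k * N) := fun k =>
    Nat.lt_two_pow_self.trans_le (Nat.pow_le_pow_right two_pos (Nat.le_mul_of_pos_right _ hN1))
  have h₁ : x.length + 2 ≤ 2 ^ (2 * N) := by
    have : 2 ≤ 2 ^ N := by simpa using Nat.pow_le_pow_right two_pos hN1
    rw [two_mul, pow_add]
    nlinarith
  have h₂ : (Nat.card M.Γ ^ (C * N)) ^ M.k ≤ 2 ^ ((Nat.card M.Γ * C * M.k) * N) := by
    rw [show Nat.card M.Γ * C * M.k * N = Nat.card M.Γ * ((C * N) * M.k) by ring, ← pow_mul,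
      pow_mul 2]
    exact Nat.pow_le_pow_left Nat.lt_two_pow_self.le _
  have h₃ : (C * N) ^ M.k ≤ 2 ^ ((C * M.k) * N) := by
    rw [show C * M.k * N = (C * N) * M.k by ring, pow_mul]
    exact Nat.pow_le_pow_left Nat.lt_two_pow_self.le _
  have h₄ : w.length + 1 ≤
      2 ^ ((Nat.card M.Q + 2 + (Nat.card M.Γ * C * M.k + C * M.k)) * N) := by
    refine (Nat.succ_le_of_lt h).trans ?_
    simp only [add_mul, pow_add]
    gcongr
    exact (hpow _).le
  rw [add_mul, pow_add]
  exact mul_lt_mul_of_lt_of_le_of_nonneg_of_pos (hpow a) h₄ (Nat.zero_le _) (by positivity)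

end OutputLength

/-! ### Counter programs -/

/-- The data of a counter program: the counters and the output. -/
structure CData (Ω ρ : Type) where
  c : ρ → ℕ
  out : List Ω

inductive CAct (Ω ρ : Type) where
  | inc (r : ρ)
  | dec (r : ρ)
  | emit (a : Ω)

/-- Tests of a counter program on a word: whether a counter is positive, and a property of the
symbol at the position given by a counter. -/
inductive CTest (Ω ρ : Type) where
  | pos (r : ρ)
  | sym (r : ρ) (f : Option Ω → Bool)

section CounterProgram

variable {Ω Ω' ρ : Type} [DecidableEq ρ]

/-- The actions of a counter program with counters bounded by `B`. -/
def CAct.sem (B : ℕ) : CAct Ω' ρ → CData Ω' ρ → CData Ω' ρ → Prop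
  | .inc r, s, s' => s' = ⟨Function.update s.c r (s.c r + 1), s.out⟩ ∧ s.c r + 1 ≤ B
  | .dec r, s, s' => s' = ⟨Function.update s.c r (s.c r - 1), s.out⟩ ∧ 0 < s.c r
  | .emit a, s, s' => s' = ⟨s.c, s.out ++ [a]⟩

def CTest.sem (w : List Ω) : CTest Ω ρ → CData Ω' ρ → Bool
  | .pos r, s => decide (s.c r ≠ 0)
  | .sym r f, s => f w[s.c r]?

/-- Counter programs on words over `Ω` with output over `Ω'`. -/
abbrev CProg (Ω Ω' ρ : Type) := Prog (CAct Ω' ρ) (CTest Ω ρ)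

abbrev CExec (w : List Ω) (B : ℕ) (p : CProg Ω Ω' ρ) (s s' : CData Ω' ρ) : Prop :=
  Exec (CAct.sem B) (CTest.sem w) p s s'

/-- The tape programs for the actions and the tests of a counter program. -/
def CAct.toTProg (M : Transducer Ω) : CAct Ω' ρ → SProg Ω' ρ M
  | .inc r => incCounter M.blank (.inr (some r))
  | .dec r => decCounter M.blank (.inr (some r))
  | .emit a => emitSym a

def CTest.prepare (M : Transducer Ω) : CTest Ω ρ → SProg Ω' ρ M
  | .pos r => testZero M (some r)
  | .sym r _ => lookup M r

def CTest.answer (M : Transducer Ω) :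
    CTest Ω ρ → Obs (Ctl M) (Option (M.Γ × Bool)) (Fin M.k ⊕ Option ρ) → Bool
  | .pos _ => fun o => ! o.fin.flag
  | .sym _ f => fun o => f o.fin.tok

/-- The tape program that runs a counter program on the output of `M`. -/
def CProg.toTProg (M : Transducer Ω) (p : CProg Ω Ω' ρ) : SProg Ω' ρ M :=
  .seq
    (.act fun o => { (o.idle : Effect _ _ _ _) with
      wr := Sum.elim (fun _ => (some (M.blank, true), .stay)) fun r => (o.cell (.inr r), .stay) })
    (p.translate (CAct.toTProg M) (CTest.prepare M) (CTest.answer M))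

/-- An instance of `Exec.translate`. The relation `R` includes the bound `B < 2 ^ L` on the
counters, which keeps every increment and every lookup within `L` bits. -/
theorem exec_toTProg (M : Transducer Ω) {x : List Bool} {w : List Ω} {V L S B : ℕ}
    (hV : V < S) (hL : L + 1 < S) (hB : B < 2 ^ L) (ho : M.Outputs x w)
    (hs : M.RunsInSpace x V) {p : CProg Ω Ω' ρ} {s : CData Ω' ρ}
    (h : CExec w B p ⟨fun _ => 0, []⟩ s) :
    ∃ d, TExec x S (CProg.toTProg M p)
      (TData.init none ⟨M.start, none, none, false, false⟩) d ∧ d.out = s.out := by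
  -- Between two actions the auxiliary counter used by lookups is zero.
  let ext : (ρ → ℕ) → Option ρ → ℕ := fun c r => r.elim 0 c
  have ext_update : ∀ c r v, Function.update (ext c) (some r) v = ext (Function.update c r v) := by
    intro c r v
    funext r'
    rcases r' with _ | r'
    · rfl
    · by_cases hr : r' = r
      · subst hr; simp [ext]
      · simp [ext, hr]
  let R : CData Ω' ρ → SData Ω' ρ M → Prop := fun s d =>
    (∃ cfg, Sim M x V L cfg (ext s.c) d) ∧ d.out = s.out ∧ ∀ r, s.c r ≤ B
  -- The first step marks cell 0 of each simulated tape, after which the data represent the initial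
  -- configuration.
  have init : ∃ d, TExec x S (.act fun o => { (o.idle : Effect _ _ _ _) with
      wr := Sum.elim (fun _ => (some (M.blank, true), .stay)) fun r => (o.cell (.inr r), .stay) })
      (TData.init none ⟨M.start, none, none, false, false⟩) d ∧ R ⟨fun _ => 0, []⟩ d := by
    refine ⟨_, .act ⟨rfl, ?_⟩, ⟨M.init, ⟨rfl, ?_, Nat.zero_le _, fun i => ?_, fun i => ?_,
      fun r => ?_, fun r => ?_⟩⟩, ?_, fun r => Nat.zero_le _⟩
    · rintro (i | r) <;>
      · simp [TData.init, TData.apply, TData.obs, Obs.idle, Move.apply]; omega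
    · simp [TData.init, TData.apply, TData.obs, Obs.idle, Move.apply, Transducer.init]
    · have := hs M.init .refl i
      refine ⟨1, one_pos, by omega, Nat.zero_le _, ?_, fun _ _ => rfl⟩
      funext p
      rcases p with _ | p <;>
        simp [TData.init, TData.apply, TData.obs, Obs.idle, markedTape, Function.update,
          Transducer.init]
    · simp [TData.init, TData.apply, TData.obs, Obs.idle, Move.apply, Transducer.init]
    · refine ⟨[], Nat.zero_le _, ?_, ?_⟩
      · cases r <;> rfl
      · funext p
        cases p <;> simp [TData.init, TData.apply, TData.obs, Obs.idle, bitsTape]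
    · simp [TData.init, TData.apply, TData.obs, Obs.idle, Move.apply]
    · simp [TData.init, TData.apply, TData.obs, Obs.idle]
  obtain ⟨d₀, e₀, r₀⟩ := init
  have hact : ∀ (a : CAct Ω' ρ) s s' d, a.sem B s s' → R s d →
      ∃ d', TExec x S (a.toTProg M) d d' ∧ R s' d' := by
    rintro (r | r | a) s s' d hss ⟨⟨cfg, hsim⟩, hout, hle⟩
    · obtain ⟨rfl, hr⟩ := hss
      obtain ⟨d', e', s', f', o'⟩ := hsim.inc (S := S) hV hL (some r) (by simp [ext]; omega)
      refine ⟨d', e', ⟨cfg, ?_⟩, o'.trans hout, fun r' => ?_⟩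
      · rw [ext_update] at s'; exact s'
      · by_cases h' : r' = r
        · subst h'; simpa using hr
        · simpa [h'] using hle r'
    · obtain ⟨rfl, hr⟩ := hss
      obtain ⟨d', e', s', f', o'⟩ := hsim.dec (S := S) hV hL (some r) (by simpa [ext] using hr)
      refine ⟨d', e', ⟨cfg, ?_⟩, o'.trans hout, fun r' => ?_⟩
      · rw [ext_update] at s'; exact s'
      · by_cases h' : r' = r
        · subst h'; have := hle r'; simp; omega
        · simpa [h'] using hle r'
    · obtain rfl : s' = _ := hss
      exact ⟨_, exec_emitSym (hsim.inRange hV hL) a, ⟨cfg, hsim.congr rfl _⟩, by simp [hout], hle⟩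
  have htest : ∀ (t : CTest Ω ρ) s d, R s d → ∃ d', TExec x S (t.prepare M) d d' ∧ R s d' ∧
      t.answer M (d'.obs x) = t.sem w s := by
    rintro (r | ⟨r, f⟩) s d ⟨⟨cfg, hsim⟩, hout, hle⟩
    · obtain ⟨d', e', s', f', o'⟩ := hsim.zero (S := S) hV hL (some r)
      refine ⟨d', e', ⟨⟨cfg, s'⟩, o'.trans hout, hle⟩, ?_⟩
      simp [TData.obs, f', CTest.sem, CTest.answer, ext]
      exact decide_eq_decide.2 Iff.rfl
    · obtain ⟨cfg', d', e', s', t', o'⟩ := hsim.lookup (S := S) hV hL ho hs rfl r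
        ((hle r).trans_lt hB)
      refine ⟨d', e', ⟨⟨cfg', s'⟩, o'.trans hout, hle⟩, ?_⟩
      simp [TData.obs, t', CTest.sem, CTest.answer, ext]
  obtain ⟨d, e, r⟩ := Exec.translate R hact htest h r₀
  exact ⟨d, .seq e₀ e, r.2.1⟩

/-- Counters bounded linearly in the length of the intermediate word have O(log n) bits, since that
length is polynomial in n; the word itself is recomputed on demand. -/
theorem LogspaceComputableOn.comp_cprog [Finite Ω] [Finite ρ] {D : Set (List Bool)}
    {f : List Bool → List Ω} (hf : LogspaceComputableOn D f) (g : List Bool → List Ω')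
    (p : CProg Ω Ω' ρ) (a : ℕ)
    (h : ∀ x ∈ D, ∃ c, CExec (f x) (a * ((f x).length + 1)) p ⟨fun _ => 0, []⟩ ⟨c, g x⟩) :
    LogspaceComputableOn D g := by
  obtain ⟨M, C, hM⟩ := hf
  obtain ⟨C', hC'⟩ := exists_output_bound M C a
  have := M.finΓ
  refine ⟨compile none ⟨M.start, none, none, false, false⟩ (CProg.toTProg M p), C + C' + 2,
    fun x hx => ?_⟩
  obtain ⟨ho, hs⟩ := hM x hx
  obtain ⟨c, hc⟩ := h x hx
  obtain ⟨d, e, hd⟩ := exec_toTProg (S := (C + C' + 2) * (Nat.log 2 x.length + 1)) M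
    (by nlinarith) (by nlinarith) (hC' x _ hs ho) ho hs hc
  have := compile_outputs _ _ _ (by positivity) e
  rwa [hd] at this

end CounterProgram

/-! ### Gate lists -/

/-- Gates without the condition that control and target differ. -/
inductive PreGate (ι : Type) where
  | h (i : ι)
  | t (i : ι)
  | cx (i j : ι)

namespace PreGate

variable {ι κ : Type}

def map (f : ι → κ) : PreGate ι → PreGate κ
  | .h i => .h (f i)
  | .t i => .t (f i)
  | .cx i j => .cx (f i) (f j)

/-- Control and target differ. -/
def Proper : PreGate ι → Prop
  | .cx i j => i ≠ j
  | _ => True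

/-- The circuit of a gate; an improper gate is dropped. -/
def toCircuit [DecidableEq ι] : PreGate ι → Circuit ι
  | .h i => [.H i]
  | .t i => [.T i]
  | .cx i j => if h : i ≠ j then [.CNOT i j h] else []

end PreGate

/-- The circuit of a gate list. -/
def circuitOf {ι : Type} [DecidableEq ι] (L : List (PreGate ι)) : Circuit ι :=
  L.flatMap PreGate.toCircuit

/-! ### Gate lists for X, Toffoli and controlled gates -/

section Gadgets

variable {ι κ : Type}

def tPow (n : ℕ) (i : ι) : List (PreGate ι) := List.replicate n (.t i)

/-- The Pauli `X` gate. -/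
def pauliX (i : ι) : List (PreGate ι) := .h i :: (tPow 4 i ++ [.h i])

/-- The Toffoli gate. -/
def ccx (a b t : ι) : List (PreGate ι) :=
  [.h t, .cx b t] ++ tPow 7 t ++ [.cx a t, .t t, .cx b t] ++ tPow 7 t ++
    [.cx a t, .t b, .t t, .h t, .cx a b, .t a] ++ tPow 7 b ++ [.cx a b]

/-- The Hadamard gate on `i`, controlled by `c`. -/
def ctrlH (c i : ι) : List (PreGate ι) :=
  tPow 6 i ++ [.h i] ++ tPow 7 i ++ [.cx c i, .t i, .h i] ++ tPow 2 i

/-- The `n`-th power of the `T` gate on `i`, controlled by `c`, using the ancilla `z`. -/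
def ctrlT (n : ℕ) (c z i : ι) : List (PreGate ι) := ccx c i z ++ tPow n z ++ ccx c i z

/-- A gate (for `n = 1`) or its inverse (for `n = 7`), on the wires given by `e`, controlled by
`c`, using the ancilla `z`. -/
def ctrlGate (n : ℕ) (c z : ι) (e : κ → ι) : Gate κ → List (PreGate ι)
  | .H i => ctrlH c (e i)
  | .T i => ctrlT n c z (e i)
  | .CNOT i j _ => ccx c (e i) (e j)

variable {ι' : Type} (f : ι → ι')

theorem map_tPow (n : ℕ) (i : ι) : (tPow n i).map (.map f) = tPow n (f i) := by
  simp [tPow, PreGate.map]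

theorem map_pauliX (i : ι) : (pauliX i).map (.map f) = pauliX (f i) := by
  simp [pauliX, map_tPow, PreGate.map]

theorem map_ccx (a b t : ι) : (ccx a b t).map (.map f) = ccx (f a) (f b) (f t) := by
  simp [ccx, map_tPow, PreGate.map]

theorem map_ctrlH (c i : ι) : (ctrlH c i).map (.map f) = ctrlH (f c) (f i) := by
  simp [ctrlH, map_tPow, PreGate.map]

theorem map_ctrlT (n : ℕ) (c z i : ι) :
    (ctrlT n c z i).map (.map f) = ctrlT n (f c) (f z) (f i) := by
  simp [ctrlT, map_tPow, map_ccx]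

theorem map_ctrlGate (n : ℕ) (c z : ι) (e : κ → ι) (g : Gate κ) :
    (ctrlGate n c z e g).map (.map f) = ctrlGate n (f c) (f z) (f ∘ e) g := by
  cases g <;> simp [ctrlGate, map_ctrlH, map_ctrlT, map_ccx]

theorem proper_tPow (n : ℕ) (i : ι) : ∀ g ∈ tPow n i, g.Proper := by
  intro g hg
  rw [List.eq_of_mem_replicate hg]
  trivial

theorem proper_pauliX (i : ι) : ∀ g ∈ pauliX i, g.Proper := by
  intro g hg
  simp only [pauliX, List.mem_cons, List.mem_append, List.not_mem_nil, or_false] at hg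
  rcases hg with rfl | hg | rfl
  · trivial
  · exact proper_tPow _ _ g hg
  · trivial

theorem proper_ccx {a b t : ι} (hab : a ≠ b) (hat : a ≠ t) (hbt : b ≠ t) :
    ∀ g ∈ ccx a b t, g.Proper := by
  simp only [ccx, List.forall_mem_append, List.forall_mem_cons]
  simp [PreGate.Proper, hab, hat, hbt, tPow]

theorem proper_ctrlH {c i : ι} (h : c ≠ i) : ∀ g ∈ ctrlH c i, g.Proper := by
  simp only [ctrlH, List.forall_mem_append, List.forall_mem_cons]
  simp [PreGate.Proper, h, tPow]

theorem proper_ctrlT {n : ℕ} {c z i : ι} (hc : c ≠ i) (hz : i ≠ z) (hcz : c ≠ z) :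
    ∀ g ∈ ctrlT n c z i, g.Proper := by
  simp only [ctrlT, List.forall_mem_append]
  exact ⟨⟨proper_ccx hc hcz hz, proper_tPow _ _⟩, proper_ccx hc hcz hz⟩

theorem proper_ctrlGate {n : ℕ} {c z : ι} {e : κ → ι} (he : e.Injective) (hcz : c ≠ z)
    (hc : ∀ i, e i ≠ c) (hz : ∀ i, e i ≠ z) (g : Gate κ) :
    ∀ g' ∈ ctrlGate n c z e g, g'.Proper := by
  cases g with
  | H i => exact proper_ctrlH (hc i).symm
  | T i => exact proper_ctrlT (hc i).symm (hz i) hcz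
  | CNOT i j h => exact proper_ccx (hc i).symm (hc j).symm (he.ne h)

end Gadgets

/-! ### The halved verifier -/

/-- The wires used by the halved verifier of a verifier with `nM` message qubits and `nW` private
qubits. -/
structure Layout (nM nW : ℕ) (ι : Type) where
  /-- the qubits of the original verifier -/
  old : Fin nM ⊕ Fin nW → ι
  /-- the message qubits that transport the original verifier's private qubits -/
  snap : Fin nW → ι
  /-- the message qubit that transports the coin -/
  coinMsg : ι
  /-- the coin -/
  coin : ι
  /-- the negated coin -/
  coinNeg : ι
  /-- an ancilla for controlled gates -/
  anc : ι
  /-- the answer -/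
  ans : ι
  /-- ancillas for the test that the original private qubits are all zero -/
  chain : Fin (nW + 1) → ι
  /-- the output qubit of the original verifier -/
  oldOut : ι
  /-- the output qubit of the halved verifier -/
  newOut : ι

namespace Layout

variable {nM nW : ℕ} {ι ι' : Type} (l : Layout nM nW ι)

def map (f : ι → ι') : Layout nM nW ι' where
  old := f ∘ l.old
  snap := f ∘ l.snap
  coinMsg := f l.coinMsg
  coin := f l.coin
  coinNeg := f l.coinNeg
  anc := f l.anc
  ans := f l.ans
  chain := f ∘ l.chain
  oldOut := f l.oldOut
  newOut := f l.newOut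

/-- Receive the snapshot. -/
def receive : List (PreGate ι) :=
  (List.finRange nW).flatMap fun i =>
    [.cx (l.snap i) (l.old (.inr i)), .cx (l.old (.inr i)) (l.snap i)]

/-- Toss the coin and send it. -/
def toss : List (PreGate ι) :=
  [.h l.coin, .cx l.coin l.coinMsg] ++ pauliX l.coinNeg ++ [.cx l.coin l.coinNeg]

/-- Apply a circuit of the original verifier if the coin is `0`. -/
def forth (C : Circuit (Fin nM ⊕ Fin nW)) : List (PreGate ι) :=
  C.flatMap (ctrlGate 1 l.coinNeg l.anc l.old)

/-- Apply the inverse of a circuit of the original verifier if the coin is `1`. -/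
def back (C : Circuit (Fin nM ⊕ Fin nW)) : List (PreGate ι) :=
  C.reverse.flatMap (ctrlGate 7 l.coin l.anc l.old)

/-- Compute into the last chain qubit whether the coin is `1` and the private qubits of the
original verifier are zero. -/
def chainTest : List (PreGate ι) :=
  .cx l.coin (l.chain 0) :: (List.finRange nW).flatMap fun i =>
    pauliX (l.old (.inr i)) ++ ccx (l.chain i.castSucc) (l.old (.inr i)) (l.chain i.succ)

/-- Compute the answer and move it to the output qubit. -/
def answer : List (PreGate ι) :=
  ccx l.coinNeg l.oldOut l.ans ++ l.chainTest ++
    [.cx (l.chain (Fin.last nW)) l.ans, .cx l.newOut l.ans, .cx l.ans l.newOut]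

/-- The actions of the halved verifier after the first one. -/
def rounds : List (Circuit (Fin nM ⊕ Fin nW)) → List (Circuit (Fin nM ⊕ Fin nW)) →
    List (List (PreGate ι))
  | F :: Fs, B :: Bs =>
    (l.forth F ++ l.back B ++ if Fs.isEmpty then l.answer else []) :: rounds Fs Bs
  | _, _ => []

/-- The actions of the halved verifier. -/
def halved (Cs : List (Circuit (Fin nM ⊕ Fin nW))) : List (List (PreGate ι)) :=
  (l.receive ++ l.toss ++ l.forth (Cs.getD (Cs.length / 2) [])) ::
    l.rounds (Cs.drop (Cs.length / 2 + 1)) (Cs.take (Cs.length / 2)).reverse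

/-- The wires are different. -/
structure Proper : Prop where
  old_inj : Function.Injective l.old
  old_snap : ∀ x i, l.old x ≠ l.snap i
  old_coinMsg : ∀ x, l.old x ≠ l.coinMsg
  old_coin : ∀ x, l.old x ≠ l.coin
  old_coinNeg : ∀ x, l.old x ≠ l.coinNeg
  old_anc : ∀ x, l.old x ≠ l.anc
  old_ans : ∀ x, l.old x ≠ l.ans
  old_chain : ∀ x i, l.old x ≠ l.chain i
  snap_inj : Function.Injective l.snap
  chain_inj : Function.Injective l.chain
  chain_coin : ∀ i, l.chain i ≠ l.coin
  chain_ans : ∀ i, l.chain i ≠ l.ans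
  coin_coinMsg : l.coin ≠ l.coinMsg
  coin_coinNeg : l.coin ≠ l.coinNeg
  coin_anc : l.coin ≠ l.anc
  coin_ans : l.coin ≠ l.ans
  coinNeg_anc : l.coinNeg ≠ l.anc
  coinNeg_ans : l.coinNeg ≠ l.ans
  oldOut : ∃ x, l.oldOut = l.old x
  newOut : l.newOut ≠ l.ans

variable (f : ι → ι')

theorem map_receive : l.receive.map (.map f) = (l.map f).receive := by
  simp [receive, map, List.map_flatMap, PreGate.map]

theorem map_toss : l.toss.map (.map f) = (l.map f).toss := by
  simp [toss, map, map_pauliX, PreGate.map]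

theorem map_forth (C) : (l.forth C).map (.map f) = (l.map f).forth C := by
  simp [forth, map, List.map_flatMap, map_ctrlGate]

theorem map_back (C) : (l.back C).map (.map f) = (l.map f).back C := by
  simp only [back, map, List.map_flatMap, map_ctrlGate]

theorem map_chainTest : l.chainTest.map (.map f) = (l.map f).chainTest := by
  simp [chainTest, map, List.map_flatMap, map_pauliX, map_ccx, PreGate.map]

theorem map_answer : l.answer.map (.map f) = (l.map f).answer := by
  simp only [answer, List.map_append, map_ccx, map_chainTest]
  rfl

theorem map_rounds (Fs Bs) :
    (l.rounds Fs Bs).map (List.map (.map f)) = (l.map f).rounds Fs Bs := by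
  induction Fs generalizing Bs with
  | nil => simp [rounds]
  | cons F Fs ih =>
    rcases Bs with _ | ⟨B, Bs⟩
    · simp [rounds]
    · simp only [rounds, List.map_cons, ih, List.map_append, map_forth, map_back]
      split_ifs <;> simp [map_answer]

/-- The construction is uniform in the names of the wires; this permits computing its description
with natural numbers in place of `Fin` wires. -/
theorem map_halved (Cs) : (l.halved Cs).map (List.map (.map f)) = (l.map f).halved Cs := by
  simp only [halved, List.map_cons, List.map_append, map_receive, map_toss, map_forth, map_rounds]

variable {l}

/-- `PreGate.toCircuit` drops a CNOT whose wires coincide. Properness excludes this, so the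
description can be printed gate by gate without comparing wires. -/
theorem Proper.proper_halved (h : l.Proper) (Cs) : ∀ L ∈ l.halved Cs, ∀ g ∈ L, g.Proper := by
  have hf : ∀ C, ∀ g ∈ l.forth C, g.Proper := by
    intro C g hg
    obtain ⟨g', -, hg⟩ := List.mem_flatMap.1 hg
    exact proper_ctrlGate h.old_inj h.coinNeg_anc h.old_coinNeg h.old_anc g' g hg
  have hb : ∀ C, ∀ g ∈ l.back C, g.Proper := by
    intro C g hg
    obtain ⟨g', -, hg⟩ := List.mem_flatMap.1 hg
    exact proper_ctrlGate h.old_inj h.coin_anc h.old_coin h.old_anc g' g hg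
  have ht : ∀ g ∈ l.toss, g.Proper := by
    simp only [toss, List.forall_mem_append, List.forall_mem_cons]
    exact ⟨⟨⟨trivial, h.coin_coinMsg, by simp⟩, proper_pauliX _⟩, h.coin_coinNeg, by simp⟩
  have hr : ∀ g ∈ l.receive, g.Proper := by
    intro g hg
    obtain ⟨i, -, hg⟩ := List.mem_flatMap.1 hg
    simp only [List.mem_cons, List.not_mem_nil, or_false] at hg
    rcases hg with rfl | rfl
    · exact (h.old_snap _ _).symm
    · exact h.old_snap _ _
  have hc : ∀ g ∈ l.chainTest, g.Proper := by
    simp only [chainTest, List.forall_mem_cons]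
    refine ⟨(h.chain_coin 0).symm, fun g hg => ?_⟩
    obtain ⟨i, -, hg⟩ := List.mem_flatMap.1 hg
    rcases List.mem_append.1 hg with hg | hg
    · exact proper_pauliX _ g hg
    · refine proper_ccx (h.old_chain _ _).symm (h.chain_inj.ne ?_) (h.old_chain _ _) g hg
      exact (Fin.castSucc_lt_succ).ne
  have ha : ∀ g ∈ l.answer, g.Proper := by
    obtain ⟨x, hx⟩ := h.oldOut
    simp only [answer, List.forall_mem_append, List.forall_mem_cons]
    refine ⟨⟨proper_ccx ?_ h.coinNeg_ans ?_, hc⟩, h.chain_ans _, h.newOut, h.newOut.symm, by simp⟩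
    · rw [hx]; exact (h.old_coinNeg x).symm
    · rw [hx]; exact h.old_ans x
  have hrd : ∀ Fs Bs, ∀ L ∈ l.rounds Fs Bs, ∀ g ∈ L, g.Proper := by
    intro Fs
    induction Fs with
    | nil => simp [rounds]
    | cons F Fs ih =>
      intro Bs
      rcases Bs with _ | ⟨B, Bs⟩
      · simp [rounds]
      · simp only [rounds, List.forall_mem_cons, List.forall_mem_append]
        refine ⟨⟨⟨hf F, hb B⟩, ?_⟩, ih Bs⟩
        split_ifs
        · exact ha
        · simp
  simp only [halved, List.forall_mem_cons, List.forall_mem_append]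
  exact ⟨⟨⟨hr, ht⟩, hf _⟩, hrd _ _⟩

end Layout

/-- The wires of the halved verifier: the message register holds the original message register, the
snapshot and the coin; the private register holds the coin, its negation, two ancillas, the
original private register, and the chain. -/
def finLayout (nM nW : ℕ) (o : Fin nM ⊕ Fin nW) :
    Layout nM nW (Fin (nM + (nW + 1)) ⊕ Fin (4 + (nW + (nW + 1)))) where
  old := Sum.map (Fin.castAdd _) fun i => Fin.natAdd 4 (Fin.castAdd _ i)
  snap i := .inl (Fin.natAdd nM i.castSucc)
  coinMsg := .inl (Fin.natAdd nM (Fin.last nW))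
  coin := .inr (Fin.castAdd _ 0)
  coinNeg := .inr (Fin.castAdd _ 1)
  anc := .inr (Fin.castAdd _ 2)
  ans := .inr (Fin.castAdd _ 3)
  chain i := .inr (Fin.natAdd 4 (Fin.natAdd nW i))
  oldOut := Sum.map (Fin.castAdd _) (fun i => Fin.natAdd 4 (Fin.castAdd _ i)) o
  newOut := .inl ⟨0, by omega⟩

theorem finLayout_proper (nM nW : ℕ) (o : Fin nM ⊕ Fin nW) : (finLayout nM nW o).Proper where
  old_inj := by
    rintro (x | x) (y | y) h <;> simp [finLayout, Fin.ext_iff] at h ⊢ <;> exact h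
  old_snap := by rintro (x | x) i <;> simp [finLayout, Fin.ext_iff]; omega
  old_coinMsg := by rintro (x | x) <;> simp [finLayout, Fin.ext_iff]; omega
  old_coin := by rintro (x | x) <;> simp [finLayout, Fin.ext_iff]
  old_coinNeg := by rintro (x | x) <;> simp [finLayout, Fin.ext_iff]; omega
  old_anc := by rintro (x | x) <;> simp [finLayout, Fin.ext_iff]; omega
  old_ans := by rintro (x | x) <;> simp [finLayout, Fin.ext_iff]; omega
  old_chain := by rintro (x | x) i <;> simp [finLayout, Fin.ext_iff]; omega
  snap_inj := by intro i j h; simpa [finLayout, Fin.ext_iff] using h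
  chain_inj := by intro i j h; simpa [finLayout, Fin.ext_iff] using h
  chain_coin := by
    intro i h
    have := congrArg Fin.val (Sum.inr.inj h)
    simp at this
  chain_ans := by intro i; simp [finLayout, Fin.ext_iff]; omega
  coin_coinMsg := by simp [finLayout]
  coin_coinNeg := by simp [finLayout, Fin.ext_iff]
  coin_anc := by simp [finLayout, Fin.ext_iff]
  coin_ans := by simp [finLayout, Fin.ext_iff]
  coinNeg_anc := by simp [finLayout, Fin.ext_iff]
  coinNeg_ans := by simp [finLayout, Fin.ext_iff]
  oldOut := ⟨o, rfl⟩
  newOut := by simp [finLayout]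

/-- The halved verifier. -/
def Actions.halve (A : Actions) : Actions where
  qM := A.qM + (A.qW + 1)
  qW := 4 + (A.qW + (A.qW + 1))
  pos := by omega
  circuits := ((finLayout A.qM A.qW A.outQubit).halved A.circuits).map circuitOf

theorem Actions.outQubit_of_pos (A : Actions) (h : 0 < A.qM) : A.outQubit = .inl ⟨0, h⟩ := by
  rw [Actions.outQubit, Equiv.symm_apply_eq]
  ext; simp

theorem Actions.outQubit_of_zero (A : Actions) (h : A.qM = 0) :
    A.outQubit = .inr ⟨0, by have := A.pos; omega⟩ := by
  rw [Actions.outQubit, Equiv.symm_apply_eq]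
  ext; simp [h]

/-! ### The description of the halved verifier -/

def encodeNatWire : ℕ ⊕ ℕ → List Tok
  | .inl i => .wireM :: List.replicate i .tally
  | .inr i => .wireW :: List.replicate i .tally

def encodePreGate : PreGate (ℕ ⊕ ℕ) → List Tok
  | .h i => .gateH :: encodeNatWire i
  | .t i => .gateT :: encodeNatWire i
  | .cx i j => .gateCNOT :: (encodeNatWire i ++ encodeNatWire j)

/-- The position of a wire. -/
def wireVal {a b : ℕ} : Fin a ⊕ Fin b → ℕ ⊕ ℕ := Sum.map Fin.val Fin.val

theorem encodeWire_eq {a b : ℕ} (i : Fin a ⊕ Fin b) : encodeWire i = encodeNatWire (wireVal i) := by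
  cases i <;> rfl

theorem encode_circuitOf {a b : ℕ} {L : List (PreGate (Fin a ⊕ Fin b))}
    (h : ∀ g ∈ L, g.Proper) :
    (circuitOf L).flatMap encodeGate = (L.map (.map wireVal)).flatMap encodePreGate := by
  induction L with
  | nil => rfl
  | cons g L ih =>
    simp only [List.forall_mem_cons] at h
    simp only [circuitOf, List.flatMap_cons, List.flatMap_append, List.map_cons] at ih ⊢
    rw [ih h.2]
    congr 1
    cases g with
    | h i => simp [PreGate.toCircuit, encodeGate, PreGate.map, encodePreGate, encodeWire_eq]
    | t i => simp [PreGate.toCircuit, encodeGate, PreGate.map, encodePreGate, encodeWire_eq]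
    | cx i j =>
      have hij : i ≠ j := h.1
      simp [PreGate.toCircuit, encodeGate, PreGate.map, encodePreGate, encodeWire_eq, hij]

/-- The form in which the counter program prints the description, with wires given as numbers. -/
theorem Actions.encode_halve (A : Actions) : A.halve.encode =
    List.replicate (A.qM + (A.qW + 1)) .tally ++ .endM ::
      (List.replicate (4 + (A.qW + (A.qW + 1))) .tally ++ .endW ::
        (((finLayout A.qM A.qW A.outQubit).map wireVal).halved A.circuits).flatMap fun L =>
          .turn :: L.flatMap encodePreGate) := by
  simp only [Actions.encode, Actions.halve, List.flatMap_map]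
  congr 3
  rw [← Layout.map_halved, List.flatMap_map]
  congr 1
  refine List.flatMap_congr fun L hL => ?_
  rw [encode_circuitOf ((finLayout_proper _ _ _).proper_halved _ L hL)]

/-! ### Building blocks of counter programs -/

section Blocks

variable {Ω Ω' ρ : Type} [DecidableEq ρ] {w : List Ω} {B : ℕ}

theorem CExec.le {p : CProg Ω Ω' ρ} {s s' : CData Ω' ρ} (h : CExec w B p s s')
    (hs : ∀ r, s.c r ≤ B) : ∀ r, s'.c r ≤ B := by
  induction h with
  | skip s => exact hs
  | @act a s s' h =>
    cases a with
    | inc r =>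
      obtain ⟨rfl, h⟩ := h
      intro r'
      by_cases hr : r' = r
      · subst hr; simpa using h
      · simpa [hr] using hs r'
    | dec r =>
      obtain ⟨rfl, h⟩ := h
      intro r'
      have := hs r'
      by_cases hr : r' = r
      · subst hr; simp; omega
      · simpa [hr] using this
    | emit a => obtain rfl : s' = _ := h; exact hs
  | seq _ _ ih₁ ih₂ => exact ih₂ (ih₁ hs)
  | iteTrue _ _ ih => exact ih hs
  | iteFalse _ _ ih => exact ih hs
  | loopTrue _ _ _ ih₁ ih₂ => exact ih₂ (ih₁ hs)
  | loopFalse _ => exact hs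

abbrev cInc (r : ρ) : CProg Ω Ω' ρ := .act (.inc r)
abbrev cDec (r : ρ) : CProg Ω Ω' ρ := .act (.dec r)
abbrev cEmit (a : Ω') : CProg Ω Ω' ρ := .act (.emit a)

/-- Run programs in sequence. -/
def Prog.seqs {A T : Type} (l : List (Prog A T)) : Prog A T := l.foldr .seq .skip

theorem exec_seqs_nil {A T D : Type} {act : A → D → D → Prop} {test : T → D → Bool} (s : D) :
    Exec act test (Prog.seqs []) s s := .skip s

theorem exec_seqs_cons {A T D : Type} {act : A → D → D → Prop} {test : T → D → Bool}
    {p : Prog A T} {l : List (Prog A T)} {s s' s'' : D} (h : Exec act test p s s')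
    (h' : Exec act test (Prog.seqs l) s' s'') : Exec act test (Prog.seqs (p :: l)) s s'' :=
  .seq h h'

theorem exec_inc {c c' : ρ → ℕ} {out : List Ω'} {r : ρ} (hB : c r + 1 ≤ B)
    (h : c' = Function.update c r (c r + 1)) :
    CExec w B (cInc r) ⟨c, out⟩ ⟨c', out⟩ := .act ⟨by rw [h], hB⟩

theorem exec_dec {c c' : ρ → ℕ} {out : List Ω'} {r : ρ} (h0 : 0 < c r)
    (h : c' = Function.update c r (c r - 1)) :
    CExec w B (cDec r) ⟨c, out⟩ ⟨c', out⟩ := .act ⟨by rw [h], h0⟩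

theorem exec_emit {c : ρ → ℕ} {out : List Ω'} {a : Ω'} :
    CExec w B (cEmit a) ⟨c, out⟩ ⟨c, out ++ [a]⟩ := .act rfl

/-- Run `p` as often as the value of `r` says, using `d` as a temporary counter. -/
def cRepeat (r d : ρ) (p : CProg Ω Ω' ρ) : CProg Ω Ω' ρ :=
  .seq (.loop (.pos r) (.seq (cDec r) (.seq (cInc d) p)))
    (.loop (.pos d) (.seq (cDec d) (cInc r)))

/-- `r` is counted down while `d` is counted up, and a second loop moves the value back. `C i` and
`o i` are the counters and the output after `i` passes; the components `r` and `d` of `C i` are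
irrelevant, being overwritten by the bookkeeping. -/
theorem exec_cRepeat {r d : ρ} (hrd : r ≠ d) {p : CProg Ω Ω' ρ} {n : ℕ} (hn : n ≤ B)
    (C : ℕ → ρ → ℕ) (o : ℕ → List Ω') {c c' : ρ → ℕ}
    (hc : c = Function.update (Function.update (C 0) r n) d 0)
    (hc' : c' = Function.update (Function.update (C n) r n) d 0)
    (hp : ∀ i < n, CExec w B p
      ⟨Function.update (Function.update (C i) r (n - (i + 1))) d (i + 1), o i⟩
      ⟨Function.update (Function.update (C (i + 1)) r (n - (i + 1))) d (i + 1), o (i + 1)⟩) :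
    CExec w B (cRepeat r d p) ⟨c, o 0⟩ ⟨c', o n⟩ := by
  have first : ∀ k i, k + i = n → CExec w B (.loop (.pos r) (.seq (cDec r) (.seq (cInc d) p)))
      ⟨Function.update (Function.update (C i) r (n - i)) d i, o i⟩
      ⟨Function.update (Function.update (C n) r 0) d n, o n⟩ := by
    intro k
    induction k with
    | zero =>
      intro i hi
      obtain rfl : i = n := by omega
      rw [Nat.sub_self]
      exact .loopFalse (by simp [CTest.sem, hrd])
    | succ k ih =>
      intro i hi
      refine .loopTrue ?_ (.seq (exec_dec ?_ rfl) (.seq (exec_inc ?_ rfl) ?_)) (ih (i + 1) (by omega))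
      · simp [CTest.sem, hrd]; omega
      · simp [hrd]; omega
      · simp [hrd.symm]; omega
      · convert hp i (by omega) using 2
        funext r'
        simp only [Function.update_apply]
        split_ifs <;> simp_all
        omega
  have second : ∀ k, k ≤ n → CExec w B (.loop (.pos d) (.seq (cDec d) (cInc r)))
      ⟨Function.update (Function.update (C n) r (n - k)) d k, o n⟩
      ⟨Function.update (Function.update (C n) r n) d 0, o n⟩ := by
    intro k
    induction k with
    | zero => intro _; exact .loopFalse (by simp [CTest.sem])
    | succ k ih =>
      intro hk
      refine .loopTrue ?_ (.seq (exec_dec ?_ rfl) (exec_inc ?_ ?_)) (ih (by omega))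
      · simp [CTest.sem]
      · simp
      · simp [hrd]; omega
      · funext r'
        simp only [Function.update_apply]
        split_ifs <;> simp_all
        omega
  have h₁ := first n 0 (by omega)
  have h₂ := second n le_rfl
  rw [hc, hc']
  rw [Nat.sub_self] at h₂
  exact .seq h₁ h₂

/-- Set a counter to zero. -/
def cClear (r : ρ) : CProg Ω Ω' ρ := .loop (.pos r) (cDec r)

theorem exec_cClear {r : ρ} {c c' : ρ → ℕ} {out : List Ω'} (h : c' = Function.update c r 0) :
    CExec w B (cClear r) ⟨c, out⟩ ⟨c', out⟩ := by
  obtain ⟨n, hn⟩ : ∃ n, c r = n := ⟨_, rfl⟩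
  induction n generalizing c with
  | zero =>
    have : c' = c := by rw [h, ← hn, Function.update_eq_self]
    rw [this]
    exact .loopFalse (by simp [CTest.sem, hn])
  | succ n ih =>
    refine .loopTrue (by simp [CTest.sem, hn]) (exec_dec (by omega) rfl) (ih ?_ ?_)
    · simpa using h
    · simp [hn]

/-- Decrease `p` by the value of `x` and set `x` to zero. -/
def cSub (p x : ρ) : CProg Ω Ω' ρ := .loop (.pos x) (.seq (cDec x) (cDec p))

theorem exec_cSub {p x : ρ} (hpx : p ≠ x) {c c' : ρ → ℕ} {out : List Ω'} (hle : c x ≤ c p)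
    (h : c' = Function.update (Function.update c p (c p - c x)) x 0) :
    CExec w B (cSub p x) ⟨c, out⟩ ⟨c', out⟩ := by
  obtain ⟨n, hn⟩ : ∃ n, c x = n := ⟨_, rfl⟩
  induction n generalizing c with
  | zero =>
    have : c' = c := by
      rw [h, hn, Nat.sub_zero, Function.update_eq_self, ← hn, Function.update_eq_self]
    rw [this]
    exact .loopFalse (by simp [CTest.sem, hn])
  | succ n ih =>
    refine .loopTrue (by simp [CTest.sem, hn]) (.seq (exec_dec (by omega) rfl)
      (exec_dec (by simp [hpx]; omega) rfl)) (ih ?_ ?_ ?_)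
    · simp [hpx, hpx.symm]; omega
    · rw [h]
      funext r
      simp only [Function.update_apply]
      split_ifs <;> simp_all
      omega
    · simp [hpx.symm, hn]

/-- The program prints `f c` when the counters are `c`, and leaves the counters unchanged, provided
that the temporary counter `d` is zero. -/
def Prints (w : List Ω) (B : ℕ) (d : ρ) (p : CProg Ω Ω' ρ) (f : (ρ → ℕ) → List Ω') : Prop :=
  ∀ c out, c d = 0 → (∀ r, c r ≤ B) → CExec w B p ⟨c, out⟩ ⟨c, out ++ f c⟩

theorem Prints.seqs {α : Type} {d : ρ} {p : α → CProg Ω Ω' ρ} {f : α → (ρ → ℕ) → List Ω'}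
    (h : ∀ a, Prints w B d (p a) (f a)) (l : List α) :
    Prints w B d (Prog.seqs (l.map p)) fun c => l.flatMap fun a => f a c := by
  induction l with
  | nil => intro c out _ _; simpa using exec_seqs_nil _
  | cons a l ih =>
    intro c out hd hB
    have := exec_seqs_cons (h a c out hd hB) (ih c _ hd hB)
    simpa using this

theorem Prints.seq {d : ρ} {p q : CProg Ω Ω' ρ} {f g : (ρ → ℕ) → List Ω'}
    (hp : Prints w B d p f) (hq : Prints w B d q g) :
    Prints w B d (.seq p q) fun c => f c ++ g c := by
  intro c out hd hB
  simpa using Exec.seq (hp c out hd hB) (hq c _ hd hB)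

theorem prints_emit {d : ρ} (a : Ω') : Prints w B d (cEmit a) fun _ => [a] :=
  fun _ _ _ _ => exec_emit

/-- Print a symbol as often as the value of `r` says. -/
theorem prints_repeat {r d : ρ} (hrd : r ≠ d) (a : Ω') :
    Prints w B d (cRepeat r d (cEmit a)) fun c => List.replicate (c r) a := by
  intro c out hd hB
  have key := exec_cRepeat (w := w) (p := cEmit a) hrd (hB r) (fun _ => c)
    (fun i => out ++ List.replicate i a) (c := c) (c' := c) ?_ ?_ ?_
  · simpa using key
  · rw [Function.update_eq_self, ← hd, Function.update_eq_self]
  · rw [Function.update_eq_self, ← hd, Function.update_eq_self]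
  · intro i _
    have := exec_emit (w := w) (B := B)
      (c := Function.update (Function.update c r (c r - (i + 1))) d (i + 1))
      (out := out ++ List.replicate i a) (a := a)
    rw [List.append_assoc, ← List.replicate_succ'] at this
    exact this

end Blocks

/-! ### The counter program that prints the halved verifier -/

inductive Reg where
  | nM | nW | pf | pb | pz | kX | rX | kY | rY | kZ | rZ | tmp | cnt
  deriving DecidableEq

instance : Finite Reg :=
  Finite.of_injective (fun r : Reg => Fin.ofNat 13 r.ctorIdx) fun r r' h => by
    cases r <;> cases r' <;> first | rfl | (exact absurd h (by decide))

instance : Finite Tok :=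
  Finite.of_injective (fun r : Tok => Fin.ofNat 9 r.ctorIdx) fun r r' h => by
    cases r <;> cases r' <;> first | rfl | (exact absurd h (by decide))

abbrev HProg := CProg Tok Tok Reg

/-- Wires that depend on the counters: a fixed wire, or the wire whose register is told by the
counter `k` and whose position is the value of `x`, after four ancillas in the private register. -/
inductive SymWire where
  | fixed (v : ℕ ⊕ ℕ)
  | var (k x : Reg)

def SymWire.eval (c : Reg → ℕ) : SymWire → ℕ ⊕ ℕ
  | .fixed v => v
  | .var k x => if c k = 0 then .inl (c x) else .inr (4 + c x)

/-- The wire does not use the temporary counter `d`. -/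
def SymWire.Ok : SymWire → Prop
  | .fixed _ => True
  | .var _ x => x ≠ .tmp

def printWire : SymWire → HProg
  | .fixed v => Prog.seqs ((encodeNatWire v).map cEmit)
  | .var k x => .seq (.ite (.pos k) (Prog.seqs ([.wireW, .tally, .tally, .tally, .tally].map cEmit))
      (cEmit .wireM)) (cRepeat x .tmp (cEmit .tally))

theorem prints_wire {w : List Tok} {B : ℕ} {v : SymWire} (hv : v.Ok) :
    Prints w B .tmp (printWire v) fun c => encodeNatWire (v.eval c) := by
  have hl : ∀ l : List Tok, Prints w B (.tmp : Reg) (Prog.seqs (l.map cEmit) : HProg) fun _ => l := by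
    intro l
    simpa using Prints.seqs (fun a : Tok => prints_emit (w := w) (B := B) (d := Reg.tmp) a) l
  cases v with
  | fixed v => exact hl _
  | var k x =>
    intro c out hd hB
    by_cases hk : c k = 0
    · have := Exec.seq (.iteFalse (by simp [CTest.sem, hk]) (prints_emit .wireM c out hd hB))
        (prints_repeat (w := w) hv Tok.tally c _ hd hB)
        
        (p := .ite (.pos k) (Prog.seqs ([.wireW, .tally, .tally, .tally, .tally].map cEmit))
          (cEmit .wireM))
      simpa [SymWire.eval, hk, encodeNatWire, printWire] using this
    · have := Exec.seq (.iteTrue (by simp [CTest.sem, hk]) (hl [.wireW, .tally, .tally, .tally, .tally] c out hd hB))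
        (prints_repeat (w := w) hv Tok.tally c _ hd hB)
        
        (p := .ite (.pos k) (Prog.seqs ([.wireW, .tally, .tally, .tally, .tally].map cEmit))
          (cEmit .wireM))
      simpa [SymWire.eval, hk, encodeNatWire, printWire, List.replicate_add,
        List.replicate_succ] using this

def printGate : PreGate SymWire → HProg
  | .h i => .seq (cEmit .gateH) (printWire i)
  | .t i => .seq (cEmit .gateT) (printWire i)
  | .cx i j => .seq (cEmit .gateCNOT) (.seq (printWire i) (printWire j))

def PreGate.Ok : PreGate SymWire → Prop
  | .h i => i.Ok
  | .t i => i.Ok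
  | .cx i j => i.Ok ∧ j.Ok

theorem prints_gate {w : List Tok} {B : ℕ} {g : PreGate SymWire} (hg : g.Ok) :
    Prints w B .tmp (printGate g) fun c => encodePreGate (g.map (SymWire.eval c)) := by
  cases g with
  | h i => exact (prints_emit _).seq (prints_wire hg)
  | t i => exact (prints_emit _).seq (prints_wire hg)
  | cx i j => exact (prints_emit _).seq ((prints_wire hg.1).seq (prints_wire hg.2))

def printGates (L : List (PreGate SymWire)) : HProg := Prog.seqs (L.map printGate)

/-- The description of a gate list whose wires depend on the counters. -/
def symDesc (L : List (PreGate SymWire)) (c : Reg → ℕ) : List Tok :=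
  (L.map (.map (SymWire.eval c))).flatMap encodePreGate

theorem prints_gates {w : List Tok} {B : ℕ} {L : List (PreGate SymWire)} (hL : ∀ g ∈ L, g.Ok) :
    Prints w B .tmp (printGates L) (symDesc L) := by
  induction L with
  | nil => intro c out _ _; simpa [symDesc, printGates] using exec_seqs_nil _
  | cons g L ih =>
    simp only [List.forall_mem_cons] at hL
    intro c out hd hB
    have := exec_seqs_cons (prints_gate hL.1 c out hd hB) (ih hL.2 c _ hd hB)
    simpa [symDesc, printGates] using this

theorem ok_tPow {n : ℕ} {i : SymWire} (hi : i.Ok) : ∀ g ∈ tPow n i, g.Ok := by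
  intro g hg
  rw [List.eq_of_mem_replicate hg]
  exact hi

theorem ok_pauliX {i : SymWire} (hi : i.Ok) : ∀ g ∈ pauliX i, g.Ok := by
  simp only [pauliX, List.forall_mem_append, List.forall_mem_cons]
  exact ⟨hi, ok_tPow hi, hi, by simp⟩

theorem ok_ccx {i j k : SymWire} (hi : i.Ok) (hj : j.Ok) (hk : k.Ok) :
    ∀ g ∈ ccx i j k, g.Ok := by
  simp only [ccx, List.forall_mem_append, List.forall_mem_cons]
  simp [PreGate.Ok, hi, hj, hk, tPow]

theorem ok_ctrlH {i j : SymWire} (hi : i.Ok) (hj : j.Ok) : ∀ g ∈ ctrlH i j, g.Ok := by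
  simp only [ctrlH, List.forall_mem_append, List.forall_mem_cons]
  simp [PreGate.Ok, hi, hj, tPow]

theorem ok_ctrlT {n : ℕ} {i j k : SymWire} (hi : i.Ok) (hj : j.Ok) (hk : k.Ok) :
    ∀ g ∈ ctrlT n i j k, g.Ok := by
  simp only [ctrlT, List.forall_mem_append]
  exact ⟨⟨ok_ccx hi hk hj, ok_tPow hj⟩, ok_ccx hi hk hj⟩

/-! #### Reading a gate -/

def Tok.isTally : Option Tok → Bool
  | some .tally => true
  | _ => false

def Tok.isWireW : Option Tok → Bool
  | some .wireW => true
  | _ => false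

def Tok.isGateH : Option Tok → Bool
  | some .gateH => true
  | _ => false

def Tok.isGateT : Option Tok → Bool
  | some .gateT => true
  | _ => false

def Tok.isGateCNOT : Option Tok → Bool
  | some .gateCNOT => true
  | _ => false

def Tok.isTurn : Option Tok → Bool
  | some .turn => true
  | _ => false

/-- A circuit ends at this symbol. -/
def Tok.isStop : Option Tok → Bool
  | some .turn => true
  | none => true
  | _ => false

/-- Read the wire at position `p` into the counters `k` and `x`, and move `p` behind it. -/
def readWire (p k x : Reg) : HProg :=
  Prog.seqs [.ite (.sym p Tok.isWireW) (cInc k) .skip, cInc p,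
    .loop (.sym p Tok.isTally) (.seq (cInc x) (cInc p))]

/-- Undo `readWire`. -/
def unreadWire (p k x : Reg) : HProg := Prog.seqs [cSub p x, cDec p, cClear k]

/-- The register of a wire. -/
def wireKind {a b : ℕ} : Fin a ⊕ Fin b → ℕ
  | .inl _ => 0
  | .inr _ => 1

/-- The position of a wire in its register. -/
def wireIdx {a b : ℕ} : Fin a ⊕ Fin b → ℕ
  | .inl i => i
  | .inr i => i

theorem encodeWire_length {a b : ℕ} (v : Fin a ⊕ Fin b) : (encodeWire v).length = wireIdx v + 1 := by
  cases v <;> simp [encodeWire, wireIdx]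

/-! ### Correctness of reading a gate and of scanning a circuit -/

section

variable {w : List Tok} {B a b : ℕ}

theorem getElem?_append_length {α : Type} (u v : List α) : (u ++ v)[u.length]? = v.head? := by
  rw [List.getElem?_append_right le_rfl, Nat.sub_self, List.head?_eq_getElem?]

/-- A number in unary is delimited only by the next symbol, whence the condition on the head of `v`.
-/
theorem exec_loop_tally {p x : Reg} (hpx : p ≠ x) {u v : List Tok} {n : ℕ}
    (hw : w = u ++ List.replicate n .tally ++ v) (hv : v.head? ≠ some .tally) (hB : w.length ≤ B)
    {c c' : Reg → ℕ} {out : List Tok} (hp : c p = u.length) (hx : c x + n ≤ B)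
    (hc' : c' = Function.update (Function.update c p (c p + n)) x (c x + n)) :
    CExec w B (.loop (.sym p Tok.isTally) (.seq (cInc x) (cInc p)) : HProg) ⟨c, out⟩ ⟨c', out⟩ := by
  induction n generalizing u c with
  | zero =>
    have : c' = c := by
      simp only [hc', Nat.add_zero, Function.update_eq_self]
    rw [this]
    refine .loopFalse ?_
    have : w[c p]? = v.head? := by
      simp [hw, hp, getElem?_append_length]
    simp only [CTest.sem, this]
    rcases v with _ | ⟨t, v⟩
    · rfl
    · cases t <;> first | rfl | simp at hv
  | succ n ih =>
    have hlen : u.length + 1 ≤ w.length := by rw [hw]; simp; omega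
    refine .loopTrue ?_ (.seq (exec_inc (by omega) rfl) (exec_inc ?_ rfl))
      (ih (u := u ++ [.tally]) ?_ ?_ ?_ ?_)
    · simp [CTest.sem, hw, hp, List.replicate_succ, Tok.isTally]
    · simp [hpx]; omega
    · rw [hw]; simp [List.replicate_succ]
    · simp [hpx, hp]
    · simp [hpx.symm]; omega
    · rw [hc']
      funext r
      simp only [Function.update_apply]
      split_ifs <;> simp_all <;> omega

theorem exec_readWire {p k x : Reg} (hpk : p ≠ k) (hpx : p ≠ x) (hkx : k ≠ x)
    {u v : List Tok} {i : Fin a ⊕ Fin b} (hw : w = u ++ encodeWire i ++ v)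
    (hv : v.head? ≠ some .tally) (hB : w.length ≤ B) {c c' : Reg → ℕ} {out : List Tok}
    (hp : c p = u.length) (hk : c k = 0) (hx : c x = 0)
    (hc' : c' = Function.update (Function.update (Function.update c p
      (u.length + (wireIdx i + 1))) k (wireKind i)) x (wireIdx i)) :
    CExec w B (readWire p k x) ⟨c, out⟩ ⟨c', out⟩ := by
  have hlen : u.length + (wireIdx i + 1) ≤ w.length := by
    rw [hw, ← encodeWire_length i]; simp
  obtain ⟨t, ht⟩ : ∃ t, encodeWire i = t :: List.replicate (wireIdx i) .tally ∧
      Tok.isWireW (some t) = decide (wireKind i = 1) := by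
    cases i
    · exact ⟨_, rfl, rfl⟩
    · exact ⟨_, rfl, rfl⟩
  have hwp : w[c p]? = some t := by rw [hw, hp, ht.1]; simp
  have hkind : wireKind i = 0 ∨ wireKind i = 1 := by cases i <;> simp [wireKind]
  have h₁ : CExec w B (.ite (.sym p Tok.isWireW) (cInc k) .skip : HProg) ⟨c, out⟩
      ⟨Function.update c k (wireKind i), out⟩ := by
    rcases hkind with h | h
    · refine .iteFalse (by simp [CTest.sem, hwp, ht.2, h]) ?_
      rw [h, ← hk, Function.update_eq_self]
      exact .skip _
    · refine .iteTrue (by simp [CTest.sem, hwp, ht.2, h]) (exec_inc (by omega) ?_)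
      rw [h, hk]
  refine exec_seqs_cons h₁ (exec_seqs_cons (exec_inc ?_ rfl)
    (exec_seqs_cons (exec_loop_tally hpx (u := u ++ [t]) (n := wireIdx i) ?_ hv hB ?_ ?_ ?_)
      (exec_seqs_nil _)))
  · simp [hpk]; omega
  · rw [hw, ht.1]; simp
  · simp [hpk, hp]
  · simp [hpx.symm, hkx.symm, hx]; omega
  · rw [hc']
    funext r
    simp only [Function.update_apply]
    split_ifs <;> simp_all <;> omega

theorem exec_unreadWire {p k x : Reg} (hpk : p ≠ k) (hpx : p ≠ x) (hkx : k ≠ x)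
    {c c' : Reg → ℕ} {out : List Tok} (hle : c x + 1 ≤ c p)
    (hc' : c' = Function.update (Function.update (Function.update c p
      (c p - (c x + 1))) k 0) x 0) :
    CExec w B (unreadWire p k x) ⟨c, out⟩ ⟨c', out⟩ := by
  refine exec_seqs_cons (exec_cSub hpx (by omega) rfl) (exec_seqs_cons (exec_dec ?_ rfl)
    (exec_seqs_cons (exec_cClear ?_) (exec_seqs_nil _)))
  · simp [hpx]; omega
  · rw [hc']
    funext r
    simp only [Function.update_apply]
    split_ifs <;> simp_all <;> omega

/-- The wires read last. -/
def wireX : SymWire := .var .kX .rX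
def wireY : SymWire := .var .kY .rY
def wireZ : SymWire := .var .kZ .rZ

def wireCoin : SymWire := .fixed (.inr 0)
def wireNeg : SymWire := .fixed (.inr 1)
def wireAnc : SymWire := .fixed (.inr 2)
def wireAns : SymWire := .fixed (.inr 3)

/-- Print the controlled version of the gate at position `p`, if there is one. -/
def printCtrl (n : ℕ) (ctl : SymWire) (p : Reg) : HProg :=
  .ite (.sym p Tok.isGateH)
    (Prog.seqs [cInc p, readWire p .kX .rX, printGates (ctrlH ctl wireX),
      unreadWire p .kX .rX, cDec p])
  (.ite (.sym p Tok.isGateT)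
    (Prog.seqs [cInc p, readWire p .kX .rX, printGates (ctrlT n ctl wireAnc wireX),
      unreadWire p .kX .rX, cDec p])
  (.ite (.sym p Tok.isGateCNOT)
    (Prog.seqs [cInc p, readWire p .kX .rX, readWire p .kY .rY,
      printGates (ccx ctl wireX wireY), unreadWire p .kY .rY, unreadWire p .kX .rX, cDec p])
    .skip))

/-- The wires of the halved verifier for the wires of the original one. -/
def oldWire {a b : ℕ} : Fin a ⊕ Fin b → ℕ ⊕ ℕ := Sum.map Fin.val fun i => 4 + i.val

theorem eval_var {k x : Reg} {c : Reg → ℕ} {i : Fin a ⊕ Fin b} (hk : c k = wireKind i)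
    (hx : c x = wireIdx i) : SymWire.eval c (.var k x) = oldWire i := by
  cases i <;> simp_all [SymWire.eval, wireKind, wireIdx, oldWire]

/-- The description of a controlled gate of the halved verifier. -/
def ctrlDesc (n : ℕ) (ctl : ℕ) (g : Gate (Fin a ⊕ Fin b)) : List Tok :=
  (ctrlGate n (.inr ctl) (.inr 2) oldWire g).flatMap encodePreGate

/-- The counters that hold a gate are zero. -/
structure Idle (c : Reg → ℕ) : Prop where
  kX : c .kX = 0
  rX : c .rX = 0
  kY : c .kY = 0
  rY : c .rY = 0
  tmp : c .tmp = 0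

/-- The counter is one of the pointers. -/
def Reg.IsPtr (p : Reg) : Prop := p = .pf ∨ p = .pb ∨ p = .pz

theorem Idle.update {c : Reg → ℕ} (h : Idle c) {p : Reg} (hp : p.IsPtr) (n : ℕ) :
    Idle (Function.update c p n) := by
  obtain ⟨h₁, h₂, h₃, h₄, h₅⟩ := h
  rcases hp with rfl | rfl | rfl <;> exact ⟨h₁, h₂, h₃, h₄, h₅⟩

/-- After printing, the reading of the operands is undone, so the pointer returns to the name of the
gate and the counters to their old values. The same routine can therefore serve scans in both
directions. -/
theorem exec_printCtrl_gate {n ctl : ℕ} {p : Reg} (hp : p.IsPtr) {u v : List Tok}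
    {g : Gate (Fin a ⊕ Fin b)} (hw : w = u ++ encodeGate g ++ v) (hv : v.head? ≠ some .tally)
    (hB : w.length ≤ B) {c : Reg → ℕ} {out : List Tok} (hc : ∀ r, c r ≤ B) (hi : Idle c)
    (hcp : c p = u.length) :
    CExec w B (printCtrl n (.fixed (.inr ctl)) p) ⟨c, out⟩ ⟨c, out ++ ctrlDesc n ctl g⟩ := by
  obtain ⟨kX0, rX0, kY0, rY0, tmp0⟩ := hi
  have hpkX : p ≠ .kX := by rcases hp with rfl | rfl | rfl <;> decide
  have hprX : p ≠ .rX := by rcases hp with rfl | rfl | rfl <;> decide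
  have hpkY : p ≠ .kY := by rcases hp with rfl | rfl | rfl <;> decide
  have hprY : p ≠ .rY := by rcases hp with rfl | rfl | rfl <;> decide
  have hptmp : p ≠ .tmp := by rcases hp with rfl | rfl | rfl <;> decide
  -- The case of a gate with one operand, common to H and T.
  have one : ∀ (L : List (PreGate SymWire)) (hL : ∀ g ∈ L, g.Ok) (t : Tok) (i : Fin a ⊕ Fin b),
      encodeGate g = t :: encodeWire i →
      (∀ c' : Reg → ℕ, c' .kX = wireKind i → c' .rX = wireIdx i →
        symDesc L c' = ctrlDesc n ctl g) →
      CExec w B (Prog.seqs [cInc p, readWire p .kX .rX, printGates L,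
        unreadWire p .kX .rX, cDec p]) ⟨c, out⟩ ⟨c, out ++ ctrlDesc n ctl g⟩ := by
    intro L hL t i hg hsym
    have hlen : u.length + 1 ≤ w.length := by rw [hw, hg]; simp
    have e₁ : CExec w B (cInc p : HProg) ⟨c, out⟩ ⟨Function.update c p (c p + 1), out⟩ :=
      exec_inc (by omega) rfl
    have e₂ := exec_readWire (w := w) (B := B) hpkX hprX (by decide) (u := u ++ [t]) (v := v)
      (i := i) (by rw [hw, hg]; simp) hv hB (c := Function.update c p (c p + 1)) (out := out)
      (by simp [hcp]) (by simp [hpkX.symm, kX0]) (by simp [hprX.symm, rX0]) rfl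
    have b₂ := CExec.le e₂ (CExec.le e₁ hc)
    have e₃ := prints_gates (w := w) (B := B) hL _ out (by simp [hptmp.symm, tmp0]) b₂
    rw [hsym _ (by simp) (by simp)] at e₃
    refine exec_seqs_cons e₁ (exec_seqs_cons e₂ (exec_seqs_cons e₃ (exec_seqs_cons
      (exec_unreadWire hpkX hprX (by decide) ?_ rfl) (exec_seqs_cons (exec_dec ?_ ?_)
        (exec_seqs_nil _)))))
    · simp [hpkX, hprX]
    · simp [hpkX, hprX]
    · funext r
      simp only [Function.update_apply]
      split_ifs <;> simp_all <;> omega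
  have hfirst : w[c p]? = (encodeGate g).head? := by
    rw [hw, hcp]
    cases g <;> simp [encodeGate]
  cases g with
  | H i =>
    refine .iteTrue (by simp [CTest.sem, hfirst, encodeGate, Tok.isGateH]) (one _
      (ok_ctrlH trivial (by simp [wireX, SymWire.Ok])) _ i rfl fun c' h₁ h₂ => ?_)
    simp only [symDesc, map_ctrlH, ctrlDesc, ctrlGate, wireX, eval_var h₁ h₂]
    rfl
  | T i =>
    refine .iteFalse (by simp [CTest.sem, hfirst, encodeGate, Tok.isGateH]) (.iteTrue
      (by simp [CTest.sem, hfirst, encodeGate, Tok.isGateT]) (one _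
      (ok_ctrlT trivial trivial (by simp [wireX, SymWire.Ok])) _ i rfl fun c' h₁ h₂ => ?_))
    simp only [symDesc, map_ctrlT, ctrlDesc, ctrlGate, wireX, eval_var h₁ h₂]
    rfl
  | CNOT i j hij =>
    refine .iteFalse (by simp [CTest.sem, hfirst, encodeGate, Tok.isGateH]) (.iteFalse
      (by simp [CTest.sem, hfirst, encodeGate, Tok.isGateT]) (.iteTrue
      (by simp [CTest.sem, hfirst, encodeGate, Tok.isGateCNOT]) ?_))
    have hlen : u.length + 1 ≤ w.length := by rw [hw]; simp [encodeGate]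
    have e₁ : CExec w B (cInc p : HProg) ⟨c, out⟩ ⟨Function.update c p (c p + 1), out⟩ :=
      exec_inc (by omega) rfl
    have e₂ := exec_readWire (w := w) (B := B) hpkX hprX (by decide) (u := u ++ [.gateCNOT])
      (v := encodeWire j ++ v)
      (i := i) (by rw [hw]; simp [encodeGate]) (by cases j <;> simp [encodeWire]) hB
      (c := Function.update c p (c p + 1)) (out := out)
      (by simp [hcp]) (by simp [hpkX.symm, kX0]) (by simp [hprX.symm, rX0]) rfl
    have e₃ := exec_readWire (w := w) (B := B) hpkY hprY (by decide)
      (u := u ++ [.gateCNOT] ++ encodeWire i) (v := v)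
      (i := j) (by rw [hw]; simp [encodeGate]) hv hB
      (c := Function.update (Function.update (Function.update (Function.update c p (c p + 1)) p
      ((u ++ [Tok.gateCNOT]).length + (wireIdx i + 1))) .kX (wireKind i)) .rX (wireIdx i))
      (out := out)
      (by simp [hpkX, hprX, encodeWire_length]; omega) (by simp [hpkY.symm, kY0])
      (by simp [hprY.symm, rY0]) rfl
    have b₃ := CExec.le e₃ (CExec.le e₂ (CExec.le e₁ hc))
    have e₄ := prints_gates (w := w) (B := B) (L := ccx (.fixed (.inr ctl)) wireX wireY)
      (ok_ccx trivial (by simp [wireX, SymWire.Ok]) (by simp [wireY, SymWire.Ok])) _ out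
      (by simp [hptmp.symm, tmp0]) b₃
    simp only [symDesc, map_ccx, wireX, wireY] at e₄
    rw [eval_var (i := i) (by simp [hpkX.symm]) (by simp [hprX.symm]),
      eval_var (i := j) (by simp) (by simp)] at e₄
    refine exec_seqs_cons e₁ (exec_seqs_cons e₂ (exec_seqs_cons e₃ (exec_seqs_cons e₄
      (exec_seqs_cons (exec_unreadWire hpkY hprY (by decide) ?_ rfl) (exec_seqs_cons
      (exec_unreadWire hpkX hprX (by decide) ?_ rfl) (exec_seqs_cons (exec_dec ?_ ?_)
        (exec_seqs_nil _)))))))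
    · simp [hpkX, hprX, hpkY, hprY]
    · simp [hpkX, hprX, hpkY, hprY, hprX.symm, encodeWire_length]; omega
    · simp [hpkX, hprX, hpkY, hprY, hprX.symm, encodeWire_length]; omega
    · funext r
      simp only [Function.update_apply]
      split_ifs <;> simp_all [encodeWire_length] <;> omega

/-- The symbol is none of the gate names. -/
def Tok.NotGate : Tok → Prop
  | .gateH | .gateT | .gateCNOT => False
  | _ => True

/-- Operand symbols are passed over without output, so a scan may advance one symbol at a time and
needs no gate lengths. -/
theorem exec_printCtrl_skip {n : ℕ} {ctl : SymWire} {p : Reg} {c : Reg → ℕ} {out : List Tok}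
    {t : Tok} (hcp : w[c p]? = some t) (ht : t.NotGate) :
    CExec w B (printCtrl n ctl p) ⟨c, out⟩ ⟨c, out⟩ := by
  refine .iteFalse ?_ (.iteFalse ?_ (.iteFalse ?_ (.skip _)))
  all_goals
    simp only [CTest.sem, hcp]
    cases t <;> first | rfl | exact ht.elim

/-- The symbols after the first one in the description of a gate. -/
theorem encodeGate_eq (g : Gate (Fin a ⊕ Fin b)) : ∃ t l, encodeGate g = t :: l ∧
    Tok.isStop (some t) = false ∧ ∀ t ∈ l, t.NotGate ∧ Tok.isStop (some t) = false := by
  have hw : ∀ i : Fin a ⊕ Fin b, ∀ t ∈ encodeWire i, t.NotGate ∧ Tok.isStop (some t) = false := by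
    rintro (i | i) t ht <;>
    · simp only [encodeWire, List.mem_cons, List.mem_replicate] at ht
      rcases ht with rfl | ⟨-, rfl⟩ <;> exact ⟨trivial, rfl⟩
  cases g with
  | H i => exact ⟨_, _, rfl, rfl, hw i⟩
  | T i => exact ⟨_, _, rfl, rfl, hw i⟩
  | CNOT i j h =>
    refine ⟨_, _, rfl, rfl, fun t ht => ?_⟩
    rcases List.mem_append.1 ht with ht | ht
    · exact hw i t ht
    · exact hw j t ht

theorem encodeGate_head_ne (C : Circuit (Fin a ⊕ Fin b)) {v : List Tok}
    (hv : v.head? ≠ some .tally) : (C.flatMap encodeGate ++ v).head? ≠ some .tally := by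
  rcases C with _ | ⟨g, C⟩
  · simpa using hv
  · cases g <;> simp [encodeGate]

/-- Print the controlled versions of the gates from position `p` on, until the circuit ends. -/
def scanForth (p : Reg) : HProg :=
  .loop (.sym p fun t => ! Tok.isStop t) (.seq (printCtrl 1 wireNeg p) (cInc p))

theorem exec_scanForth {p : Reg} (hp : p.IsPtr) {u v : List Tok} {C : Circuit (Fin a ⊕ Fin b)}
    (hw : w = u ++ C.flatMap encodeGate ++ v) (hv : Tok.isStop v.head? = true)
    (hB : w.length ≤ B) {c c' : Reg → ℕ} {out : List Tok} (hc : ∀ r, c r ≤ B) (hi : Idle c)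
    (hcp : c p = u.length)
    (hc' : c' = Function.update c p (u.length + (C.flatMap encodeGate).length)) :
    CExec w B (scanForth p) ⟨c, out⟩ ⟨c', out ++ C.flatMap (ctrlDesc 1 1)⟩ := by
  have hv' : v.head? ≠ some .tally := by
    intro h; rw [h] at hv; cases hv
  induction C generalizing u c out with
  | nil =>
    have : c' = c := by rw [hc', List.flatMap_nil, List.length_nil, Nat.add_zero, ← hcp,
      Function.update_eq_self]
    rw [this, List.flatMap_nil, List.append_nil]
    refine .loopFalse ?_
    simp [CTest.sem, hcp, hw, getElem?_append_length, hv]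
  | cons g C ih =>
    obtain ⟨t, l, hg, ht, hl⟩ := encodeGate_eq g
    have hw' : w = u ++ encodeGate g ++ (C.flatMap encodeGate ++ v) := by rw [hw]; simp
    have hlen : u.length + (l.length + 1) ≤ w.length := by rw [hw', hg]; simp
    -- skipping the rest of the gate
    have skip : ∀ (l : List Tok) (u : List Tok) (c : Reg → ℕ) (out : List Tok) (s : CData Tok Reg),
        (∀ t ∈ l, t.NotGate ∧ Tok.isStop (some t) = false) → (∃ v, w = u ++ l ++ v) →
        c p = u.length →
        CExec w B (scanForth p) ⟨Function.update c p (u.length + l.length), out⟩ s →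
        CExec w B (scanForth p) ⟨c, out⟩ s := by
      intro l
      induction l with
      | nil =>
        intro u c out s _ _ hcp h
        rwa [List.length_nil, Nat.add_zero, ← hcp, Function.update_eq_self] at h
      | cons t l ihl =>
        rintro u c out s hl ⟨v, hw⟩ hcp h
        simp only [List.forall_mem_cons] at hl
        have hwt : w[c p]? = some t := by rw [hw, hcp]; simp
        have hlen : u.length + 1 ≤ w.length := by rw [hw]; simp
        refine .loopTrue ?_ (.seq (exec_printCtrl_skip hwt hl.1.1) (exec_inc (by omega) rfl))
          (ihl (u ++ [t]) _ out s hl.2 ⟨v, by rw [hw]; simp⟩ (by simp [hcp]) ?_)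
        · simp [CTest.sem, hwt, hl.1.2]
        · convert h using 2
          funext r
          simp only [Function.update_apply]
          split_ifs <;> simp_all <;> omega
    have hwt : w[c p]? = some t := by rw [hw', hcp, hg]; simp
    have e₁ := exec_printCtrl_gate (n := 1) (ctl := 1) hp hw' (encodeGate_head_ne C hv') hB
      (out := out) hc hi hcp
    have e₂ : CExec w B (cInc p : HProg) ⟨c, out ++ ctrlDesc 1 1 g⟩
      ⟨Function.update c p (c p + 1), out ++ ctrlDesc 1 1 g⟩ := exec_inc (by omega) rfl
    have b₂ := CExec.le e₂ hc
    refine .loopTrue (by simp [CTest.sem, hwt, ht]) (.seq e₁ e₂)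
      (skip l (u ++ [t]) _ _ _ hl ⟨C.flatMap encodeGate ++ v, by rw [hw', hg]; simp⟩
        (by simp [hcp]) ?_)
    have := ih (u := u ++ encodeGate g) (c := Function.update (Function.update c p (c p + 1)) p
      ((u ++ [t]).length + l.length)) (out := out ++ ctrlDesc 1 1 g) (by rw [hw]; simp) ?_
      ((hi.update hp _).update hp _) ?_ ?_
    · simpa using this
    · intro r
      have := hc r
      simp only [Function.update_apply]
      split_ifs <;> simp <;> omega
    · simp [hg]; omega
    · rw [hc']; simp [hg]; congr 1; omega

/-- Print the controlled inverses of the gates before position `p`, from right to left, and leave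
`p` at the beginning of the circuit. -/
def scanBack (p : Reg) : HProg :=
  .seq (cDec p) (.loop (.sym p fun t => ! Tok.isTurn t) (.seq (printCtrl 7 wireCoin p) (cDec p)))

/-- Moving left, the operands of a gate are met before its name; they print nothing, and at the name
the whole gate is read to the right. The final position, on the turn symbol, is just behind the
preceding circuit and so is the right start for the next backward scan. -/
theorem exec_scanBack {p : Reg} (hp : p.IsPtr) {u v : List Tok} {C : Circuit (Fin a ⊕ Fin b)}
    (hw : w = u ++ .turn :: C.flatMap encodeGate ++ v) (hv : v.head? ≠ some .tally)
    (hB : w.length ≤ B) {c c' : Reg → ℕ} {out : List Tok} (hc : ∀ r, c r ≤ B) (hi : Idle c)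
    (hcp : c p = u.length + 1 + (C.flatMap encodeGate).length)
    (hc' : c' = Function.update c p u.length) :
    CExec w B (scanBack p) ⟨c, out⟩ ⟨c', out ++ C.reverse.flatMap (ctrlDesc 7 0)⟩ := by
  refine .seq (exec_dec (by omega) rfl) ?_
  -- The induction has to remove gates from the end of the circuit.
  obtain ⟨D, hD⟩ : ∃ D, C = D.reverse := ⟨C.reverse, by simp⟩
  subst hD
  rw [List.reverse_reverse]
  induction D generalizing v c out with
  | nil =>
    have : c' = Function.update c p (c p - 1) := by rw [hc', hcp]; simp
    rw [this, List.flatMap_nil, List.append_nil]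
    refine .loopFalse ?_
    simp [CTest.sem, hcp, hw, Tok.isTurn]
  | cons g D ih =>
    obtain ⟨t, l, hg, ht, hl⟩ := encodeGate_eq g
    simp only [List.reverse_cons, List.flatMap_append, List.flatMap_cons, List.flatMap_nil,
      List.append_nil, List.length_append] at hw hcp
    set U := u ++ .turn :: D.reverse.flatMap encodeGate with hU
    have hUl : U.length = u.length + 1 + (D.reverse.flatMap encodeGate).length := by
      simp [hU]; omega
    have hw' : w = U ++ encodeGate g ++ v := by rw [hw, hU]; simp
    have hlen : U.length + (l.length + 1) ≤ w.length := by rw [hw', hg]; simp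
    have skip : ∀ k ≤ l.length, ∀ (s : CData Tok Reg),
        CExec w B (.loop (.sym p fun t => ! Tok.isTurn t)
          (.seq (printCtrl 7 wireCoin p) (cDec p)) : HProg) ⟨Function.update c p U.length, out⟩ s →
        CExec w B (.loop (.sym p fun t => ! Tok.isTurn t)
          (.seq (printCtrl 7 wireCoin p) (cDec p)) : HProg)
          ⟨Function.update c p (U.length + k), out⟩ s := by
      intro k
      induction k with
      | zero => intro _ s h; exact h
      | succ k ihk =>
        intro hk s h
        have hwt : w[U.length + (k + 1)]? = some (l[k]'hk) := by
          rw [hw', hg, List.append_assoc, List.getElem?_append_right (by omega)]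
          simp [List.getElem?_append_left hk]
        obtain ⟨h₁, h₂⟩ := hl _ (List.getElem_mem hk)
        refine .loopTrue ?_ (.seq (exec_printCtrl_skip (t := l[k]'hk) (by simpa using hwt) h₁)
          (exec_dec (by simp) (c' := Function.update c p (U.length + k)) ?_))
          (ihk (by omega) s h)
        · simp only [CTest.sem, Function.update_self, hwt]
          generalize l[k] = t at h₂
          cases t <;> first | rfl | cases h₂
        · simp
    have hcpU : c p - 1 = U.length + l.length := by
      have : (encodeGate g).length = l.length + 1 := by simp [hg]
      omega
    rw [hcpU]
    refine skip l.length le_rfl _ ?_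
    have hwt : w[U.length]? = some t := by rw [hw', hg]; simp
    have bU : ∀ r, Function.update c p U.length r ≤ B := by
      intro r
      have := hc r
      simp only [Function.update_apply]
      split_ifs <;> omega
    have e₁ := exec_printCtrl_gate (n := 7) (ctl := 0) hp hw' hv hB
      (out := out) bU (hi.update hp _) (by simp)
    have e₂ := ih (v := encodeGate g ++ v) (c := Function.update c p U.length)
      (out := out ++ ctrlDesc 7 0 g) (hw := by rw [hw', hU]; simp)
      (hv := by cases g <;> simp [encodeGate]) (hc := bU)
      (hi := hi.update hp _) (hcp := by simp [hUl]) (hc' := by rw [hc']; simp)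
    rw [List.append_assoc] at e₂
    refine .loopTrue ?_ (.seq e₁ (exec_dec (by simp [hUl]) rfl)) e₂
    simp only [CTest.sem, Function.update_self, hwt]
    cases t <;> first | rfl | cases ht

end

/-! #### The program -/

/-- The counters, given by their values. -/
@[simp] def regs (nM nW pf pb pz kX rX kY rY kZ rZ tmp cnt : ℕ) : Reg → ℕ
  | .nM => nM
  | .nW => nW
  | .pf => pf
  | .pb => pb
  | .pz => pz
  | .kX => kX
  | .rX => rX
  | .kY => kY
  | .rY => rY
  | .kZ => kZ
  | .rZ => rZ
  | .tmp => tmp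
  | .cnt => cnt

section regs

variable (nM nW pf pb pz kX rX kY rY kZ rZ tmp cnt v : ℕ)

local notation "R₀" => regs nM nW pf pb pz kX rX kY rY kZ rZ tmp cnt

@[simp] theorem update_regs_nM : Function.update R₀ .nM v =
    regs v nW pf pb pz kX rX kY rY kZ rZ tmp cnt := by funext r; cases r <;> rfl
@[simp] theorem update_regs_nW : Function.update R₀ .nW v =
    regs nM v pf pb pz kX rX kY rY kZ rZ tmp cnt := by funext r; cases r <;> rfl
@[simp] theorem update_regs_pf : Function.update R₀ .pf v =
    regs nM nW v pb pz kX rX kY rY kZ rZ tmp cnt := by funext r; cases r <;> rfl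
@[simp] theorem update_regs_pb : Function.update R₀ .pb v =
    regs nM nW pf v pz kX rX kY rY kZ rZ tmp cnt := by funext r; cases r <;> rfl
@[simp] theorem update_regs_pz : Function.update R₀ .pz v =
    regs nM nW pf pb v kX rX kY rY kZ rZ tmp cnt := by funext r; cases r <;> rfl
@[simp] theorem update_regs_kX : Function.update R₀ .kX v =
    regs nM nW pf pb pz v rX kY rY kZ rZ tmp cnt := by funext r; cases r <;> rfl
@[simp] theorem update_regs_rX : Function.update R₀ .rX v =
    regs nM nW pf pb pz kX v kY rY kZ rZ tmp cnt := by funext r; cases r <;> rfl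
@[simp] theorem update_regs_kY : Function.update R₀ .kY v =
    regs nM nW pf pb pz kX rX v rY kZ rZ tmp cnt := by funext r; cases r <;> rfl
@[simp] theorem update_regs_rY : Function.update R₀ .rY v =
    regs nM nW pf pb pz kX rX kY v kZ rZ tmp cnt := by funext r; cases r <;> rfl
@[simp] theorem update_regs_kZ : Function.update R₀ .kZ v =
    regs nM nW pf pb pz kX rX kY rY v rZ tmp cnt := by funext r; cases r <;> rfl
@[simp] theorem update_regs_rZ : Function.update R₀ .rZ v =
    regs nM nW pf pb pz kX rX kY rY kZ v tmp cnt := by funext r; cases r <;> rfl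
@[simp] theorem update_regs_tmp : Function.update R₀ .tmp v =
    regs nM nW pf pb pz kX rX kY rY kZ rZ v cnt := by funext r; cases r <;> rfl
@[simp] theorem update_regs_cnt : Function.update R₀ .cnt v =
    regs nM nW pf pb pz kX rX kY rY kZ rZ tmp v := by funext r; cases r <;> rfl

end regs

/-- Read the sizes of the registers. -/
def readHeader : HProg := Prog.seqs
  [.loop (.sym .pf Tok.isTally) (.seq (cInc .nM) (cInc .pf)), cInc .pf,
    .loop (.sym .pf Tok.isTally) (.seq (cInc .nW) (cInc .pf)), cInc .pf,
    cRepeat .pf .tmp (.seq (cInc .pb) (cInc .pz))]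

/-- Print the sizes of the new registers. -/
def printHeader : HProg :=
  .seq (cRepeat .nM .tmp (cEmit .tally)) <| .seq (cRepeat .nW .tmp (cEmit .tally)) <|
  .seq (cEmit .tally) <| .seq (cEmit .endM) <|
  .seq (cEmit .tally) <| .seq (cEmit .tally) <| .seq (cEmit .tally) <| .seq (cEmit .tally) <|
  .seq (cRepeat .nW .tmp (cEmit .tally)) <| .seq (cRepeat .nW .tmp (cEmit .tally)) <|
  .seq (cEmit .tally) (cEmit .endW)

/-- Move a pointer to the beginning of the next circuit. -/
def nextTurn (p : Reg) : HProg :=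
  .seq (cInc p) (.loop (.sym p fun t => ! Tok.isStop t) (cInc p))

/-- Move `pf` and `pb` to the middle circuit. -/
def findMiddle : HProg :=
  .seq (nextTurn .pz) (.loop (.sym .pz Option.isSome)
    (Prog.seqs [nextTurn .pz, nextTurn .pz, nextTurn .pf, nextTurn .pb]))

/-- Print the first circuit. -/
def printFirst : HProg := Prog.seqs
  [cEmit .turn, cRepeat .nM .tmp (cInc .rX), cInc .kY,
    cRepeat .nW .cnt (Prog.seqs [printGates [.cx wireX wireY, .cx wireY wireX], cInc .rX, cInc .rY]),
    printGates ([.h wireCoin, .cx wireCoin wireX] ++ pauliX wireNeg ++ [.cx wireCoin wireNeg]),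
    cClear .rX, cClear .rY, cClear .kY, cInc .pf, scanForth .pf]

/-- Print the computation of the answer. -/
def printAnswer : HProg := Prog.seqs
  [.ite (.pos .nM) .skip (cInc .kX), printGates (ccx wireNeg wireX wireAns), cClear .kX,
    cInc .kX, cInc .kY, cInc .kZ, cRepeat .nW .tmp (.seq (cInc .rY) (cInc .rZ)), cInc .rZ,
    printGates [.cx wireCoin wireY],
    cRepeat .nW .cnt (Prog.seqs [printGates (pauliX wireX ++ ccx wireY wireX wireZ),
      cInc .rX, cInc .rY, cInc .rZ]),
    printGates [.cx wireY wireAns, .cx (.fixed (.inl 0)) wireAns, .cx wireAns (.fixed (.inl 0))]]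

/-- Print the other circuits. -/
def printRounds : HProg := .loop (.sym .pf Option.isSome)
  (Prog.seqs [cEmit .turn, cInc .pf, scanForth .pf, scanBack .pb,
    .ite (.sym .pf Option.isSome) .skip printAnswer])

def halveProgram : HProg :=
  Prog.seqs [readHeader, printHeader, findMiddle, printFirst, printRounds]

section

variable {w : List Tok} {B a b : ℕ}

theorem exec_readHeader {v : List Tok} {out : List Tok}
    (hw : w = List.replicate a .tally ++ .endM :: (List.replicate b .tally ++ .endW :: v))
    (hB : w.length ≤ B) :
    CExec w B readHeader ⟨fun _ => 0, out⟩
      ⟨regs a b (a + b + 2) (a + b + 2) (a + b + 2) 0 0 0 0 0 0 0 0, out⟩ := by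
  have h0 : (fun _ => 0 : Reg → ℕ) = regs 0 0 0 0 0 0 0 0 0 0 0 0 0 := by
    funext r; cases r <;> rfl
  have hlen : a + b + 2 ≤ w.length := by rw [hw]; simp; omega
  rw [h0]
  refine exec_seqs_cons (s' := ⟨regs a 0 a 0 0 0 0 0 0 0 0 0 0, out⟩)
    (exec_loop_tally (by decide) (u := []) (n := a) (by rw [hw]; rfl) (by simp) hB (by simp)
      (by simp; omega) (by simp)) (exec_seqs_cons
      (s' := ⟨regs a 0 (a + 1) 0 0 0 0 0 0 0 0 0 0, out⟩) (exec_inc (by simp; omega) (by simp))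
    (exec_seqs_cons (s' := ⟨regs a b (a + 1 + b) 0 0 0 0 0 0 0 0 0 0, out⟩)
      (exec_loop_tally (by decide) (u := List.replicate a .tally ++ [.endM]) (n := b)
        (by rw [hw, List.append_assoc, List.append_assoc]; rfl) (by simp) hB (by simp)
        (by simp; omega) (by simp))
      (exec_seqs_cons (s' := ⟨regs a b (a + b + 2) 0 0 0 0 0 0 0 0 0 0, out⟩)
        (exec_inc (by simp; omega)
          (by rw [update_regs_pf]; congr 1; simp only [regs]; omega))
        (exec_seqs_cons ?_ (exec_seqs_nil _)))))
  refine exec_cRepeat (by decide) (n := a + b + 2) (by omega)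
    (fun i => regs a b (a + b + 2) i i 0 0 0 0 0 0 0 0) (fun _ => out) (by simp) (by simp) ?_
  intro i hi
  exact .seq (exec_inc (by simp; omega) rfl) (exec_inc (by simp; omega) (by simp))

theorem exec_printHeader {c : Reg → ℕ} {out : List Tok} (htmp : c .tmp = 0)
    (hB : ∀ r, c r ≤ B) : CExec w B printHeader ⟨c, out⟩
      ⟨c, out ++ (List.replicate (c .nM + (c .nW + 1)) .tally ++ .endM ::
        (List.replicate (4 + (c .nW + (c .nW + 1))) .tally ++ [.endW]))⟩ := by
  have e := fun a : Tok => prints_emit (w := w) (B := B) (d := Reg.tmp) a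
  have m := prints_repeat (w := w) (B := B) (r := Reg.nM) (d := .tmp) (by decide) Tok.tally
  have n := prints_repeat (w := w) (B := B) (r := Reg.nW) (d := .tmp) (by decide) Tok.tally
  have := (m.seq (n.seq ((e .tally).seq ((e .endM).seq ((e .tally).seq ((e .tally).seq
    ((e .tally).seq ((e .tally).seq (n.seq (n.seq ((e .tally).seq (e .endW))))))))))))
    c out htmp hB
  have h₄ : List.replicate (4 + (c .nW + (c .nW + 1))) Tok.tally = .tally :: .tally :: .tally ::
      .tally :: (List.replicate (c .nW) .tally ++ (List.replicate (c .nW) .tally ++ [.tally])) := by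
    rw [List.replicate_add, List.replicate_add, List.replicate_succ' (n := c .nW)]
    rfl
  rw [h₄, List.replicate_add, List.replicate_succ' (n := c .nW)]
  simp only [List.append_assoc, List.singleton_append, List.cons_append, List.nil_append] at this ⊢
  exact this

/-- The description of a circuit in a tuple of circuits. -/
def turnDesc (C : Circuit (Fin a ⊕ Fin b)) : List Tok := .turn :: C.flatMap encodeGate

theorem isStop_head_turnDesc (Cs : List (Circuit (Fin a ⊕ Fin b))) :
    Tok.isStop (Cs.flatMap turnDesc).head? = true := by
  cases Cs <;> rfl

theorem exec_nextTurn {p : Reg} {u v : List Tok} {C : Circuit (Fin a ⊕ Fin b)}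
    (hw : w = u ++ turnDesc C ++ v) (hv : Tok.isStop v.head? = true) (hB : w.length ≤ B)
    {c c' : Reg → ℕ} {out : List Tok} (hcp : c p = u.length)
    (hc' : c' = Function.update c p (u ++ turnDesc C).length) :
    CExec w B (nextTurn p) ⟨c, out⟩ ⟨c', out⟩ := by
  have key : ∀ (l : List Tok) (u : List Tok) (c : Reg → ℕ),
      (∀ t ∈ l, Tok.isStop (some t) = false) → w = u ++ l ++ v → c p = u.length →
      CExec w B (.loop (.sym p fun t => ! Tok.isStop t) (cInc p) : HProg) ⟨c, out⟩
        ⟨Function.update c p (u ++ l).length, out⟩ := by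
    intro l
    induction l with
    | nil =>
      intro u c _ hw hcp
      rw [List.append_nil, ← hcp, Function.update_eq_self]
      refine .loopFalse ?_
      simp [CTest.sem, hcp, hw, getElem?_append_length, hv]
    | cons t l ih =>
      intro u c hl hw hcp
      simp only [List.forall_mem_cons] at hl
      have hwt : w[c p]? = some t := by rw [hw, hcp]; simp
      have hlen : u.length + 1 ≤ w.length := by rw [hw]; simp
      refine .loopTrue ?_ (exec_inc (by omega) rfl) ?_
      · simp [CTest.sem, hwt, hl.1]
      · have := ih (u ++ [t]) (Function.update c p (c p + 1)) hl.2 (by rw [hw]; simp)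
          (by simp [hcp])
        simpa using this
  have hturn : ∀ t ∈ C.flatMap encodeGate, Tok.isStop (some t) = false := by
    intro t ht
    obtain ⟨g, -, ht⟩ := List.mem_flatMap.1 ht
    obtain ⟨t', l, hg, h₁, h₂⟩ := encodeGate_eq g
    rw [hg] at ht
    rcases List.mem_cons.1 ht with rfl | ht
    · exact h₁
    · exact (h₂ t ht).2
  have hlen : u.length + 1 ≤ w.length := by rw [hw]; simp [turnDesc]
  refine .seq (exec_inc (by omega) rfl) ?_
  have := key (C.flatMap encodeGate) (u ++ [.turn]) (Function.update c p (c p + 1)) hturn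
    (by rw [hw]; simp [turnDesc]) (by simp [hcp])
  rw [hc']
  simpa [turnDesc] using this

/-! #### Positions of the circuits -/

variable {hdr : List Tok} {Cs : List (Circuit (Fin a ⊕ Fin b))}

/-- The position of the `k`-th circuit. -/
def turnPos (hdr : List Tok) (Cs : List (Circuit (Fin a ⊕ Fin b))) (k : ℕ) : ℕ :=
  (hdr ++ (Cs.take k).flatMap turnDesc).length

theorem split_at_turn (hw : w = hdr ++ Cs.flatMap turnDesc) {k : ℕ} (hk : k < Cs.length) :
    w = (hdr ++ (Cs.take k).flatMap turnDesc) ++ turnDesc Cs[k] ++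
      (Cs.drop (k + 1)).flatMap turnDesc := by
  conv_lhs => rw [hw, ← List.take_append_drop k Cs, List.drop_eq_getElem_cons hk]
  simp only [List.flatMap_append, List.flatMap_cons, List.append_assoc]

theorem turnPos_succ {k : ℕ} (hk : k < Cs.length) :
    turnPos hdr Cs (k + 1) =
      ((hdr ++ (Cs.take k).flatMap turnDesc) ++ turnDesc Cs[k]).length := by
  rw [turnPos, List.take_succ_eq_append_getElem hk]
  simp only [List.flatMap_append, List.flatMap_cons, List.flatMap_nil, List.append_nil,
    List.append_assoc]

theorem turnPos_le (hw : w = hdr ++ Cs.flatMap turnDesc) (k : ℕ) :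
    turnPos hdr Cs k ≤ w.length := by
  rw [hw, turnPos]
  conv_rhs => rw [← List.take_append_drop k Cs]
  simp only [List.flatMap_append, List.length_append]
  omega

/-- Whether there is a `k`-th circuit can be seen from whether its position lies inside the word:
this is the end test of the loops over the circuits. -/
theorem getElem?_turnPos (hw : w = hdr ++ Cs.flatMap turnDesc) (k : ℕ) :
    (w[turnPos hdr Cs k]?).isSome = decide (k < Cs.length) := by
  have : w = (hdr ++ (Cs.take k).flatMap turnDesc) ++ (Cs.drop k).flatMap turnDesc := by
    conv_lhs => rw [hw, ← List.take_append_drop k Cs]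
    simp only [List.flatMap_append, List.append_assoc]
  have h : w[turnPos hdr Cs k]? = ((Cs.drop k).flatMap turnDesc).head? := by
    conv_lhs => rw [this]
    exact getElem?_append_length _ _
  rw [h]
  rcases Nat.lt_or_ge k Cs.length with hk | hk
  · rw [List.drop_eq_getElem_cons hk]
    simp only [List.flatMap_cons, turnDesc, List.cons_append, List.head?_cons, hk]
    rfl
  · rw [List.drop_eq_nil_of_le hk]
    simp [hk]

theorem exec_nextTurn_pos (hw : w = hdr ++ Cs.flatMap turnDesc) (hB : w.length ≤ B) {p : Reg}
    {k : ℕ} (hk : k < Cs.length) {c c' : Reg → ℕ} {out : List Tok}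
    (hcp : c p = turnPos hdr Cs k) (hc' : c' = Function.update c p (turnPos hdr Cs (k + 1))) :
    CExec w B (nextTurn p) ⟨c, out⟩ ⟨c', out⟩ :=
  exec_nextTurn (split_at_turn hw hk) (isStop_head_turnDesc _) hB hcp
    (by rw [hc', turnPos_succ hk])

/-- `pz` starts one circuit ahead and moves two circuits per pass, the other pointers one; when `pz`
has passed all 2m+1 circuits, they stand at circuit `m`. -/
theorem exec_findMiddle (hw : w = hdr ++ Cs.flatMap turnDesc) (hB : w.length ≤ B) {m : ℕ}
    (hm : Cs.length = 2 * m + 1) {nM nW : ℕ} {out : List Tok} :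
    CExec w B findMiddle
      ⟨regs nM nW (turnPos hdr Cs 0) (turnPos hdr Cs 0) (turnPos hdr Cs 0) 0 0 0 0 0 0 0 0, out⟩
      ⟨regs nM nW (turnPos hdr Cs m) (turnPos hdr Cs m) (turnPos hdr Cs (2 * m + 1))
        0 0 0 0 0 0 0 0, out⟩ := by
  have key : ∀ k i, k + i = m → CExec w B (.loop (.sym .pz Option.isSome)
      (Prog.seqs [nextTurn .pz, nextTurn .pz, nextTurn .pf, nextTurn .pb]) : HProg)
      ⟨regs nM nW (turnPos hdr Cs i) (turnPos hdr Cs i) (turnPos hdr Cs (2 * i + 1))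
        0 0 0 0 0 0 0 0, out⟩
      ⟨regs nM nW (turnPos hdr Cs m) (turnPos hdr Cs m) (turnPos hdr Cs (2 * m + 1))
        0 0 0 0 0 0 0 0, out⟩ := by
    intro k
    induction k with
    | zero =>
      intro i hi
      obtain rfl : i = m := by omega
      refine .loopFalse ?_
      simp only [CTest.sem, regs, getElem?_turnPos hw]
      simp [hm]
    | succ k ih =>
      intro i hi
      refine .loopTrue ?_ (exec_seqs_cons
        (exec_nextTurn_pos hw hB (k := 2 * i + 1) (by omega) rfl rfl) (exec_seqs_cons
        (exec_nextTurn_pos hw hB (k := 2 * i + 1 + 1) (by omega) (by simp) rfl) (exec_seqs_cons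
        (exec_nextTurn_pos hw hB (k := i) (by omega) (by simp) rfl) (exec_seqs_cons
        (exec_nextTurn_pos hw hB (k := i) (by omega) (by simp) ?_) (exec_seqs_nil _)))))
        (ih (i + 1) (by omega))
      · simp only [CTest.sem, regs, getElem?_turnPos hw]
        simp [hm]; omega
      · simp only [update_regs_pz, update_regs_pf, update_regs_pb]
        rfl
  exact .seq (exec_nextTurn_pos hw hB (k := 0) (by omega) rfl (by simp)) (key m 0 (by omega))

/-! #### The circuits of the halved verifier -/

/-- The description of a gate list. -/
def gatesDesc (L : List (PreGate (ℕ ⊕ ℕ))) : List Tok := L.flatMap encodePreGate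

theorem flatMap_finRange {α : Type} (n : ℕ) (f : ℕ → List α) :
    (List.finRange n).flatMap (fun i => f i.val) = (List.range n).flatMap f := by
  rw [← List.map_coe_finRange_eq_range, List.flatMap_map]

variable {o : Fin a ⊕ Fin b}

/-- The wires of the halved verifier, as numbers. -/
abbrev natLayout (o : Fin a ⊕ Fin b) : Layout a b (ℕ ⊕ ℕ) := (finLayout a b o).map wireVal

theorem natLayout_old : (natLayout o).old = oldWire := by
  funext x; cases x <;> rfl

theorem forth_desc (C : Circuit (Fin a ⊕ Fin b)) :
    gatesDesc ((natLayout o).forth C) = C.flatMap (ctrlDesc 1 1) := by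
  simp only [gatesDesc, Layout.forth, List.flatMap_assoc, natLayout_old]
  rfl

theorem back_desc (C : Circuit (Fin a ⊕ Fin b)) :
    gatesDesc ((natLayout o).back C) = C.reverse.flatMap (ctrlDesc 7 0) := by
  simp only [gatesDesc, Layout.back, List.flatMap_assoc, natLayout_old]
  rfl

/-- In pass `i`, with register kinds 0 and 1, the wires X and Y are message qubit a + i and the old
private qubit at 4 + i. The loop uses `cnt` as its temporary counter because printing a wire needs
`tmp`. -/
theorem exec_receive {pf pb pz : ℕ} (hB : ∀ r, regs a b pf pb pz 0 (a + b) 1 b 0 0 0 b r ≤ B)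
    {out : List Tok} : CExec w B
      (cRepeat .nW .cnt (Prog.seqs [printGates [.cx wireX wireY, .cx wireY wireX],
        cInc .rX, cInc .rY]))
      ⟨regs a b pf pb pz 0 a 1 0 0 0 0 0, out⟩
      ⟨regs a b pf pb pz 0 (a + b) 1 b 0 0 0 0, out ++ gatesDesc (natLayout o).receive⟩ := by
  have h₁ := hB .rX
  have h₂ := hB .nW
  have h₃ := hB .kY
  simp only [regs] at h₁ h₂ h₃
  have key := exec_cRepeat (w := w) (B := B) (r := Reg.nW) (d := .cnt) (by decide) (n := b)
    (p := Prog.seqs [printGates [.cx wireX wireY, .cx wireY wireX], cInc .rX, cInc .rY])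
    h₂ (fun i => regs a b pf pb pz 0 (a + i) 1 i 0 0 0 0)
    (fun i => out ++ (List.range i).flatMap fun j =>
      gatesDesc [.cx (.inl (a + j)) (.inr (4 + j)), .cx (.inr (4 + j)) (.inl (a + j))])
    (c := regs a b pf pb pz 0 a 1 0 0 0 0 0) (c' := regs a b pf pb pz 0 (a + b) 1 b 0 0 0 0)
    (by simp) (by simp) ?_
  · convert key using 2
    · simp
    · congr 1
      rw [← flatMap_finRange]
      simp only [gatesDesc, Layout.receive, List.flatMap_assoc]
      rfl
  · intro i hi
    have bound : ∀ r, regs a (b - (i + 1)) pf pb pz 0 (a + i) 1 i 0 0 0 (i + 1) r ≤ B := by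
      intro r
      have := hB r
      cases r <;> simp only [regs] at this ⊢ <;> omega
    have e := prints_gates (w := w) (B := B) (L := [.cx wireX wireY, .cx wireY wireX])
      (by simp [PreGate.Ok, wireX, wireY, SymWire.Ok]) _
      (out ++ (List.range i).flatMap fun j =>
        gatesDesc [.cx (.inl (a + j)) (.inr (4 + j)), .cx (.inr (4 + j)) (.inl (a + j))])
      (by simp) bound
    simp only [update_regs_nW, update_regs_cnt]
    refine exec_seqs_cons e (exec_seqs_cons (exec_inc (by simp; omega) rfl)
      (exec_seqs_cons (exec_inc (by simp; omega) rfl) ?_))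
    convert exec_seqs_nil _ using 2
    · simp [add_assoc]
    · simp [List.range_succ, symDesc, gatesDesc, PreGate.map, SymWire.eval, wireX, wireY]

theorem exec_printFirst (hw : w = hdr ++ Cs.flatMap turnDesc) (hh : a + b + 2 ≤ hdr.length)
    (hB : w.length + 1 ≤ B) {m : ℕ} (hm : Cs.length = 2 * m + 1) {pz : ℕ} (hz : pz ≤ B)
    {out : List Tok} :
    CExec w B printFirst
      ⟨regs a b (turnPos hdr Cs m) (turnPos hdr Cs m) pz 0 0 0 0 0 0 0 0, out⟩
      ⟨regs a b (turnPos hdr Cs (m + 1)) (turnPos hdr Cs m) pz 0 0 0 0 0 0 0 0,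
        out ++ .turn :: gatesDesc ((natLayout o).receive ++ (natLayout o).toss ++
          (natLayout o).forth (Cs.getD m []))⟩ := by
  have hlen : hdr.length ≤ w.length := by rw [hw]; simp
  have hp := turnPos_le hw m
  have bound : ∀ kY ≤ 1, ∀ rX ≤ a + b, ∀ rY ≤ b, ∀ cnt ≤ b, ∀ pf ≤ w.length,
      ∀ r, regs a b pf (turnPos hdr Cs m) pz 0 rX kY rY 0 0 0 cnt r ≤ B := by
    intro kY _ rX _ rY _ cnt _ pf _ r
    cases r <;> simp only [regs] <;> omega
  have e₁ : CExec w B (cRepeat .nM .tmp (cInc .rX))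
      ⟨regs a b (turnPos hdr Cs m) (turnPos hdr Cs m) pz 0 0 0 0 0 0 0 0, out ++ [.turn]⟩
      ⟨regs a b (turnPos hdr Cs m) (turnPos hdr Cs m) pz 0 a 0 0 0 0 0 0, out ++ [.turn]⟩ := by
    refine exec_cRepeat (w := w) (B := B) (p := cInc .rX) (r := .nM) (d := .tmp) (by decide) (n := a) (by omega)
      (fun i => regs a b (turnPos hdr Cs m) (turnPos hdr Cs m) pz 0 i 0 0 0 0 0 0)
      (fun _ => out ++ [.turn])
      (c := regs a b (turnPos hdr Cs m) (turnPos hdr Cs m) pz 0 0 0 0 0 0 0 0)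
      (c' := regs a b (turnPos hdr Cs m) (turnPos hdr Cs m) pz 0 a 0 0 0 0 0 0)
      (by simp) (by simp) fun i hi => ?_
    exact exec_inc (by simp; omega) (by simp)
  have e₂ := exec_receive (w := w) (o := o) (out := out ++ [.turn])
    (bound 1 le_rfl (a + b) le_rfl b le_rfl b le_rfl _ hp)
  -- The loop has left a + b in `rX`, so `wireX` is now the message qubit that transports the coin.
  have e₃ := prints_gates (w := w) (B := B)
    (L := [.h wireCoin, .cx wireCoin wireX] ++ pauliX wireNeg ++ [.cx wireCoin wireNeg])
    (by
      simp only [List.forall_mem_append, List.forall_mem_cons]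
      simp [PreGate.Ok, wireX, wireCoin, wireNeg, SymWire.Ok, pauliX, tPow]) _
    (out ++ [.turn] ++ gatesDesc (natLayout o).receive) (by simp)
    (bound 1 le_rfl (a + b) le_rfl b le_rfl 0 (Nat.zero_le _) _ hp)
  have hpf : turnPos hdr Cs m + 1 ≤ w.length := by
    have := turnPos_le hw (m + 1)
    rw [turnPos_succ (by omega)] at this
    simp [turnPos, turnDesc] at this ⊢; omega
  have e₄ := exec_scanForth (w := w) (B := B) (p := .pf) (.inl rfl)
    (u := hdr ++ (Cs.take m).flatMap turnDesc ++ [.turn])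
    (C := Cs[m]) (v := (Cs.drop (m + 1)).flatMap turnDesc)
    (by conv_lhs => rw [split_at_turn hw (k := m) (by omega)]
        simp [turnDesc])
    (isStop_head_turnDesc _) (by omega)
    (c := regs a b (turnPos hdr Cs m + 1) (turnPos hdr Cs m) pz 0 0 0 0 0 0 0 0)
    (c' := regs a b (turnPos hdr Cs (m + 1)) (turnPos hdr Cs m) pz 0 0 0 0 0 0 0 0)
    (out := out ++ [.turn] ++ gatesDesc (natLayout o).receive ++
      symDesc ([.h wireCoin, .cx wireCoin wireX] ++ pauliX wireNeg ++ [.cx wireCoin wireNeg])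
        (regs a b (turnPos hdr Cs m) (turnPos hdr Cs m) pz 0 (a + b) 1 b 0 0 0 0))
    (bound 0 (Nat.zero_le _) 0 (Nat.zero_le _) 0 (Nat.zero_le _) 0 (Nat.zero_le _) _ hpf)
    ⟨rfl, rfl, rfl, rfl, rfl⟩
    (by simp only [regs, turnPos, List.length_append, List.length_cons, List.length_nil])
    (by rw [turnPos_succ (by omega)]; rw [update_regs_pf]; congr 1; simp only [turnDesc, List.length_append, List.length_cons, List.length_nil]; omega)
  refine exec_seqs_cons exec_emit (exec_seqs_cons e₁ (exec_seqs_cons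
    (exec_inc (by simp; omega) (update_regs_kY ..).symm) (exec_seqs_cons e₂ (exec_seqs_cons e₃ (exec_seqs_cons
    (exec_cClear (update_regs_rX ..).symm) (exec_seqs_cons (exec_cClear (update_regs_rY ..).symm)
    (exec_seqs_cons (exec_cClear (update_regs_kY ..).symm) (exec_seqs_cons
    (exec_inc (by simp; omega) (update_regs_pf ..).symm)
    (exec_seqs_cons e₄ ?_)))))))))
  convert exec_seqs_nil _ using 2
  rw [← forth_desc (o := o), List.getD_eq_getElem _ _ (show m < Cs.length by omega)]
  simp only [gatesDesc, List.flatMap_append, List.append_assoc, List.singleton_append,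
    List.append_cancel_left_eq, List.cons.injEq, true_and, List.append_cancel_right_eq]
  simp [symDesc, Layout.toss, PreGate.map, SymWire.eval, wireX, wireCoin, wireNeg, map_pauliX,
    finLayout, Layout.map, wireVal]

end

/-! ### Printing the answer and the remaining rounds -/

section

variable {w : List Tok} {B a b : ℕ} {o : Fin a ⊕ Fin b}

/-- The old output qubit depends only on whether there are message qubits, which one test of a
counter decides. The private one sits at 4, behind the four new single qubits. -/
theorem oldOut_natLayout (A : Actions) : (natLayout A.outQubit).oldOut =
    if 0 < A.qM then .inl 0 else .inr 4 := by
  split_ifs with h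
  · rw [A.outQubit_of_pos h]; rfl
  · rw [A.outQubit_of_zero (by omega)]; rfl

theorem chainTest_desc : gatesDesc (natLayout o).chainTest =
    gatesDesc [.cx (.inr 0) (.inr (4 + b))] ++ (List.range b).flatMap fun j =>
      gatesDesc (pauliX (.inr (4 + j)) ++ ccx (.inr (4 + (b + j))) (.inr (4 + j))
        (.inr (4 + (b + (j + 1))))) := by
  rw [← flatMap_finRange]
  simp only [gatesDesc, Layout.chainTest, List.flatMap_cons, List.flatMap_assoc, List.flatMap_nil,
    List.append_nil]
  rfl

/-- In pass `i` the wires X, Y, Z are the old private qubit `i` and the chain qubits `i` and `i +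
1`; the chain lies behind the `b` old private qubits, hence the initial values `b` and `b + 1`. -/
theorem exec_chainTest {pf pb pz : ℕ} (hpf : pf ≤ B) (hpb : pb ≤ B) (hpz : pz ≤ B) (ha : a ≤ B)
    (hb : 2 * b + 1 ≤ B) {out : List Tok} : CExec w B
      (cRepeat .nW .cnt (Prog.seqs [printGates (pauliX wireX ++ ccx wireY wireX wireZ),
        cInc .rX, cInc .rY, cInc .rZ]))
      ⟨regs a b pf pb pz 1 0 1 b 1 (b + 1) 0 0, out ++ gatesDesc [.cx (.inr 0) (.inr (4 + b))]⟩
      ⟨regs a b pf pb pz 1 b 1 (b + b) 1 (b + 1 + b) 0 0,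
        out ++ gatesDesc (natLayout o).chainTest⟩ := by
  have key := exec_cRepeat (w := w) (B := B) (r := Reg.nW) (d := .cnt) (by decide) (n := b)
    (p := Prog.seqs [printGates (pauliX wireX ++ ccx wireY wireX wireZ),
      cInc .rX, cInc .rY, cInc .rZ])
    (by omega) (fun i => regs a b pf pb pz 1 i 1 (b + i) 1 (b + 1 + i) 0 0)
    (fun i => out ++ gatesDesc [.cx (.inr 0) (.inr (4 + b))] ++ (List.range i).flatMap fun j =>
      gatesDesc (pauliX (.inr (4 + j)) ++ ccx (.inr (4 + (b + j))) (.inr (4 + j))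
        (.inr (4 + (b + (j + 1))))))
    (c := regs a b pf pb pz 1 0 1 b 1 (b + 1) 0 0)
    (c' := regs a b pf pb pz 1 b 1 (b + b) 1 (b + 1 + b) 0 0)
    (by simp) (by simp) ?_
  · convert key using 2
    · simp
    · rw [chainTest_desc, List.append_assoc]
  · intro i hi
    have bound : ∀ r, regs a (b - (i + 1)) pf pb pz 1 i 1 (b + i) 1 (b + 1 + i) 0 (i + 1) r ≤ B := by
      intro r
      cases r <;> simp only [regs] <;> omega
    have e := prints_gates (w := w) (B := B) (L := pauliX wireX ++ ccx wireY wireX wireZ)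
      (List.forall_mem_append.2 ⟨ok_pauliX (by simp [wireX, SymWire.Ok]),
        ok_ccx (by simp [wireY, SymWire.Ok]) (by simp [wireX, SymWire.Ok])
          (by simp [wireZ, SymWire.Ok])⟩) _
      (out ++ gatesDesc [.cx (.inr 0) (.inr (4 + b))] ++ (List.range i).flatMap fun j =>
        gatesDesc (pauliX (.inr (4 + j)) ++ ccx (.inr (4 + (b + j))) (.inr (4 + j))
          (.inr (4 + (b + (j + 1))))))
      (by simp) bound
    simp only [update_regs_nW, update_regs_cnt]
    refine exec_seqs_cons e (exec_seqs_cons (exec_inc (by simp; omega) rfl)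
      (exec_seqs_cons (exec_inc (by simp; omega) rfl)
      (exec_seqs_cons (exec_inc (by simp; omega) rfl) ?_)))
    convert exec_seqs_nil _ using 2
    · simp [add_assoc]
    · simp only [List.range_succ, symDesc, gatesDesc, List.map_append, map_pauliX, map_ccx,
        SymWire.eval, wireX, wireY, wireZ, regs, List.flatMap_append, List.flatMap_cons,
        List.flatMap_nil, List.append_nil, List.append_assoc]
      simp [add_assoc, add_comm 1 i]

/-- The answer is the last thing printed, so the counters need not be cleared. -/
theorem exec_printAnswer {pf pb pz : ℕ} (hpf : pf ≤ B) (hpb : pb ≤ B) (hpz : pz ≤ B) (ha : a ≤ B)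
    (hb : 2 * b + 1 ≤ B) (ho : (natLayout o).oldOut = if 0 < a then .inl 0 else .inr 4)
    {out : List Tok} : CExec w B printAnswer
      ⟨regs a b pf pb pz 0 0 0 0 0 0 0 0, out⟩
      ⟨regs a b pf pb pz 1 b 1 (b + b) 1 (b + 1 + b) 0 0,
        out ++ gatesDesc (natLayout o).answer⟩ := by
  obtain ⟨k, hk⟩ : ∃ k, k = if 0 < a then 0 else 1 := ⟨_, rfl⟩
  have hk1 : k ≤ 1 := by rw [hk]; split_ifs <;> omega
  have e₁ : CExec w B (.ite (.pos .nM) .skip (cInc .kX))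
      ⟨regs a b pf pb pz 0 0 0 0 0 0 0 0, out⟩ ⟨regs a b pf pb pz k 0 0 0 0 0 0 0, out⟩ := by
    by_cases h : 0 < a
    · rw [hk, if_pos h]
      exact .iteTrue (decide_eq_true h.ne') (.skip _)
    · rw [hk, if_neg h]
      exact .iteFalse (decide_eq_false fun h' => h (Nat.pos_of_ne_zero h')) (exec_inc (by simp only [regs]; omega) (by simp))
  have e₂ := prints_gates (w := w) (B := B) (L := ccx wireNeg wireX wireAns)
    (ok_ccx trivial (by simp [wireX, SymWire.Ok]) trivial)
    (regs a b pf pb pz k 0 0 0 0 0 0 0) out rfl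
    (by intro r; cases r <;> simp only [regs] <;> omega)
  have s₂ : symDesc (ccx wireNeg wireX wireAns) (regs a b pf pb pz k 0 0 0 0 0 0 0) =
      gatesDesc (ccx (natLayout o).coinNeg (natLayout o).oldOut (natLayout o).ans) := by
    rw [ho]
    simp only [symDesc, map_ccx, wireX, SymWire.eval, regs, hk]
    split_ifs with h <;> first | rfl | simp at *
  have e₃ : CExec w B (cRepeat .nW .tmp (.seq (cInc .rY) (cInc .rZ)))
      ⟨regs a b pf pb pz 1 0 1 0 1 0 0 0, out ++ gatesDesc (ccx (natLayout o).coinNeg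
        (natLayout o).oldOut (natLayout o).ans)⟩ ⟨regs a b pf pb pz 1 0 1 b 1 b 0 0, out ++
        gatesDesc (ccx (natLayout o).coinNeg (natLayout o).oldOut (natLayout o).ans)⟩ := by
    refine exec_cRepeat (w := w) (B := B) (p := .seq (cInc .rY) (cInc .rZ)) (r := .nW) (d := .tmp)
      (by decide) (n := b) (by omega)
      (fun i => regs a b pf pb pz 1 0 1 i 1 i 0 0)
      (fun _ => out ++ gatesDesc (ccx (natLayout o).coinNeg (natLayout o).oldOut (natLayout o).ans))
      (c := regs a b pf pb pz 1 0 1 0 1 0 0 0)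
      (c' := regs a b pf pb pz 1 0 1 b 1 b 0 0)
      (by simp) (by simp) fun i hi => ?_
    exact .seq (exec_inc (by simp; omega) rfl) (exec_inc (by simp; omega) (by simp))
  have e₄ := prints_gates (w := w) (B := B) (L := [.cx wireCoin wireY])
    (by simp [PreGate.Ok, wireCoin, wireY, SymWire.Ok])
    (regs a b pf pb pz 1 0 1 b 1 (b + 1) 0 0) (out ++ gatesDesc (ccx (natLayout o).coinNeg
        (natLayout o).oldOut (natLayout o).ans)) rfl
    (by intro r; cases r <;> simp only [regs] <;> omega)
  have e₅ := exec_chainTest (w := w) (o := o) hpf hpb hpz ha hb (out := out ++ gatesDesc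
    (ccx (natLayout o).coinNeg (natLayout o).oldOut (natLayout o).ans))
  have e₆ := prints_gates (w := w) (B := B)
    (L := [.cx wireY wireAns, .cx (.fixed (.inl 0)) wireAns, .cx wireAns (.fixed (.inl 0))])
    (by simp [PreGate.Ok, wireAns, wireY, SymWire.Ok])
    (regs a b pf pb pz 1 b 1 (b + b) 1 (b + 1 + b) 0 0) (out ++ gatesDesc
    (ccx (natLayout o).coinNeg (natLayout o).oldOut (natLayout o).ans) ++
      gatesDesc (natLayout o).chainTest) rfl
    (by intro r; cases r <;> simp only [regs] <;> omega)
  rw [s₂] at e₂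
  refine exec_seqs_cons e₁ (exec_seqs_cons e₂ (exec_seqs_cons
    (exec_cClear (update_regs_kX ..).symm) (exec_seqs_cons
    (exec_inc (by simp; omega) (update_regs_kX ..).symm) (exec_seqs_cons
    (exec_inc (by simp; omega) (update_regs_kY ..).symm) (exec_seqs_cons
    (exec_inc (by simp; omega) (update_regs_kZ ..).symm) (exec_seqs_cons e₃ (exec_seqs_cons
    (exec_inc (by simp; omega) (update_regs_rZ ..).symm) (exec_seqs_cons e₄ (exec_seqs_cons e₅
    (exec_seqs_cons e₆ ?_))))))))))
  convert exec_seqs_nil _ using 2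
  simp only [gatesDesc, Layout.answer, List.flatMap_append, List.append_assoc]
  rfl

variable {hdr : List Tok} {Cs : List (Circuit (Fin a ⊕ Fin b))}

/-- The invariant: `j` forward circuits are done and `k` backward ones are left. For `k = 0` the
answer has been printed and the other counters are no longer clean, so only the position of `pf`,
which ends the loop, is asserted. -/
theorem exec_printRounds (hw : w = hdr ++ Cs.flatMap turnDesc) (hh : a + b + 2 ≤ hdr.length)
    (hB : 2 * (w.length + 1) ≤ B) {m : ℕ} (hm : Cs.length = 2 * m + 1) {pz : ℕ} (hz : pz ≤ B)
    (ho : (natLayout o).oldOut = if 0 < a then .inl 0 else .inr 4) :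
    ∀ k j, k + j = m → (k = 0 → 0 < j) → ∀ out : List Tok, ∀ c : Reg → ℕ,
      (0 < k → c = regs a b (turnPos hdr Cs (m + 1 + j)) (turnPos hdr Cs k) pz 0 0 0 0 0 0 0 0) →
      c .pf = turnPos hdr Cs (m + 1 + j) →
      ∃ c', CExec w B printRounds ⟨c, out⟩ ⟨c', out ++
        ((natLayout o).rounds (Cs.drop (m + 1 + j)) (Cs.take k).reverse).flatMap fun L =>
          .turn :: gatesDesc L⟩ := by
  have hlen : hdr.length ≤ w.length := by rw [hw]; simp
  intro k
  induction k with
  | zero =>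
    intro j hj _ out c _ hpf
    refine ⟨c, ?_⟩
    simp only [List.take_zero, List.reverse_nil]
    rw [show (natLayout o).rounds (Cs.drop (m + 1 + j)) [] = [] by
      cases Cs.drop (m + 1 + j) <;> rfl, List.flatMap_nil, List.append_nil]
    refine .loopFalse ?_
    simp only [CTest.sem, hpf, getElem?_turnPos hw, hm]
    simp; omega
  | succ k ih =>
    intro j hj _ out c hc _
    obtain rfl := hc (by omega)
    have hk : m + 1 + j < Cs.length := by omega
    have hk' : k < Cs.length := by omega
    have p₁ := turnPos_le hw (m + 1 + j)
    have p₂ := turnPos_le hw (m + 1 + j + 1)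
    have p₃ := turnPos_le hw (k + 1)
    have hpf : turnPos hdr Cs (m + 1 + j) + 1 ≤ w.length := by
      rw [turnPos_succ hk] at p₂
      simp only [turnPos, turnDesc, List.length_append, List.length_cons] at p₂ ⊢; omega
    have e₁ := exec_scanForth (w := w) (B := B) (p := .pf) (.inl rfl)
      (u := hdr ++ (Cs.take (m + 1 + j)).flatMap turnDesc ++ [.turn])
      (C := Cs[m + 1 + j]) (v := (Cs.drop (m + 1 + j + 1)).flatMap turnDesc)
      (by conv_lhs => rw [split_at_turn hw hk]
          simp [turnDesc])
      (isStop_head_turnDesc _) (by omega)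
      (c := regs a b (turnPos hdr Cs (m + 1 + j) + 1) (turnPos hdr Cs (k + 1)) pz 0 0 0 0 0 0 0 0)
      (c' := regs a b (turnPos hdr Cs (m + 1 + j + 1)) (turnPos hdr Cs (k + 1)) pz
        0 0 0 0 0 0 0 0)
      (out := out ++ [.turn])
      (by intro r; cases r <;> simp only [regs] <;> omega)
      ⟨rfl, rfl, rfl, rfl, rfl⟩
      (by simp only [regs, turnPos, List.length_append, List.length_cons, List.length_nil])
      (by rw [turnPos_succ hk, update_regs_pf]; congr 1
          simp only [turnDesc, List.length_append, List.length_cons, List.length_nil]; omega)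
    have e₂ := exec_scanBack (w := w) (B := B) (p := .pb) (.inr (.inl rfl))
      (u := hdr ++ (Cs.take k).flatMap turnDesc)
      (C := Cs[k]) (v := (Cs.drop (k + 1)).flatMap turnDesc)
      (by conv_lhs => rw [split_at_turn hw hk']
          simp [turnDesc])
      (by
        intro h
        have := isStop_head_turnDesc (Cs.drop (k + 1))
        rw [h] at this; cases this) (by omega)
      (c := regs a b (turnPos hdr Cs (m + 1 + j + 1)) (turnPos hdr Cs (k + 1)) pz 0 0 0 0 0 0 0 0)
      (c' := regs a b (turnPos hdr Cs (m + 1 + j + 1)) (turnPos hdr Cs k) pz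
        0 0 0 0 0 0 0 0)
      (out := out ++ [.turn] ++ Cs[m + 1 + j].flatMap (ctrlDesc 1 1))
      (by intro r; cases r <;> simp only [regs] <;> omega)
      ⟨rfl, rfl, rfl, rfl, rfl⟩
      (by simp only [regs, turnPos_succ hk', turnDesc, List.length_append, List.length_cons]; omega)
      (by rw [update_regs_pb]; rfl)
    have hdrop : Cs.drop (m + 1 + j) = Cs[m + 1 + j] :: Cs.drop (m + 1 + j + 1) :=
      List.drop_eq_getElem_cons hk
    have htake : (Cs.take (k + 1)).reverse = Cs[k] :: (Cs.take k).reverse := by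
      rw [List.take_succ_eq_append_getElem hk']; simp
    -- There are as many circuits after the middle as before it, so both supplies run out in the
    -- same round, the one that gets the answer.
    have hempty : (Cs.drop (m + 1 + j + 1)).isEmpty = decide (k = 0) := by
      rw [Bool.eq_iff_iff, List.isEmpty_iff, List.drop_eq_nil_iff, decide_eq_true_iff]; omega
    rcases Nat.eq_zero_or_pos k with h0 | h0
    · subst h0
      have e₃ := exec_printAnswer (w := w) (B := B) (o := o) (pf := turnPos hdr Cs (m + 1 + j + 1))
        (pb := turnPos hdr Cs 0) (pz := pz) (by omega) (by have := turnPos_le hw 0; omega) hz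
        (by omega) (by omega) ho (out := out ++ [.turn] ++ Cs[m + 1 + j].flatMap (ctrlDesc 1 1) ++
          Cs[0].reverse.flatMap (ctrlDesc 7 0))
      obtain ⟨c', e₄⟩ := ih (j + 1) (by omega) (by omega) (out ++ [.turn] ++
        Cs[m + 1 + j].flatMap (ctrlDesc 1 1) ++ Cs[0].reverse.flatMap (ctrlDesc 7 0) ++
          gatesDesc (natLayout o).answer)
        (regs a b (turnPos hdr Cs (m + 1 + j + 1)) (turnPos hdr Cs 0) pz 1 b 1 (b + b) 1 (b + 1 + b)
          0 0) (by omega) rfl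
      refine ⟨c', .loopTrue ?_ (exec_seqs_cons exec_emit (exec_seqs_cons (exec_inc (by simp; omega)
        (update_regs_pf ..).symm) (exec_seqs_cons e₁ (exec_seqs_cons e₂ (exec_seqs_cons
        (.iteFalse ?_ e₃) (exec_seqs_nil _)))))) ?_⟩
      · simp only [CTest.sem, regs, getElem?_turnPos hw]
        simpa using hk
      · simp only [CTest.sem, regs, getElem?_turnPos hw]
        simp; omega
      · convert e₄ using 2
        · rfl
        rw [hdrop, htake, Layout.rounds, hempty]
        simp only [decide_true, if_true, List.flatMap_cons, ← forth_desc (o := o),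
          ← back_desc (o := o), gatesDesc, List.flatMap_append]
        simp only [List.append_assoc, List.cons_append, List.nil_append]
        rfl
    · obtain ⟨c', e₄⟩ := ih (j + 1) (by omega) (by omega) (out ++ [.turn] ++
        Cs[m + 1 + j].flatMap (ctrlDesc 1 1) ++ Cs[k].reverse.flatMap (ctrlDesc 7 0))
        (regs a b (turnPos hdr Cs (m + 1 + j + 1)) (turnPos hdr Cs k) pz
        0 0 0 0 0 0 0 0) (fun _ => rfl) rfl
      refine ⟨c', .loopTrue ?_ (exec_seqs_cons exec_emit (exec_seqs_cons (exec_inc (by simp; omega)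
        (update_regs_pf ..).symm) (exec_seqs_cons e₁ (exec_seqs_cons e₂ (exec_seqs_cons
        (.iteTrue ?_ (.skip _)) (exec_seqs_nil _)))))) ?_⟩
      · simp only [CTest.sem, regs, getElem?_turnPos hw]
        simpa using hk
      · simp only [CTest.sem, regs, getElem?_turnPos hw]
        simp; omega
      · convert e₄ using 2
        · rfl
        have h0' : decide (k = 0) = false := by simp; omega
        rw [hdrop, htake, Layout.rounds, hempty, h0']
        simp only [List.flatMap_cons, ← forth_desc (o := o),
          ← back_desc (o := o), gatesDesc, List.flatMap_append]
        simp only [List.append_assoc, List.cons_append, List.nil_append]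
        rfl

end

/-- The counter program prints the halved verifier. -/
theorem exec_halveProgram (A : Actions) {m : ℕ} (hm : A.circuits.length = 2 * m + 1)
    (hm' : 0 < m) : ∃ c, CExec A.encode (2 * (A.encode.length + 1)) halveProgram
      ⟨fun _ => 0, []⟩ ⟨c, A.halve.encode⟩ := by
  set hdr : List Tok := List.replicate A.qM .tally ++ .endM ::
    (List.replicate A.qW .tally ++ [.endW]) with hhdr
  have hw : A.encode = hdr ++ A.circuits.flatMap turnDesc := by
    rw [hhdr, Actions.encode]
    simp only [List.append_assoc, List.cons_append, List.nil_append]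
    rfl
  have hlen : hdr.length = A.qM + A.qW + 2 := by rw [hhdr]; simp; omega
  have h0 : turnPos hdr A.circuits 0 = A.qM + A.qW + 2 := by simp [turnPos, hlen]
  have hle : hdr.length ≤ A.encode.length := by rw [hw]; simp
  have e₁ := exec_readHeader (w := A.encode) (B := 2 * (A.encode.length + 1))
    (a := A.qM) (b := A.qW) (out := []) rfl (by omega)
  have e₂ := exec_printHeader (w := A.encode) (B := 2 * (A.encode.length + 1))
    (c := regs A.qM A.qW (A.qM + A.qW + 2) (A.qM + A.qW + 2) (A.qM + A.qW + 2) 0 0 0 0 0 0 0 0)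
    (out := []) rfl (by intro r; cases r <;> simp only [regs] <;> omega)
  rw [← h0] at e₁ e₂
  have e₃ := fun out => exec_findMiddle (B := 2 * (A.encode.length + 1)) hw (by omega) hm
    (nM := A.qM) (nW := A.qW) (out := out)
  have e₄ := fun out => exec_printFirst (B := 2 * (A.encode.length + 1)) hw hlen.ge (by omega) hm
    (o := A.outQubit) (pz := turnPos hdr A.circuits (2 * m + 1))
    (by have := turnPos_le hw (2 * m + 1); omega) (out := out)
  obtain ⟨c', e₅⟩ := exec_printRounds (B := 2 * (A.encode.length + 1)) hw hlen.ge le_rfl hm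
    (pz := turnPos hdr A.circuits (2 * m + 1)) (by have := turnPos_le hw (2 * m + 1); omega)
    (oldOut_natLayout A) m 0 rfl (by omega) _ _ (fun _ => rfl) rfl
  refine ⟨c', ?_⟩
  have := exec_seqs_cons e₁ (exec_seqs_cons e₂ (exec_seqs_cons (e₃ _) (exec_seqs_cons (e₄ _)
    (exec_seqs_cons e₅ (exec_seqs_nil _)))))
  convert this using 2
  · rfl
  have hm2 : A.circuits.length / 2 = m := by omega
  rw [Actions.encode_halve, Layout.halved, hm2]
  simp only [List.flatMap_cons, List.append_assoc, List.cons_append, List.nil_append, regs]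
  rfl

theorem logspaceComputableOn_halve {D : Set (List Bool)} {V : List Bool → Actions}
    (hV : LogspaceComputableOn D fun x => (V x).encode)
    (hm : ∀ x ∈ D, ∃ m, 0 < m ∧ (V x).circuits.length = 2 * m + 1) :
    LogspaceComputableOn D fun x => (V x).halve.encode := by
  -- The factor 2 is due to the chain test, where a counter reaches 2b + 1 and may exceed the length
  -- of the old description.
  refine LogspaceComputableOn.comp_cprog hV _ halveProgram 2 fun x hx => ?_
  obtain ⟨m, hm', hm⟩ := hm x hx
  exact exec_halveProgram (V x) hm hm'

/-! ### The action of gate lists on states -/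

open Matrix Function

/-- The phase of the `T` gate. -/
def phase : ℂ := Complex.exp (Real.pi / 4 * Complex.I)

theorem phase_eq : phase = (1 + Complex.I) / ((Real.sqrt 2 : ℝ) : ℂ) := by
  have h2 : ((Real.sqrt 2 : ℝ) : ℂ) * ((Real.sqrt 2 : ℝ) : ℂ) = 2 := by
    rw [← Complex.ofReal_mul, Real.mul_self_sqrt (by norm_num)]; simp
  have h0 : ((Real.sqrt 2 : ℝ) : ℂ) ≠ 0 := by
    intro h; rw [h] at h2; norm_num at h2
  rw [phase, Complex.exp_mul_I, ← Complex.ofReal_ofNat, ← Complex.ofReal_div, ← Complex.ofReal_cos,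
    ← Complex.ofReal_sin, Real.cos_pi_div_four, Real.sin_pi_div_four, eq_div_iff h0]
  push_cast
  linear_combination (1 + Complex.I) / 2 * h2

theorem sqrt_two_sq : ((Real.sqrt 2 : ℝ) : ℂ) ^ 2 = 2 := by
  rw [← Complex.ofReal_pow, Real.sq_sqrt (by norm_num)]; simp

theorem sqrt_two_ne : ((Real.sqrt 2 : ℝ) : ℂ) ≠ 0 := by
  intro h; have := sqrt_two_sq; rw [h] at this; norm_num at this

theorem phase_pow_four : phase ^ 4 = -1 := by
  rw [phase_eq, div_pow, div_eq_iff (pow_ne_zero _ sqrt_two_ne)]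
  have := sqrt_two_sq
  have hI := Complex.I_sq
  linear_combination (Complex.I ^ 2 + 4 * Complex.I + 5) * hI +
    (((Real.sqrt 2 : ℝ) : ℂ) ^ 2 + 2) * this

/-- Relates the eighth root of unity to the normalisation of H; used in verifying the controlled
Hadamard gate. -/
theorem phase_sub : phase - phase ^ 3 = ((Real.sqrt 2 : ℝ) : ℂ) := by
  have := sqrt_two_sq
  have hI := Complex.I_sq
  have h3 : phase ^ 3 = phase * Complex.I := by
    rw [phase_eq]; field_simp [sqrt_two_ne]; rw [this]; linear_combination (1 + Complex.I) * hI
  rw [h3, phase_eq]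
  field_simp [sqrt_two_ne]
  rw [this]; linear_combination -hI

/-- The phase has order 8, so T† is T⁷: inverse circuits stay within the gate set. -/
theorem star_phase : star phase = phase ^ 7 := by
  have h1 : star phase * phase = 1 := by
    have : star phase = Complex.exp (-(Real.pi / 4 * Complex.I)) := by
      rw [phase, Complex.star_def, ← Complex.exp_conj]
      congr 1
      simp [Complex.conj_ofNat]
    rw [this, phase, ← Complex.exp_add, neg_add_cancel, Complex.exp_zero]
  have h4 := phase_pow_four
  linear_combination phase ^ 7 * h1 - star phase * (phase ^ 4 - 1) * h4

section

variable {ι : Type} [DecidableEq ι] [Fintype ι]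

theorem mat_append (C D : Circuit ι) : Circuit.mat (C ++ D) = Circuit.mat D * Circuit.mat C := by
  induction C with
  | nil => simp [Circuit.mat]
  | cons g C ih => simp [Circuit.mat, ih, Matrix.mul_assoc]

theorem H_mulVec (i : ι) (ψ : (ι → Bool) → ℂ) (v : ι → Bool) :
    ((Gate.H i).mat *ᵥ ψ) v = (ψ (update v i false) +
      (if v i then -1 else 1) * ψ (update v i true)) / ((Real.sqrt 2 : ℝ) : ℂ) := by
  have hne : update v i false ≠ update v i true := fun h => by simpa using congrFun h i
  rw [Matrix.mulVec, dotProduct, ← Finset.sum_subset (Finset.subset_univ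
    {update v i false, update v i true}), Finset.sum_pair hne]
  · simp only [Gate.mat, Matrix.of_apply, update_self]
    rw [if_pos (fun j hj => by simp [hj]), if_pos (fun j hj => by simp [hj])]
    cases v i <;> simp <;> ring
  · intro w _ hw
    have : ¬ ∀ j, j ≠ i → v j = w j := by
      intro h
      apply hw
      have : w = update v i (w i) := by
        funext j
        by_cases hj : j = i
        · subst hj; simp
        · simp [hj, h j hj]
      rw [this]
      cases w i <;> simp
    simp [Gate.mat, this]

theorem T_mulVec (i : ι) (ψ : (ι → Bool) → ℂ) (v : ι → Bool) :
    ((Gate.T i).mat *ᵥ ψ) v = (if v i then phase else 1) * ψ v := by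
  simp [Gate.mat, Matrix.mulVec_diagonal, phase]

theorem CNOT_mulVec {a t : ι} (h : a ≠ t) (ψ : (ι → Bool) → ℂ) (v : ι → Bool) :
    ((Gate.CNOT a t h).mat *ᵥ ψ) v = ψ (update v t (xor (v a) (v t))) := by
  have key : ∀ w : ι → Bool, v = update w t (xor (w a) (w t)) ↔
      w = update v t (xor (v a) (v t)) := by
    have : ∀ v w : ι → Bool, v = update w t (xor (w a) (w t)) →
        w = update v t (xor (v a) (v t)) := by
      rintro v w rfl
      simp [h]
    exact fun w => ⟨this v w, this w v⟩
  rw [Matrix.mulVec, dotProduct]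
  simp only [Gate.mat, Matrix.of_apply, key, ite_mul, one_mul, zero_mul]
  simp

/-- The state after a gate list. -/
def run (L : List (PreGate ι)) (ψ : (ι → Bool) → ℂ) : (ι → Bool) → ℂ := (circuitOf L).mat *ᵥ ψ

@[simp] theorem run_nil (ψ : (ι → Bool) → ℂ) : run [] ψ = ψ := by
  simp [run, circuitOf, Circuit.mat]

theorem run_append (L L' : List (PreGate ι)) (ψ : (ι → Bool) → ℂ) :
    run (L ++ L') ψ = run L' (run L ψ) := by
  simp [run, circuitOf, mat_append]

theorem run_cons (g : PreGate ι) (L : List (PreGate ι)) (ψ : (ι → Bool) → ℂ) :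
    run (g :: L) ψ = run L (run [g] ψ) := run_append [g] L ψ

theorem run_cons_cons (g g' : PreGate ι) (L : List (PreGate ι)) (ψ : (ι → Bool) → ℂ) :
    run (g :: g' :: L) ψ = run (g' :: L) (run [g] ψ) := run_cons g _ ψ

@[simp] theorem run_h (i : ι) (ψ : (ι → Bool) → ℂ) : run [.h i] ψ = fun v =>
    (ψ (update v i false) + (if v i then -1 else 1) * ψ (update v i true)) /
      ((Real.sqrt 2 : ℝ) : ℂ) := by
  funext v
  simpa [run, circuitOf, PreGate.toCircuit, Circuit.mat] using H_mulVec i ψ v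

@[simp] theorem run_t (i : ι) (ψ : (ι → Bool) → ℂ) :
    run [.t i] ψ = fun v => (if v i then phase else 1) * ψ v := by
  funext v
  simpa [run, circuitOf, PreGate.toCircuit, Circuit.mat] using T_mulVec i ψ v

theorem run_cx {a t : ι} (h : a ≠ t) (ψ : (ι → Bool) → ℂ) :
    run [.cx a t] ψ = fun v => ψ (update v t (xor (v a) (v t))) := by
  funext v
  simpa [run, circuitOf, PreGate.toCircuit, Circuit.mat, h] using CNOT_mulVec h ψ v

@[simp] theorem run_tPow (n : ℕ) (i : ι) (ψ : (ι → Bool) → ℂ) :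
    run (tPow n i) ψ = fun v => (if v i then phase ^ n else 1) * ψ v := by
  induction n generalizing ψ with
  | zero => funext v; simp [tPow]
  | succ n ih =>
    rw [tPow, List.replicate_succ, run_cons, ← tPow, ih]
    funext v
    simp only [run_t]
    split_ifs <;> ring

theorem run_pauliX (i : ι) (ψ : (ι → Bool) → ℂ) :
    run (pauliX i) ψ = fun v => ψ (update v i (! v i)) := by
  funext v
  have h2 := sqrt_two_sq
  have h0 := sqrt_two_ne
  simp only [pauliX, run_cons (PreGate.h i) (_ ++ _), run_append, run_tPow, run_h, update_self,
    update_idem, phase_pow_four]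
  cases v i <;> simp <;> field_simp <;> rw [h2] <;> ring

/-- Between the Hadamards on `t`, past which the gates on `a` and `b` alone commute, the circuit is
diagonal. Its exponent is a + b + t − a⊕b − a⊕t − b⊕t + a⊕b⊕t = 4abt, so by phase⁴ = −1 it is a
doubly controlled Z. -/
theorem run_ccx {a b t : ι} (hab : a ≠ b) (hat : a ≠ t) (hbt : b ≠ t) (ψ : (ι → Bool) → ℂ) :
    run (ccx a b t) ψ = fun v => ψ (update v t (xor (v a && v b) (v t))) := by
  have h2 := sqrt_two_sq
  have h0 := sqrt_two_ne
  have h4 := phase_pow_four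
  have e₁ : ∀ ψ : (ι → Bool) → ℂ, run ([.cx a b, .t a] ++ tPow 7 b ++ [.cx a b]) ψ = fun v =>
      ((if v a then phase else 1) * (if xor (v a) (v b) then phase ^ 7 else 1)) * ψ v := by
    intro ψ
    funext v
    simp only [run_append, run_cons_cons, run_tPow, run_cx hab, run_t, update_self,
      update_idem, update_of_ne hab, ← mul_assoc]
    have : update v b (v a ^^ (v a ^^ v b)) = v := by simp
    rw [this]
    ring
  have e₂ : ∀ ψ : (ι → Bool) → ℂ, run ([.cx b t] ++ tPow 7 t ++ [.cx a t, .t t, .cx b t] ++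
      tPow 7 t ++ [.cx a t, .t b, .t t]) ψ = fun v =>
      ((if xor (v b) (v t) then phase ^ 7 else 1) *
        (if xor (v a) (xor (v b) (v t)) then phase else 1) *
        (if xor (v a) (v t) then phase ^ 7 else 1) * (if v b then phase else 1) *
        (if v t then phase else 1)) * ψ v := by
    intro ψ
    funext v
    simp only [run_append, run_cons_cons, run_tPow, run_cx hat, run_cx hbt, run_t, update_self,
      update_idem, update_of_ne hat, update_of_ne hbt]
    have : update v t (v b ^^ (v a ^^ (v b ^^ (v a ^^ v t)))) = v := by
      conv_rhs => rw [← update_eq_self t v]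
      congr 1
      cases v a <;> cases v b <;> cases v t <;> rfl
    rw [this]
    cases v a <;> cases v b <;> cases v t <;> simp <;> ring
  have e : run (ccx a b t) ψ = run ([.cx a b, .t a] ++ tPow 7 b ++ [.cx a b]) (run [.h t]
      (run ([.cx b t] ++ tPow 7 t ++ [.cx a t, .t t, .cx b t] ++
      tPow 7 t ++ [.cx a t, .t b, .t t]) (run [.h t] ψ))) := by
    rw [← run_append, ← run_append, ← run_append]
    congr 1
  rw [e, e₁, e₂]
  funext v
  simp only [run_h, update_self, update_idem, update_of_ne hat, update_of_ne hbt]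
  have h8 : phase ^ 8 = 1 := by linear_combination (phase ^ 4 - 1) * h4
  have hv := update_eq_self t v
  cases ha : v a <;> cases hb : v b <;> cases ht : v t <;> rw [ht] at hv <;> simp [hv] <;>
    field_simp <;> rw [h2]
  all_goals
    have h16 : phase ^ 16 = 1 := by linear_combination (phase ^ 8 + 1) * h8
    have h12 : phase ^ 12 = -1 := by linear_combination phase ^ 4 * h8 + h4
    simp only [h16, h12, h4]
    ring

/-- The operator is S·H·T·X^c·T†·H·S† with S = T². For c = 0 everything cancels; for c = 1 the
conjugation turns X into (X + Z)/√2, which is H. -/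
theorem run_ctrlH {c i : ι} (h : c ≠ i) (ψ : (ι → Bool) → ℂ) :
    run (ctrlH c i) ψ = fun v => if v c then (ψ (update v i false) +
      (if v i then -1 else 1) * ψ (update v i true)) / ((Real.sqrt 2 : ℝ) : ℂ) else ψ v := by
  have h2 := sqrt_two_sq
  have h0 := sqrt_two_ne
  have h4 := phase_pow_four
  have h3 := phase_sub
  funext v
  have hv := update_eq_self i v
  simp only [ctrlH, run_append, run_cons_cons, run_tPow, run_h,
    run_t, run_cx h, update_self, update_idem, update_of_ne h]
  cases hc : v c <;> cases hi : v i <;> rw [hi] at hv <;> simp [hv] <;> field_simp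
  · rw [show phase ^ 8 = 1 by linear_combination (phase ^ 4 - 1) * h4, h2]
    ring
  · linear_combination (phase ^ 2 * (ψ (update v i false) + phase ^ 6 * ψ v) * (1 - phase ^ 4) +
      2 * ψ v * phase ^ 8 * (phase ^ 4 - 1) + 2 * ψ v * (phase ^ 4 - 1)) * h4 - ψ v * h2
  · linear_combination (phase ^ 3 * (ψ v + ψ (update v i true)) -
      phase * ψ (update v i true) * (phase ^ 8 - phase ^ 4 + 1)) * h4 +
      (ψ v + ψ (update v i true)) * h3
  · linear_combination (phase * (phase ^ 4 - 1) * (ψ (update v i false) - ψ v) -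
      phase ^ 3 * (phase ^ 8 - phase ^ 4 + 1) * ψ v) * h4 + (ψ (update v i false) - ψ v) * h3

/-- The conjunction of `c` and `i` is computed into `z`, receives the phase there, and is
uncomputed; for `z = 0` this is a controlled power of T. -/
theorem run_ctrlT {n : ℕ} {c z i : ι} (hc : c ≠ i) (hz : i ≠ z) (hcz : c ≠ z)
    (ψ : (ι → Bool) → ℂ) : run (ctrlT n c z i) ψ = fun v =>
      (if xor (v c && v i) (v z) then phase ^ n else 1) * ψ v := by
  funext v
  simp [ctrlT, run_append, run_ccx hc hcz hz, update_of_ne hcz, update_of_ne hz]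

theorem run_ctrlGate {κ : Type} [DecidableEq κ] {n : ℕ} {c z : ι} {e : κ → ι} (he : e.Injective)
    (hcz : c ≠ z) (hc : ∀ i, e i ≠ c) (hz : ∀ i, e i ≠ z) (ψ : (ι → Bool) → ℂ) (v : ι → Bool) :
    ∀ g : Gate κ, run (ctrlGate n c z e g) ψ v = match g with
      | .H i => if v c then (ψ (update v (e i) false) +
          (if v (e i) then -1 else 1) * ψ (update v (e i) true)) / ((Real.sqrt 2 : ℝ) : ℂ) else ψ v
      | .T i => (if xor (v c && v (e i)) (v z) then phase ^ n else 1) * ψ v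
      | .CNOT i j _ => ψ (update v (e j) (xor (v c && v (e i)) (v (e j)))) := by
  rintro (i | i | ⟨i, j, h⟩)
  · simp only [ctrlGate, run_ctrlH (hc i).symm]
  · simp only [ctrlGate, run_ctrlT (hc i).symm (hz i) hcz]
  · simp only [ctrlGate, run_ccx (hc i).symm (hc j).symm (he.ne h)]

/-- A gate (for `n = 1`) or its inverse (for `n = 7`), applied to a state. -/
def gateFn {κ : Type} [DecidableEq κ] (n : ℕ) (g : Gate κ) (χ : (κ → Bool) → ℂ) (u : κ → Bool) :
    ℂ :=
  match g with
  | .H i => (χ (update u i false) + (if u i then -1 else 1) * χ (update u i true)) /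
      ((Real.sqrt 2 : ℝ) : ℂ)
  | .T i => (if u i then phase ^ n else 1) * χ u
  | .CNOT i j _ => χ (update u j (xor (u i) (u j)))

theorem gateFn_one (g : Gate ι) (χ : (ι → Bool) → ℂ) : gateFn 1 g χ = g.mat *ᵥ χ := by
  funext u
  cases g with
  | H i => rw [H_mulVec]; rfl
  | T i => rw [T_mulVec]; simp [gateFn]
  | CNOT i j h => rw [CNOT_mulVec]; rfl

theorem gateFn_seven (g : Gate ι) (χ : (ι → Bool) → ℂ) : gateFn 7 g χ = g.matᴴ *ᵥ χ := by
  cases g with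
  | H i =>
    have : (Gate.H i).matᴴ = (Gate.H i).mat := by
      ext v w
      simp only [Gate.mat, Matrix.conjTranspose_apply, Matrix.of_apply]
      have h₁ : (∀ j, j ≠ i → w j = v j) ↔ ∀ j, j ≠ i → v j = w j :=
        forall₂_congr fun _ _ => eq_comm
      simp only [h₁, and_comm (a := w i = true)]
      split_ifs <;> simp
    rw [this, ← gateFn_one]
    rfl
  | T i =>
    funext u
    simp only [Gate.mat, Matrix.diagonal_conjTranspose, Matrix.mulVec_diagonal, gateFn, Pi.star_apply]
    congr 1
    split_ifs
    · exact star_phase.symm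
    · simp
  | CNOT i j h =>
    have : (Gate.CNOT i j h).matᴴ = (Gate.CNOT i j h).mat := by
      have key : ∀ v w : ι → Bool, v = update w j (xor (w i) (w j)) →
          w = update v j (xor (v i) (v j)) := by
        rintro v w rfl
        simp [h]
      ext v w
      simp only [Gate.mat, Matrix.conjTranspose_apply, Matrix.of_apply]
      by_cases hv : v = update w j (xor (w i) (w j))
      · rw [if_pos hv, if_pos (key v w hv), star_one]
      · rw [if_neg hv, if_neg fun hw => hv (key w v hw), star_zero]
    rw [this, ← gateFn_one]
    rfl

/-! ### Controlled circuits on a slice: the wires in the range of `e` vary, the others are fixed -/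

section Slice

variable {κ : Type} [DecidableEq κ] {e : κ → ι}

theorem extend_update (he : e.Injective) (u : κ → Bool) (v : ι → Bool) (i : κ) (b : Bool) :
    update (extend e u v) (e i) b = extend e (update u i b) v := by
  funext x
  by_cases hx : ∃ k, e k = x
  · obtain ⟨k, rfl⟩ := hx
    by_cases hk : k = i
    · subst hk; simp [he.extend_apply]
    · simp [he.extend_apply, he.ne hk, hk]
  · have : x ≠ e i := fun h => hx ⟨i, h.symm⟩
    rw [update_of_ne this, extend_apply' _ _ _ hx, extend_apply' _ _ _ hx]

theorem extend_of_ne {u : κ → Bool} {v : ι → Bool} {x : ι} (hx : ∀ i, e i ≠ x) :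
    extend e u v x = v x := extend_apply' _ _ _ fun ⟨i, h⟩ => hx i h

/-- Control and ancilla lie outside the range of `e`, so both are constant on the slice, and the
gate acts there as itself or not at all. The ancilla has to be 0 because it would invert the
condition of the controlled T. -/
theorem run_ctrlGate_extend {n : ℕ} {c z : ι} (he : e.Injective)
    (hcz : c ≠ z) (hc : ∀ i, e i ≠ c) (hz : ∀ i, e i ≠ z) (ψ : (ι → Bool) → ℂ) (v : ι → Bool)
    (hv : v z = false) (g : Gate κ) (u : κ → Bool) :
    run (ctrlGate n c z e g) ψ (extend e u v) =
      if v c then gateFn n g (fun u => ψ (extend e u v)) u else ψ (extend e u v) := by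
  rw [run_ctrlGate he hcz hc hz]
  cases g with
  | H i => simp only [gateFn, extend_of_ne hc, extend_update he, he.extend_apply]
  | T i =>
    simp only [gateFn, extend_of_ne hc, extend_of_ne hz, he.extend_apply, hv]
    cases v c <;> simp
  | CNOT i j h =>
    simp only [gateFn, extend_of_ne hc, extend_update he, he.extend_apply]
    cases v c <;> simp

/-- Complements the previous lemma on slices with a wrong ancilla: amplitudes do not flow between
slices, so zero stays zero. -/
theorem run_ctrlGate_vanish {n : ℕ} {c z : ι} (he : e.Injective)
    (hcz : c ≠ z) (hc : ∀ i, e i ≠ c) (hz : ∀ i, e i ≠ z) {ψ : (ι → Bool) → ℂ} {v : ι → Bool}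
    (h : ∀ u, ψ (extend e u v) = 0) (g : Gate κ) (u : κ → Bool) :
    run (ctrlGate n c z e g) ψ (extend e u v) = 0 := by
  rw [run_ctrlGate he hcz hc hz]
  cases g with
  | H i => simp only [extend_update he, h]; simp
  | T i => simp only [h]; simp
  | CNOT i j h' => simp only [extend_update he, h]

theorem run_ctrlGates_vanish {n : ℕ} {c z : ι} (he : e.Injective)
    (hcz : c ≠ z) (hc : ∀ i, e i ≠ c) (hz : ∀ i, e i ≠ z) {ψ : (ι → Bool) → ℂ} {v : ι → Bool}
    (h : ∀ u, ψ (extend e u v) = 0) (C : Circuit κ) (u : κ → Bool) :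
    run (C.flatMap (ctrlGate n c z e)) ψ (extend e u v) = 0 := by
  induction C generalizing ψ with
  | nil => simpa using h u
  | cons g C ih =>
    rw [List.flatMap_cons, run_append]
    exact ih (run_ctrlGate_vanish he hcz hc hz h g)

variable [Fintype κ]

theorem run_forth {c z : ι} (he : e.Injective)
    (hcz : c ≠ z) (hc : ∀ i, e i ≠ c) (hz : ∀ i, e i ≠ z) (ψ : (ι → Bool) → ℂ) (v : ι → Bool)
    (hv : v z = false) (C : Circuit κ) (u : κ → Bool) :
    run (C.flatMap (ctrlGate 1 c z e)) ψ (extend e u v) =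
      if v c then (C.mat *ᵥ fun u => ψ (extend e u v)) u else ψ (extend e u v) := by
  induction C generalizing ψ with
  | nil => simp [Circuit.mat]
  | cons g C ih =>
    rw [List.flatMap_cons, run_append, ih]
    simp only [run_ctrlGate_extend he hcz hc hz _ _ hv]
    split_ifs with h
    · rw [Circuit.mat, ← Matrix.mulVec_mulVec, ← gateFn_one]
    · rfl

/-- The first gate of the circuit is the last one to be inverted, in accordance with (AB)† = B†A†.
-/
theorem run_back {c z : ι} (he : e.Injective)
    (hcz : c ≠ z) (hc : ∀ i, e i ≠ c) (hz : ∀ i, e i ≠ z) (ψ : (ι → Bool) → ℂ) (v : ι → Bool)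
    (hv : v z = false) (C : Circuit κ) (u : κ → Bool) :
    run (C.reverse.flatMap (ctrlGate 7 c z e)) ψ (extend e u v) =
      if v c then (C.matᴴ *ᵥ fun u => ψ (extend e u v)) u else ψ (extend e u v) := by
  induction C generalizing u with
  | nil => simp [Circuit.mat]
  | cons g C ih =>
    rw [List.reverse_cons, List.flatMap_append, run_append, List.flatMap_cons, List.flatMap_nil,
      List.append_nil, run_ctrlGate_extend he hcz hc hz _ _ hv]
    simp only [ih]
    split_ifs with h
    · rw [Circuit.mat, Matrix.conjTranspose_mul, ← Matrix.mulVec_mulVec, ← gateFn_seven]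
    · rfl

end Slice

/-! ### Permutations of the computational basis -/

/-- The gate list maps the basis state `v` to the basis state `v'`. -/
def Maps (L : List (PreGate ι)) (v v' : ι → Bool) : Prop :=
  ∀ ψ : (ι → Bool) → ℂ, run L ψ v' = ψ v

theorem Maps.nil (v : ι → Bool) : Maps [] v v := fun ψ => by simp

theorem Maps.append {L L' : List (PreGate ι)} {v v' v'' : ι → Bool} (h : Maps L v v')
    (h' : Maps L' v' v'') : Maps (L ++ L') v v'' := fun ψ => by
  rw [run_append, h', h]

theorem Maps.inj {L : List (PreGate ι)} {v w v' : ι → Bool} (h : Maps L v v')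
    (h' : Maps L w v') : v = w := by
  have := (h (Pi.single v 1)).symm.trans (h' (Pi.single v 1))
  by_contra hne
  rw [Pi.single_eq_same, Pi.single_eq_of_ne (Ne.symm hne)] at this
  exact one_ne_zero this

theorem maps_cx {a t : ι} (h : a ≠ t) (v : ι → Bool) :
    Maps [.cx a t] v (update v t (xor (v a) (v t))) := fun ψ => by
  simp [run_cx h, update_of_ne h]

theorem maps_pauliX (i : ι) (v : ι → Bool) : Maps (pauliX i) v (update v i (! v i)) := fun ψ => by
  simp [run_pauliX]

theorem maps_ccx {a b t : ι} (hab : a ≠ b) (hat : a ≠ t) (hbt : b ≠ t) (v : ι → Bool) :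
    Maps (ccx a b t) v (update v t (xor (v a && v b) (v t))) := fun ψ => by
  simp [run_ccx hab hat hbt, update_of_ne hat, update_of_ne hbt]

/-- A gate list that permutes the basis states permutes the probabilities. -/
theorem sum_run_eq {L : List (PreGate ι)} {f : (ι → Bool) → ι → Bool} (hf : ∀ v, Maps L v (f v))
    (p : (ι → Bool) → Prop) [DecidablePred p] (ψ : (ι → Bool) → ℂ) :
    ∑ v, (if p v then ‖run L ψ v‖ ^ 2 else 0) = ∑ v, if p (f v) then ‖ψ v‖ ^ 2 else 0 := by
  have hinj : f.Injective := fun v w h => (hf v).inj (h ▸ hf w)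
  rw [← (Equiv.ofBijective f (Finite.injective_iff_bijective.1 hinj)).sum_comp]
  refine Finset.sum_congr rfl fun v _ => ?_
  simp only [Equiv.ofBijective_apply, hf v ψ]

end

/-! ### Linear algebra -/

section LinearAlgebra

variable {S : Type} [Fintype S]

/-- The probability that a measurement yields a basis state with property `p`. -/
def weight (p : S → Prop) [DecidablePred p] (ψ : S → ℂ) : ℝ :=
  ∑ s, if p s then ‖ψ s‖ ^ 2 else 0

/-- The squared norm. -/
def total (ψ : S → ℂ) : ℝ := ∑ s, ‖ψ s‖ ^ 2

theorem total_nonneg (ψ : S → ℂ) : 0 ≤ total ψ := Finset.sum_nonneg fun _ _ => sq_nonneg _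

theorem weight_nonneg (p : S → Prop) [DecidablePred p] (ψ : S → ℂ) : 0 ≤ weight p ψ :=
  Finset.sum_nonneg fun _ _ => by split_ifs <;> positivity

theorem weight_eq_total {p : S → Prop} [DecidablePred p] {ψ : S → ℂ}
    (h : ∀ s, ¬ p s → ψ s = 0) : weight p ψ = total ψ := by
  refine Finset.sum_congr rfl fun s _ => ?_
  split_ifs with hs
  · rfl
  · simp [h s hs]

/-- The part of a state with property `p`. -/
def mask (p : S → Prop) [DecidablePred p] (ψ : S → ℂ) (s : S) : ℂ := if p s then ψ s else 0

theorem total_mask (p : S → Prop) [DecidablePred p] (ψ : S → ℂ) :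
    total (mask p ψ) = weight p ψ := by
  refine Finset.sum_congr rfl fun s _ => ?_
  simp only [mask]
  split_ifs <;> simp

theorem star_dotProduct_self (ψ : S → ℂ) : star ψ ⬝ᵥ ψ = (total ψ : ℂ) := by
  simp only [dotProduct, total, Pi.star_apply, Complex.star_def, Complex.conj_mul']
  push_cast
  rfl

theorem weight_smul (p : S → Prop) [DecidablePred p] (c : ℂ) (ψ : S → ℂ) :
    weight p (c • ψ) = ‖c‖ ^ 2 * weight p ψ := by
  simp [weight, mul_pow, Finset.mul_sum]

theorem norm_star_dotProduct_le (ψ χ : S → ℂ) :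
    ‖star ψ ⬝ᵥ χ‖ ≤ Real.sqrt (total ψ) * Real.sqrt (total χ) := by
  have h := norm_inner_le_norm (𝕜 := ℂ) (WithLp.toLp 2 ψ : EuclideanSpace ℂ S) (WithLp.toLp 2 χ)
  rwa [EuclideanSpace.inner_toLp_toLp, EuclideanSpace.norm_eq, EuclideanSpace.norm_eq,
    dotProduct_comm] at h

variable [DecidableEq S]

theorem star_conjTranspose_mulVec (A : Matrix S S ℂ) (ψ χ : S → ℂ) :
    star (Aᴴ *ᵥ ψ) ⬝ᵥ χ = star ψ ⬝ᵥ (A *ᵥ χ) := by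
  rw [star_mulVec, conjTranspose_conjTranspose, dotProduct_mulVec]

theorem total_mulVec {U : Matrix S S ℂ} (hU : U ∈ unitaryGroup S ℂ) (ψ : S → ℂ) :
    total (U *ᵥ ψ) = total ψ := by
  have h : star (U *ᵥ ψ) ⬝ᵥ (U *ᵥ ψ) = star ψ ⬝ᵥ ψ := by
    rw [star_mulVec, ← dotProduct_mulVec, mulVec_mulVec]
    have := mem_unitaryGroup_iff'.1 hU
    rw [star_eq_conjTranspose] at this
    rw [this, one_mulVec]
  rw [star_dotProduct_self, star_dotProduct_self] at h
  exact_mod_cast h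

theorem conjTranspose_mem_unitaryGroup {U : Matrix S S ℂ} (hU : U ∈ unitaryGroup S ℂ) :
    Uᴴ ∈ unitaryGroup S ℂ := by
  rw [← star_eq_conjTranspose]
  exact Unitary.star_mem hU

theorem mulVec_conjTranspose_mulVec {U : Matrix S S ℂ} (hU : U ∈ unitaryGroup S ℂ) (ψ : S → ℂ) :
    U *ᵥ (Uᴴ *ᵥ ψ) = ψ := by
  have := mem_unitaryGroup_iff.1 hU
  rw [star_eq_conjTranspose] at this
  rw [mulVec_mulVec, this, one_mulVec]

/-- The key estimate: two measurements, each applied after a unitary to the same state, cannot both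
be likely to succeed if no state for which the second one is certain to succeed lets the first one
succeed with probability more than `t` after the second unitary is undone. -/
theorem weight_add_weight_le {X₀ X₁ : Matrix S S ℂ} (h₀ : X₀ ∈ unitaryGroup S ℂ)
    (h₁ : X₁ ∈ unitaryGroup S ℂ) {φ : S → ℂ} (hφ : total φ = 1) {p q : S → Prop}
    [DecidablePred p] [DecidablePred q] {t : ℝ} (ht : 0 ≤ t)
    (h : ∀ ξ : S → ℂ, (∀ s, ¬ q s → ξ s = 0) → weight p (X₀ *ᵥ (X₁ᴴ *ᵥ ξ)) ≤ t * total ξ) :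
    weight p (X₀ *ᵥ φ) + weight q (X₁ *ᵥ φ) ≤ 1 + Real.sqrt t := by
  have dot_mask : ∀ (p : S → Prop) [DecidablePred p] (ψ χ : S → ℂ),
      star (mask p ψ) ⬝ᵥ χ = star (mask p ψ) ⬝ᵥ mask p χ := by
    intro p _ ψ χ
    refine Finset.sum_congr rfl fun s _ => ?_
    simp only [mask, Pi.star_apply]
    split_ifs <;> simp
  set a := weight p (X₀ *ᵥ φ) with ha
  set b := weight q (X₁ *ᵥ φ) with hb
  have ha0 : 0 ≤ a := weight_nonneg _ _
  have hb0 : 0 ≤ b := weight_nonneg _ _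
  set x := mask p (X₀ *ᵥ φ) with hx
  set y := mask q (X₁ *ᵥ φ) with hy
  -- `u` and `v` are the projections of `φ` onto the two accepting subspaces, pulled back to the
  -- time of `φ`. Therefore ⟨u, φ⟩ = ‖u‖² = a and ⟨v, φ⟩ = ‖v‖² = b.
  set u := X₀ᴴ *ᵥ x with hu
  set v := X₁ᴴ *ᵥ y with hv
  have hNx : total x = a := total_mask _ _
  have hNy : total y = b := total_mask _ _
  have hNu : total u = a := by rw [hu, total_mulVec (conjTranspose_mem_unitaryGroup h₀), hNx]
  have hNv : total v = b := by rw [hv, total_mulVec (conjTranspose_mem_unitaryGroup h₁), hNy]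
  have huφ : star u ⬝ᵥ φ = a := by
    rw [hu, star_conjTranspose_mulVec, hx, dot_mask, ← hx, star_dotProduct_self, hNx]
  have hvφ : star v ⬝ᵥ φ = b := by
    rw [hv, star_conjTranspose_mulVec, hy, dot_mask, ← hy, star_dotProduct_self, hNy]
  -- ⟨u, v⟩ equals ⟨x, X₀X₁†y⟩, where only the part of X₀X₁†y with property `p` counts; the
  -- hypothesis for ξ = y bounds its weight by t·b.
  have huv : ‖star u ⬝ᵥ v‖ ≤ Real.sqrt a * Real.sqrt (t * b) := by
    rw [hu, star_conjTranspose_mulVec, hx, dot_mask, ← hx]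
    refine (norm_star_dotProduct_le _ _).trans ?_
    rw [hNx]
    refine mul_le_mul_of_nonneg_left (Real.sqrt_le_sqrt ?_) (Real.sqrt_nonneg _)
    rw [total_mask, ← hNy]
    refine h y fun s hs => ?_
    simp [hy, mask, hs]
  have hsum : total (u + v) = a + b + 2 * (star u ⬝ᵥ v).re := by
    have e₁ : star (u + v) ⬝ᵥ (u + v) =
        star u ⬝ᵥ u + star v ⬝ᵥ v + (star u ⬝ᵥ v + star v ⬝ᵥ u) := by
      rw [star_add, add_dotProduct, dotProduct_add, dotProduct_add]; ring
    have e₂ : star v ⬝ᵥ u = star (star u ⬝ᵥ v) := by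
      rw [star_dotProduct]
    rw [star_dotProduct_self, star_dotProduct_self, star_dotProduct_self, hNu, hNv, e₂] at e₁
    have := congrArg Complex.re e₁
    simp at this
    rw [this]; ring
  -- Cauchy–Schwarz for u + v and the unit vector φ.
  have hle : a + b ≤ Real.sqrt (total (u + v)) := by
    have := norm_star_dotProduct_le (u + v) φ
    rw [star_add, add_dotProduct, huφ, hvφ, hφ, Real.sqrt_one, mul_one, ← Complex.ofReal_add,
      Complex.norm_real] at this
    exact (le_abs_self _).trans this
  -- ‖u + v‖² is at most a + b + 2√t·√(ab), and 2√(ab) ≤ a + b.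
  have hsq : (a + b) ^ 2 ≤ (a + b) * (1 + Real.sqrt t) := by
    have e₁ : (a + b) ^ 2 ≤ total (u + v) := by
      have := pow_le_pow_left₀ (by positivity) hle 2
      rwa [Real.sq_sqrt (total_nonneg _)] at this
    have e₂ : (star u ⬝ᵥ v).re ≤ Real.sqrt a * Real.sqrt (t * b) :=
      (Complex.re_le_norm _).trans huv
    rw [Real.sqrt_mul ht] at e₂
    have e₃ : 2 * (Real.sqrt a * Real.sqrt b) ≤ a + b := by
      have := sq_nonneg (Real.sqrt a - Real.sqrt b)
      nlinarith [Real.sq_sqrt ha0, Real.sq_sqrt hb0]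
    have e₄ := mul_le_mul_of_nonneg_left e₃ (Real.sqrt_nonneg t)
    rw [hsum] at e₁
    nlinarith
  rcases (add_nonneg ha0 hb0).eq_or_lt with h0 | h0
  · rw [← h0]; positivity
  · exact le_of_mul_le_mul_left (by rwa [pow_two] at hsq) h0

/-- Every unit vector is the image of a basis state under a unitary. -/
theorem exists_unitary_mulVec_single (i : S) {x : S → ℂ} (hx : total x = 1) :
    ∃ U ∈ unitaryGroup S ℂ, U *ᵥ Pi.single i 1 = x := by
  have hn : ‖(WithLp.toLp 2 x : EuclideanSpace ℂ S)‖ = 1 := by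
    rw [EuclideanSpace.norm_eq]
    exact Real.sqrt_eq_one.2 hx
  obtain ⟨b, hb⟩ := Orthonormal.exists_orthonormalBasis_extension_of_card_eq (𝕜 := ℂ)
    (E := EuclideanSpace ℂ S) (ι := S) (by simp) (v := fun _ => WithLp.toLp 2 x) (s := {i})
    ⟨fun _ => hn, fun j k hjk => absurd (Subsingleton.elim j k) hjk⟩
  refine ⟨(EuclideanSpace.basisFun S ℂ).toBasis.toMatrix b,
    (EuclideanSpace.basisFun S ℂ).toMatrix_orthonormalBasis_mem_unitary b, ?_⟩
  funext j
  rw [mulVec_single_one, col_apply, Module.Basis.toMatrix_apply, hb i rfl]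
  simp

/-- The product of the operators that are applied in an interaction. -/
def altMat : List (Matrix S S ℂ) → List (Matrix S S ℂ) → Matrix S S ℂ
  | P :: Ps, V :: Vs => altMat Ps Vs * (V * P)
  | _, _ => 1

theorem alternate_eq (Ps Vs : List (Matrix S S ℂ)) (ψ : S → ℂ) :
    alternate Ps Vs ψ = altMat Ps Vs *ᵥ ψ := by
  induction Ps generalizing Vs ψ with
  | nil => simp [alternate, altMat]
  | cons P Ps ih =>
    cases Vs with
    | nil => simp [alternate, altMat]
    | cons V Vs => simp [alternate, altMat, ih]

theorem altMat_mem {Ps Vs : List (Matrix S S ℂ)} (hP : ∀ P ∈ Ps, P ∈ unitaryGroup S ℂ)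
    (hV : ∀ V ∈ Vs, V ∈ unitaryGroup S ℂ) : altMat Ps Vs ∈ unitaryGroup S ℂ := by
  induction Ps generalizing Vs with
  | nil => exact one_mem _
  | cons P Ps ih =>
    cases Vs with
    | nil => exact one_mem _
    | cons V Vs =>
      simp only [List.forall_mem_cons] at hP hV
      exact mul_mem (ih hP.2 hV.2) (mul_mem hV.1 hP.1)

/-- The verifier's first actions undo what is done by their inverses in the opposite order. -/
theorem alternate_reverse {Ps Bs : List (Matrix S S ℂ)} (h : Ps.length = Bs.length)
    (P V : Matrix S S ℂ) (Ps' Vs' : List (Matrix S S ℂ)) (ψ : S → ℂ) :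
    alternate (P :: ((Ps.map conjTranspose).reverse ++ Ps')) (Bs.reverse ++ V :: Vs') ψ =
      alternate Ps' Vs' (V *ᵥ ((altMat Ps (Bs.map conjTranspose))ᴴ *ᵥ (P *ᵥ ψ))) := by
  induction Ps generalizing Bs V Ps' Vs' with
  | nil =>
    obtain rfl : Bs = [] := List.length_eq_zero_iff.1 h.symm
    simp [alternate, altMat]
  | cons P₁ Ps ih =>
    cases Bs with
    | nil => simp at h
    | cons B Bs =>
      -- The heads of the lists are the last pair of the reversed run: `B` takes the role of the
      -- middle operator, and P₁† and `V` join the operators that follow.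
      have := ih (Bs := Bs) (by simpa using h) B (P₁ᴴ :: Ps') (V :: Vs')
      simp only [List.map_cons, List.reverse_cons, List.append_assoc, List.cons_append,
        List.nil_append]
      rw [this, alternate, altMat]
      simp only [conjTranspose_mul, conjTranspose_conjTranspose, mulVec_mulVec, Matrix.mul_assoc]

end LinearAlgebra

/-! ### Operators on three registers -/

section Registers

variable {α β γ δ R : Type} [Fintype α] [DecidableEq α] [Fintype β] [DecidableEq β] [Fintype γ]
  [DecidableEq γ] [Fintype δ] [DecidableEq δ] [Fintype R] [DecidableEq R]

/-- An operator on the first two registers. -/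
def opP (δ : Type) [DecidableEq δ] (U : Matrix (α × γ) (α × γ) ℂ) :
    Matrix (α × γ × δ) (α × γ × δ) ℂ :=
  (U ⊗ₖ (1 : Matrix δ δ ℂ)).submatrix (Equiv.prodAssoc α γ δ).symm (Equiv.prodAssoc α γ δ).symm

theorem opP_mulVec (U : Matrix (α × γ) (α × γ) ℂ) (ψ : α × γ × δ → ℂ) (x : α) (c : γ) (w : δ) :
    (opP δ U *ᵥ ψ) (x, c, w) = (U *ᵥ fun p => ψ (p.1, p.2, w)) (x, c) := by
  simp only [mulVec, dotProduct, opP, submatrix_apply, kroneckerMap_apply]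
  rw [← (Equiv.prodAssoc α γ δ).sum_comp, Fintype.sum_prod_type]
  refine Finset.sum_congr rfl fun p _ => ?_
  simp only [Equiv.symm_apply_apply, Equiv.prodAssoc_symm_apply, one_apply, mul_ite, mul_one,
    mul_zero, ite_mul, zero_mul]
  simp [Equiv.prodAssoc_apply]

theorem opP_mul (U U' : Matrix (α × γ) (α × γ) ℂ) : opP δ (U * U') = opP δ U * opP δ U' := by
  rw [opP, opP, opP, submatrix_mul_equiv, ← mul_kronecker_mul, Matrix.one_mul]

theorem opP_conjTranspose (U : Matrix (α × γ) (α × γ) ℂ) : (opP δ U)ᴴ = opP δ Uᴴ := by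
  rw [opP, opP, conjTranspose_submatrix, conjTranspose_kronecker, conjTranspose_one]

theorem opP_one : opP δ (1 : Matrix (α × γ) (α × γ) ℂ) = 1 := by
  rw [opP, one_kronecker_one, submatrix_one_equiv]

theorem opP_mem {U : Matrix (α × γ) (α × γ) ℂ} (hU : U ∈ unitaryGroup (α × γ) ℂ) :
    opP δ U ∈ unitaryGroup (α × γ × δ) ℂ := by
  rw [mem_unitaryGroup_iff, star_eq_conjTranspose] at hU ⊢
  rw [opP_conjTranspose, ← opP_mul, hU, opP_one]

variable {a b : ℕ}

/-- An operator on the last two registers. -/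
def opM (α : Type) [DecidableEq α] (M : Matrix (Fin a ⊕ Fin b → Bool) (Fin a ⊕ Fin b → Bool) ℂ) :
    Matrix (α × Bits a × Bits b) (α × Bits a × Bits b) ℂ :=
  (1 : Matrix α α ℂ) ⊗ₖ M.submatrix (Equiv.sumArrowEquivProdArrow _ _ _).symm
    (Equiv.sumArrowEquivProdArrow _ _ _).symm

theorem opM_mulVec (M : Matrix (Fin a ⊕ Fin b → Bool) (Fin a ⊕ Fin b → Bool) ℂ)
    (ψ : α × Bits a × Bits b → ℂ) (x : α) (c : Bits a) (w : Bits b) :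
    (opM α M *ᵥ ψ) (x, c, w) =
      (M *ᵥ fun v => ψ (x, v ∘ Sum.inl, v ∘ Sum.inr)) (Sum.elim c w) := by
  simp only [mulVec, dotProduct, opM, kroneckerMap_apply, submatrix_apply, one_apply]
  rw [Fintype.sum_prod_type, Finset.sum_eq_single x]
  · rw [← (Equiv.sumArrowEquivProdArrow (Fin a) (Fin b) Bool).sum_comp]
    refine Finset.sum_congr rfl fun v _ => ?_
    rw [if_pos rfl, one_mul, Equiv.symm_apply_apply]
    rfl
  · intro y _ hy
    simp [hy.symm]
  · simp

theorem opM_mul (M M' : Matrix (Fin a ⊕ Fin b → Bool) (Fin a ⊕ Fin b → Bool) ℂ) :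
    opM α (M * M') = opM α M * opM α M' := by
  rw [opM, opM, opM, ← mul_kronecker_mul, Matrix.one_mul, submatrix_mul_equiv]

theorem opM_conjTranspose (M : Matrix (Fin a ⊕ Fin b → Bool) (Fin a ⊕ Fin b → Bool) ℂ) :
    (opM α M)ᴴ = opM α Mᴴ := by
  rw [opM, opM, conjTranspose_kronecker, conjTranspose_submatrix, conjTranspose_one]

theorem opM_one :
    opM α (1 : Matrix (Fin a ⊕ Fin b → Bool) (Fin a ⊕ Fin b → Bool) ℂ) = 1 := by
  rw [opM, submatrix_one_equiv, one_kronecker_one]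

theorem gate_mat_mem {ι : Type} [DecidableEq ι] [Fintype ι] (g : Gate ι) :
    g.mat ∈ unitaryGroup (ι → Bool) ℂ := by
  rw [mem_unitaryGroup_iff', star_eq_conjTranspose]
  refine ext_of_mulVec_single fun v => ?_
  rw [← mulVec_mulVec, one_mulVec, ← gateFn_seven, ← gateFn_one]
  generalize (Pi.single v 1 : (ι → Bool) → ℂ) = χ
  funext u
  cases g with
  | H i =>
    have h2 := sqrt_two_sq
    have h0 := sqrt_two_ne
    have hu := update_eq_self i u
    simp only [gateFn, update_self, update_idem]
    cases hi : u i <;> rw [hi] at hu <;> simp [hu] <;> field_simp <;> rw [h2] <;> ring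
  | T i =>
    simp only [gateFn]
    split_ifs
    · have h4 := phase_pow_four
      linear_combination (phase ^ 4 - 1) * χ u * h4
    · simp
  | CNOT i j h => simp [gateFn, h]

theorem circuit_mat_mem {ι : Type} [DecidableEq ι] [Fintype ι] (C : Circuit ι) :
    C.mat ∈ unitaryGroup (ι → Bool) ℂ := by
  induction C with
  | nil => exact one_mem _
  | cons g C ih => exact mul_mem ih (gate_mat_mem g)

theorem opM_mem (C : Circuit (Fin a ⊕ Fin b)) :
    opM α C.mat ∈ unitaryGroup (α × Bits a × Bits b) ℂ := by
  have hU := circuit_mat_mem C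
  rw [mem_unitaryGroup_iff, star_eq_conjTranspose] at hU ⊢
  rw [opM_conjTranspose, ← opM_mul, hU, opM_one]

/-- Exchange the last two of three registers. -/
def swapRight (β R γ : Type) : (β × R) × γ ≃ (β × γ) × R where
  toFun x := ((x.1.1, x.2), x.1.2)
  invFun x := ((x.1.1, x.2), x.1.2)
  left_inv _ := rfl
  right_inv _ := rfl

/-- Apply the operator `U r` if the register `R` contains `r`. -/
def controlled (U : R → Matrix (β × γ) (β × γ) ℂ) :
    Matrix ((β × R) × γ) ((β × R) × γ) ℂ :=
  (blockDiagonal U).submatrix (swapRight β R γ) (swapRight β R γ)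

theorem controlled_mem {U : R → Matrix (β × γ) (β × γ) ℂ}
    (hU : ∀ r, U r ∈ unitaryGroup (β × γ) ℂ) :
    controlled U ∈ unitaryGroup ((β × R) × γ) ℂ := by
  rw [mem_unitaryGroup_iff, star_eq_conjTranspose, controlled, conjTranspose_submatrix,
    submatrix_mul_equiv, blockDiagonal_conjTranspose, ← blockDiagonal_mul]
  have : (fun r => U r * (U r)ᴴ) = 1 := by
    funext r
    have := mem_unitaryGroup_iff.1 (hU r)
    rwa [star_eq_conjTranspose] at this
  rw [this, blockDiagonal_one, submatrix_one_equiv]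

/-- The state with content `r` in the register `R`. -/
def withReg (r : R) (η : β × γ × δ → ℂ) : (β × R) × γ × δ → ℂ :=
  fun s => if s.1.2 = r then η (s.1.1, s.2) else 0

/-- A control register in a basis state acts as a classical choice; the honest prover uses this to
branch on the coin. -/
theorem opP_controlled_mulVec (U : R → Matrix (β × γ) (β × γ) ℂ) (r : R) (η : β × γ × δ → ℂ) :
    opP δ (controlled U) *ᵥ withReg r η = withReg r (opP δ (U r) *ᵥ η) := by
  funext ⟨⟨x, r'⟩, c, w⟩
  simp only [withReg]
  rw [opP_mulVec, opP_mulVec]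
  simp only [mulVec, dotProduct, controlled, submatrix_apply]
  rw [← (swapRight β R γ).symm.sum_comp, Fintype.sum_prod_type]
  split_ifs with h
  · subst h
    refine Finset.sum_congr rfl fun p _ => ?_
    rw [Finset.sum_eq_single r']
    · simp [swapRight, blockDiagonal_apply, withReg]
    · intro r hr hne
      simp [swapRight, hne, withReg]
    · simp
  · refine Finset.sum_eq_zero fun p _ => Finset.sum_eq_zero fun r'' _ => ?_
    by_cases hr : r'' = r
    · subst hr
      simp [swapRight, blockDiagonal_apply, h, withReg]
    · simp [swapRight, hr, withReg]

theorem opM_withReg (M : Matrix (Fin a ⊕ Fin b → Bool) (Fin a ⊕ Fin b → Bool) ℂ) (r : R)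
    (η : β × Bits a × Bits b → ℂ) :
    opM (β × R) M *ᵥ withReg r η = withReg r (opM β M *ᵥ η) := by
  funext ⟨⟨x, r'⟩, c, w⟩
  simp only [withReg]
  rw [opM_mulVec, opM_mulVec]
  split_ifs with h
  · simp only [withReg, h, if_true]
  · simp [mulVec, dotProduct, withReg, h]

theorem alternate_withReg (Us : List (R → Matrix (β × Bits a) (β × Bits a) ℂ))
    (Ms : List (Matrix (Fin a ⊕ Fin b → Bool) (Fin a ⊕ Fin b → Bool) ℂ)) (r : R)
    (η : β × Bits a × Bits b → ℂ) :
    alternate (Us.map fun U => opP (Bits b) (controlled U)) (Ms.map (opM (β × R)))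
      (withReg r η) =
    withReg r (alternate (Us.map fun U => opP (Bits b) (U r)) (Ms.map (opM β)) η) := by
  induction Us generalizing Ms η with
  | nil => simp [alternate]
  | cons U Us ih =>
    cases Ms with
    | nil => simp [alternate]
    | cons M Ms =>
      simp only [List.map_cons, alternate, opP_controlled_mulVec, opM_withReg, ih]

theorem weight_withReg (r : R) (η : β × γ × δ → ℂ) (p : γ × δ → Prop) [DecidablePred p] :
    weight (fun s => p s.2) (withReg r η) = weight (fun s => p s.2) η := by
  simp only [weight, withReg]
  rw [Fintype.sum_prod_type, Fintype.sum_prod_type, Fintype.sum_prod_type]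
  refine Finset.sum_congr rfl fun x _ => ?_
  rw [Finset.sum_eq_single r]
  · simp
  · intro r' _ h
    simp [h]
  · simp

theorem total_withReg (r : R) (η : β × γ × δ → ℂ) : total (withReg r η) = total η := by
  have := weight_withReg r η (fun _ => True)
  simpa [weight, total] using this

end Registers

/-! ### The halved verifier on basis states -/

namespace Layout

variable {nM nW : ℕ} {ι : Type} [DecidableEq ι] [Fintype ι] {l : Layout nM nW ι}

/-- Two of the three CNOTs of a swap, which suffice to move the snapshot since the private qubits
start at 0. Amplitudes are transported backwards, so the preimage of a basis state is what matters.
-/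
theorem Proper.maps_receive (h : l.Proper) (v : ι → Bool) : ∃ v₀, Maps l.receive v₀ v ∧
    (∀ i, v₀ (l.snap i) = xor (v (l.snap i)) (v (l.old (.inr i)))) ∧
    (∀ i, v₀ (l.old (.inr i)) = v (l.snap i)) ∧
    ∀ x, (∀ i, x ≠ l.snap i) → (∀ i, x ≠ l.old (.inr i)) → v₀ x = v x := by
  have key : ∀ L : List (Fin nW), L.Nodup → ∃ v₀, Maps (L.flatMap fun i =>
      [.cx (l.snap i) (l.old (.inr i)), .cx (l.old (.inr i)) (l.snap i)]) v₀ v ∧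
      (∀ i ∈ L, v₀ (l.snap i) = xor (v (l.snap i)) (v (l.old (.inr i)))) ∧
      (∀ i ∈ L, v₀ (l.old (.inr i)) = v (l.snap i)) ∧
      ∀ x, (∀ i ∈ L, x ≠ l.snap i) → (∀ i ∈ L, x ≠ l.old (.inr i)) → v₀ x = v x := by
    intro L hL
    induction L with
    | nil => exact ⟨v, by simpa using Maps.nil v, by simp, by simp, by simp⟩
    | cons i L ih =>
      obtain ⟨hi, hL⟩ := List.nodup_cons.1 hL
      obtain ⟨v₁, hm, h₁, h₂, h₃⟩ := ih hL
      have hne : ∀ j ∈ L, j ≠ i := fun j hj e => hi (e ▸ hj)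
      have hs : v₁ (l.snap i) = v (l.snap i) :=
        h₃ _ (fun j hj => h.snap_inj.ne (hne j hj).symm) fun j _ => (h.old_snap _ _).symm
      have ho : v₁ (l.old (.inr i)) = v (l.old (.inr i)) :=
        h₃ _ (fun j _ => h.old_snap _ _) fun j hj => h.old_inj.ne fun e =>
          hne j hj (Sum.inr_injective e).symm
      have hso : l.snap i ≠ l.old (.inr i) := (h.old_snap _ _).symm
      set v₂ := update v₁ (l.snap i) (xor (v₁ (l.old (.inr i))) (v₁ (l.snap i))) with hv₂
      set v₃ := update v₂ (l.old (.inr i)) (xor (v₂ (l.snap i)) (v₂ (l.old (.inr i)))) with hv₃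
      have m₂ : Maps [.cx (l.old (.inr i)) (l.snap i)] v₂ v₁ := by
        convert maps_cx hso.symm v₂ using 1
        simp [hv₂, hso.symm]
      have m₃ : Maps [.cx (l.snap i) (l.old (.inr i))] v₃ v₂ := by
        convert maps_cx hso v₃ using 1
        simp [hv₃, hso]
      refine ⟨v₃, (m₃.append m₂).append hm, ?_, ?_, ?_⟩
      · intro j hj
        rcases List.mem_cons.1 hj with rfl | hj
        · simp [hv₃, hv₂, hso, hs, ho, Bool.xor_comm]
        · have e₁ : l.snap j ≠ l.snap i := h.snap_inj.ne (hne j hj)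
          have e₂ : l.snap j ≠ l.old (.inr i) := (h.old_snap _ _).symm
          simp [hv₃, hv₂, e₁, e₂, h₁ j hj]
      · intro j hj
        rcases List.mem_cons.1 hj with rfl | hj
        · simp only [hv₃, hv₂, update_self, update_of_ne hso.symm, hs, ho]
          cases v (l.snap j) <;> cases v (l.old (.inr j)) <;> rfl
        · have e₁ : l.old (.inr j) ≠ l.snap i := h.old_snap _ _
          have e₂ : l.old (.inr j) ≠ l.old (.inr i) := h.old_inj.ne fun e =>
            hne j hj (Sum.inr_injective e)
          simp [hv₃, hv₂, e₁, e₂, h₂ j hj]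
      · intro x hx₁ hx₂
        simp only [List.forall_mem_cons] at hx₁ hx₂
        simp [hv₃, hv₂, hx₁.1, hx₂.1, h₃ x hx₁.2 hx₂.2]
  obtain ⟨v₀, hm, h₁, h₂, h₃⟩ := key _ (List.nodup_finRange nW)
  exact ⟨v₀, hm, fun i => h₁ i (List.mem_finRange i), fun i => h₂ i (List.mem_finRange i),
    fun x hx₁ hx₂ => h₃ x (fun i _ => hx₁ i) fun i _ => hx₂ i⟩

/-- Chain qubit `k` becomes the conjunction of the coin with the vanishing of the first `k` private
qubits. The X gates are not undone, because the private qubits are not needed any more. -/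
theorem Proper.maps_chainTest (h : l.Proper) (v : ι → Bool) : ∃ v', Maps l.chainTest v v' ∧
    v' l.ans = v l.ans ∧ ((∀ i, v (l.chain i) = false) →
      v' (l.chain (Fin.last nW)) = (v l.coin && decide (∀ i, v (l.old (.inr i)) = false))) := by
  have key : ∀ k ≤ nW, ∃ v', Maps (.cx l.coin (l.chain 0) :: ((List.finRange nW).take k).flatMap
      fun i => pauliX (l.old (.inr i)) ++
        ccx (l.chain i.castSucc) (l.old (.inr i)) (l.chain i.succ)) v v' ∧
      v' l.ans = v l.ans ∧ (∀ i : Fin nW, k ≤ i.val → v' (l.old (.inr i)) = v (l.old (.inr i))) ∧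
      ((∀ i, v (l.chain i) = false) → (∀ i : Fin (nW + 1), k < i.val → v' (l.chain i) = false) ∧
        ∀ i : Fin (nW + 1), i.val = k → v' (l.chain i) =
          (v l.coin && decide (∀ j : Fin nW, j.val < k → v (l.old (.inr j)) = false))) := by
    intro k
    induction k with
    | zero =>
      intro _
      refine ⟨_, by simpa using maps_cx (h.chain_coin 0).symm v, ?_, ?_, ?_⟩
      · simp [(h.chain_ans 0).symm]
      · intro i _
        simp [h.old_chain]
      · intro h0
        refine ⟨fun i hi => ?_, fun i hi => ?_⟩
        · have : i ≠ 0 := by rintro rfl; simp at hi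
          simp [h.chain_inj.ne this, h0]
        · obtain rfl : i = 0 := Fin.ext hi
          simp [h0]
    | succ k ih =>
      intro hk
      obtain ⟨v₁, hm, h₁, h₂, h₃⟩ := ih (by omega)
      set i : Fin nW := ⟨k, hk⟩ with hi
      have htake : (List.finRange nW).take (k + 1) = (List.finRange nW).take k ++ [i] := by
        rw [List.take_succ_eq_append_getElem (by simpa using hk)]
        simp [hi]
      have hcs : l.chain i.castSucc ≠ l.chain i.succ := h.chain_inj.ne Fin.castSucc_lt_succ.ne
      set v₂ := update v₁ (l.old (.inr i)) (! v₁ (l.old (.inr i))) with hv₂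
      have m := (maps_pauliX (l.old (.inr i)) v₁).append
        (maps_ccx (h.old_chain (.inr i) i.castSucc).symm hcs (h.old_chain (.inr i) i.succ) v₂)
      set v₃ := update v₂ (l.chain i.succ) (xor (v₂ (l.chain i.castSucc) && v₂ (l.old (.inr i)))
        (v₂ (l.chain i.succ))) with hv₃
      refine ⟨v₃, ?_, ?_, ?_, ?_⟩
      · rw [htake, List.flatMap_append, ← List.cons_append, List.flatMap_cons, List.flatMap_nil,
          List.append_nil]
        exact hm.append m
      · simp [hv₃, hv₂, (h.chain_ans _).symm, (h.old_ans _).symm, h₁]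
      · intro j hj
        have : j ≠ i := by rintro rfl; simp [hi] at hj
        have : l.old (.inr j) ≠ l.old (.inr i) := h.old_inj.ne fun e => this (Sum.inr_injective e)
        simp [hv₃, hv₂, h.old_chain, this, h₂ j (by omega)]
      · intro h0
        obtain ⟨h₄, h₅⟩ := h₃ h0
        refine ⟨fun j hj => ?_, fun j hj => ?_⟩
        · have : j ≠ i.succ := by rintro rfl; simp [hi] at hj
          simp [hv₃, hv₂, h.chain_inj.ne this, (h.old_chain _ _).symm, h₄ j (by omega)]
        · obtain rfl : j = i.succ := Fin.ext (by simp [hi, hj])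
          have e₁ := h₅ i.castSucc rfl
          have e₂ := h₄ i.succ (by simp [hi])
          have e₃ := h₂ i le_rfl
          have e₄ : (∀ j : Fin nW, j.val < k + 1 → v (l.old (.inr j)) = false) ↔
              (∀ j : Fin nW, j.val < k → v (l.old (.inr j)) = false) ∧
                v (l.old (.inr i)) = false := by
            refine ⟨fun h => ⟨fun j hj => h j (by omega), h i (by simp [hi])⟩,
              fun h j hj => ?_⟩
            rcases Nat.lt_succ_iff_lt_or_eq.1 hj with hj | hj
            · exact h.1 j hj
            · obtain rfl : j = i := Fin.ext hj
              exact h.2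
          simp only [hv₃, hv₂, update_self, update_of_ne (h.old_chain _ _).symm, e₁, e₂, e₃, e₄]
          cases v l.coin <;> cases v (l.old (.inr i)) <;> simp
  obtain ⟨v', hm, h₁, -, h₂⟩ := key nW le_rfl
  refine ⟨v', ?_, h₁, fun h0 => ?_⟩
  · rwa [List.take_of_length_le (by simp)] at hm
  · rw [(h₂ h0).2 (Fin.last nW) rfl]
    simp

/-- The two conditions are exclusive, one requiring coin 0 and the other coin 1, so adding both into
`ans` gives their disjunction. Two CNOTs then move it to the output qubit, whatever that contained.
-/
theorem Proper.maps_answer (h : l.Proper) (v : ι → Bool) : ∃ v', Maps l.answer v v' ∧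
    (v l.ans = false → (∀ i, v (l.chain i) = false) → v l.coinNeg = (! v l.coin) →
      v' l.newOut = if v l.coin then decide (∀ i, v (l.old (.inr i)) = false) else v l.oldOut) := by
  obtain ⟨x, hx⟩ := h.oldOut
  have hno : l.coinNeg ≠ l.oldOut := by rw [hx]; exact (h.old_coinNeg x).symm
  have hoa : l.oldOut ≠ l.ans := by rw [hx]; exact h.old_ans x
  have m₁ := maps_ccx hno h.coinNeg_ans hoa v
  set v₁ := update v l.ans (xor (v l.coinNeg && v l.oldOut) (v l.ans)) with hv₁
  obtain ⟨v₂, m₂, h₂, h₃⟩ := h.maps_chainTest v₁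
  have m₃ := maps_cx (h.chain_ans (Fin.last nW)) v₂
  set v₃ := update v₂ l.ans (xor (v₂ (l.chain (Fin.last nW))) (v₂ l.ans)) with hv₃
  have m₄ := maps_cx h.newOut v₃
  set v₄ := update v₃ l.ans (xor (v₃ l.newOut) (v₃ l.ans)) with hv₄
  have m₅ := maps_cx h.newOut.symm v₄
  refine ⟨_, (m₁.append m₂).append ((m₃.append m₄).append m₅), fun ha hc hn => ?_⟩
  have e₁ : v₂ (l.chain (Fin.last nW)) =
      (v l.coin && decide (∀ i, v (l.old (.inr i)) = false)) := by
    rw [h₃ fun i => by simp [hv₁, h.chain_ans, hc]]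
    simp [hv₁, h.coin_ans, h.old_ans]
  have e₂ : v₂ l.ans = (! v l.coin && v l.oldOut) := by
    rw [h₂]
    simp [hv₁, ha, hn]
  simp only [update_self, hv₄, update_of_ne h.newOut, hv₃, e₁, e₂]
  generalize v₂ l.newOut = p
  generalize decide (∀ i, v (l.old (.inr i)) = false) = q
  cases v l.coin <;> cases v l.oldOut <;> cases p <;> cases q <;> rfl

end Layout

/-! ### The states of the halved verifier -/

section Halved

variable {a b : ℕ} {β : Type} [Fintype β] [DecidableEq β] {o : Fin a ⊕ Fin b}

/-- The wires of the halved verifier. -/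
abbrev NewWire (a b : ℕ) : Type := Fin (a + (b + 1)) ⊕ Fin (4 + (b + (b + 1)))

/-- The joint states of the prover and the halved verifier. -/
abbrev NewState (β : Type) (a b : ℕ) : Type := β × Bits (a + (b + 1)) × Bits (4 + (b + (b + 1)))

/-- The states of the prover and the original verifier, where the prover also has the additional
message qubits. -/
abbrev OldState (β : Type) (a b : ℕ) : Type := (β × Bits (b + 1)) × Bits a × Bits b

/-- A family of states of the verifier's qubits as a joint state. -/
def joint (f : β → (NewWire a b → Bool) → ℂ) : NewState β a b → ℂ :=
  fun j => f j.1 (Sum.elim j.2.1 j.2.2)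

theorem opM_joint (M : Matrix (NewWire a b → Bool) (NewWire a b → Bool) ℂ)
    (f : β → (NewWire a b → Bool) → ℂ) :
    opM β M *ᵥ joint f = joint fun x => M *ᵥ f x := by
  funext ⟨x, μ, ν⟩
  rw [opM_mulVec]
  simp only [joint, Sum.elim_comp_inl_inr]

theorem weight_joint (f : β → (NewWire a b → Bool) → ℂ) (i : NewWire a b) :
    weight (fun j : NewState β a b => Sum.elim j.2.1 j.2.2 i = true) (joint f) =
      ∑ x, ∑ v : NewWire a b → Bool, if v i = true then ‖f x v‖ ^ 2 else 0 := by
  rw [weight, Fintype.sum_prod_type]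
  refine Finset.sum_congr rfl fun x _ => ?_
  rw [← (Equiv.sumArrowEquivProdArrow _ _ Bool).sum_comp]
  refine Finset.sum_congr rfl fun v _ => ?_
  have : Sum.elim (Equiv.sumArrowEquivProdArrow _ _ Bool v).1
    (Equiv.sumArrowEquivProdArrow _ _ Bool v).2 = v := Sum.elim_comp_inl_inr v
  simp only [joint, this]

/-- The private qubits of the halved verifier other than the coin and the original private qubits
have their standard values. -/
def Standard (o : Fin a ⊕ Fin b) (v : NewWire a b → Bool) : Prop :=
  v (finLayout a b o).coinNeg = (! v (finLayout a b o).coin) ∧ v (finLayout a b o).anc = false ∧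
    v (finLayout a b o).ans = false ∧ ∀ i, v ((finLayout a b o).chain i) = false

instance (o : Fin a ⊕ Fin b) : DecidablePred (Standard o) := fun _ => inferInstanceAs
  (Decidable (_ ∧ _))

/-- The state of the original verifier and the additional message qubits. -/
def oldPart (x : β) (v : NewWire a b → Bool) : OldState β a b :=
  ((x, fun i => v (.inl (Fin.natAdd a i))), fun i => v (.inl (Fin.castAdd _ i)),
    fun i => v (.inr (Fin.natAdd 4 (Fin.castAdd _ i))))

/-- The state of the halved verifier that belongs to a state for each value of the coin. -/
def lifted (o : Fin a ⊕ Fin b) (φ : Bool → OldState β a b → ℂ) (x : β)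
    (v : NewWire a b → Bool) : ℂ :=
  if Standard o v then φ (v (finLayout a b o).coin) (oldPart x v) else 0

theorem standard_extend (v : NewWire a b → Bool) (u : Fin a ⊕ Fin b → Bool) :
    Standard o (extend (finLayout a b o).old u v) ↔ Standard o v := by
  have h := finLayout_proper a b o
  simp only [Standard, extend_of_ne h.old_coin, extend_of_ne h.old_coinNeg,
    extend_of_ne h.old_anc, extend_of_ne h.old_ans, extend_of_ne fun x => h.old_chain x _]

theorem oldPart_extend (x : β) (v : NewWire a b → Bool) (u : Fin a ⊕ Fin b → Bool) :
    oldPart x (extend (finLayout a b o).old u v) =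
      ((x, fun i => v (.inl (Fin.natAdd a i))), u ∘ Sum.inl, u ∘ Sum.inr) := by
  have h := finLayout_proper a b o
  refine Prod.ext (Prod.ext rfl ?_) (Prod.ext ?_ ?_)
  · funext i
    refine extend_of_ne (e := (finLayout a b o).old) ?_
    rintro (y | y)
    · simp [finLayout, Fin.ext_iff]; omega
    · simp [finLayout]
  · funext i
    exact h.old_inj.extend_apply u v (.inl i)
  · funext i
    exact h.old_inj.extend_apply u v (.inr i)

theorem lifted_extend (φ : Bool → OldState β a b → ℂ) (x : β) (v : NewWire a b → Bool)
    (u : Fin a ⊕ Fin b → Bool) : lifted o φ x (extend (finLayout a b o).old u v) =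
      if Standard o v then φ (v (finLayout a b o).coin)
        ((x, fun i => v (.inl (Fin.natAdd a i))), u ∘ Sum.inl, u ∘ Sum.inr) else 0 := by
  simp only [lifted, standard_extend, oldPart_extend,
    extend_of_ne (finLayout_proper a b o).old_coin]

theorem extend_self {ι κ : Type} {e : κ → ι} (v : ι → Bool) : extend e (v ∘ e) v = v := by
  classical
  funext x
  by_cases hx : ∃ k, e k = x
  · rw [extend_def, dif_pos hx]
    exact congrArg v (Classical.choose_spec hx)
  · rw [extend_apply' _ _ _ hx]

theorem run_forth_lifted (φ : Bool → OldState β a b → ℂ) (C : Circuit (Fin a ⊕ Fin b)) (x : β) :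
    run ((finLayout a b o).forth C) (lifted o φ x) =
      lifted o (fun c => if c then φ c else opM _ C.mat *ᵥ φ c) x := by
  have h := finLayout_proper a b o
  funext v
  obtain ⟨u, hu⟩ : ∃ u, extend (finLayout a b o).old u v = v := ⟨_, extend_self v⟩
  by_cases hv : Standard o v
  · rw [← hu, Layout.forth, run_forth h.old_inj h.coinNeg_anc h.old_coinNeg h.old_anc _ _ hv.2.1,
      hv.1]
    simp only [lifted_extend, hv, if_true]
    cases v (finLayout a b o).coin
    · simp only [Bool.not_false, if_true, Bool.false_eq_true, if_false]
      rw [opM_mulVec, Sum.elim_comp_inl_inr]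
    · simp
  · rw [← hu, Layout.forth, run_ctrlGates_vanish h.old_inj h.coinNeg_anc h.old_coinNeg h.old_anc]
    · simp [lifted_extend, hv]
    · intro u
      simp [lifted_extend, hv]

theorem run_back_lifted (φ : Bool → OldState β a b → ℂ) (C : Circuit (Fin a ⊕ Fin b)) (x : β) :
    run ((finLayout a b o).back C) (lifted o φ x) =
      lifted o (fun c => if c then opM _ C.matᴴ *ᵥ φ c else φ c) x := by
  have h := finLayout_proper a b o
  funext v
  obtain ⟨u, hu⟩ : ∃ u, extend (finLayout a b o).old u v = v := ⟨_, extend_self v⟩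
  by_cases hv : Standard o v
  · rw [← hu, Layout.back, run_back h.old_inj h.coin_anc h.old_coin h.old_anc _ _ hv.2.1]
    simp only [lifted_extend, hv, if_true]
    cases v (finLayout a b o).coin
    · simp
    · simp only [if_true]
      rw [opM_mulVec, Sum.elim_comp_inl_inr]
  · rw [← hu, Layout.back, run_ctrlGates_vanish h.old_inj h.coin_anc h.old_coin h.old_anc]
    · simp [lifted_extend, hv]
    · intro u
      simp [lifted_extend, hv]

/-- The registers of the prover of the halved verifier, as registers of a prover of the original
one. -/
def regroup (β : Type) (a b : ℕ) : (β × Bits (b + 1)) × Bits a ≃ β × Bits (a + (b + 1)) where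
  toFun p := (p.1.1, Fin.append p.2 p.1.2)
  invFun p := ((p.1, fun i => p.2 (Fin.natAdd a i)), fun i => p.2 (Fin.castAdd _ i))
  left_inv p := by simp
  right_inv p := by
    refine Prod.ext rfl ?_
    funext i
    refine Fin.addCases (fun i => ?_) (fun i => ?_) i <;> simp

/-- An action of a prover of the halved verifier, as an action of a prover of the original one. -/
def regrouped (U : Matrix (β × Bits (a + (b + 1))) (β × Bits (a + (b + 1))) ℂ) :
    Matrix ((β × Bits (b + 1)) × Bits a) ((β × Bits (b + 1)) × Bits a) ℂ :=
  U.submatrix (regroup β a b) (regroup β a b)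

/-- The prover cannot touch the coin or the ancillas, so the same operator acts in both branches.
This is what forces the two branches of the protocol to share the prover's moves. -/
theorem opP_joint_lifted (U : Matrix (β × Bits (a + (b + 1))) (β × Bits (a + (b + 1))) ℂ)
    (φ : Bool → OldState β a b → ℂ) : opP (Bits (4 + (b + (b + 1)))) U *ᵥ joint (lifted o φ) =
      joint (lifted o fun c => opP (Bits b) (regrouped U) *ᵥ φ c) := by
  funext ⟨x, μ, ν⟩
  rw [opP_mulVec]
  by_cases hν : ∀ μ, Standard o (Sum.elim μ ν)
  · simp only [joint, lifted, hν, if_true, oldPart, Sum.elim_inl, Sum.elim_inr]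
    rw [opP_mulVec, regrouped, submatrix_mulVec_equiv]
    simp only [Function.comp_apply]
    congr 1
    exact ((regroup β a b).apply_symm_apply (x, μ)).symm
  · have : ∀ μ, ¬ Standard o (Sum.elim μ ν) := fun μ h => hν fun μ' => h
    simp only [joint, lifted, this, if_false]
    simp [mulVec, dotProduct]

theorem newWire_cases {P : NewWire a b → Prop} (o : Fin a ⊕ Fin b)
    (h₁ : ∀ i, P (.inl (Fin.castAdd _ i))) (h₂ : ∀ i, P (.inl (Fin.natAdd a i)))
    (h₃ : P (finLayout a b o).coin) (h₄ : P (finLayout a b o).coinNeg)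
    (h₅ : P (finLayout a b o).anc) (h₆ : P (finLayout a b o).ans)
    (h₇ : ∀ i, P (.inr (Fin.natAdd 4 (Fin.castAdd _ i)))) (h₈ : ∀ i, P ((finLayout a b o).chain i)) :
    ∀ x, P x := by
  rintro (i | i)
  · exact Fin.addCases h₁ h₂ i
  · refine Fin.addCases (motive := fun i => P (.inr i)) (fun i => ?_) (fun i => ?_) i
    · match i with
      | 0 => exact h₃
      | 1 => exact h₄
      | 2 => exact h₅
      | 3 => exact h₆
    · exact Fin.addCases (motive := fun i => P (.inr (Fin.natAdd 4 i))) h₇ h₈ i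

/-- The bits of the halved verifier in a standard state. -/
def newBits (c : Bool) (s : OldState β a b) : NewWire a b → Bool :=
  Sum.elim (Fin.append s.2.1 s.1.2)
    (Fin.append ![c, ! c, false, false] (Fin.append s.2.2 fun _ => false))

theorem newBits_coin (c : Bool) (s : OldState β a b) :
    newBits c s (finLayout a b o).coin = c := by
  simp only [newBits, finLayout, Sum.elim_inr, Fin.append_left]
  rfl

theorem newBits_coinNeg (c : Bool) (s : OldState β a b) :
    newBits c s (finLayout a b o).coinNeg = ! c := by
  simp only [newBits, finLayout, Sum.elim_inr, Fin.append_left]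
  rfl

theorem newBits_anc (c : Bool) (s : OldState β a b) :
    newBits c s (finLayout a b o).anc = false := by
  simp only [newBits, finLayout, Sum.elim_inr, Fin.append_left]
  rfl

theorem newBits_ans (c : Bool) (s : OldState β a b) :
    newBits c s (finLayout a b o).ans = false := by
  simp only [newBits, finLayout, Sum.elim_inr, Fin.append_left]
  rfl

theorem newBits_chain (c : Bool) (s : OldState β a b) (i : Fin (b + 1)) :
    newBits c s ((finLayout a b o).chain i) = false := by
  simp only [newBits, finLayout, Sum.elim_inr, Fin.append_right]

theorem newBits_old (c : Bool) (s : OldState β a b) (x : Fin a ⊕ Fin b) :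
    newBits c s ((finLayout a b o).old x) = Sum.elim s.2.1 s.2.2 x := by
  cases x <;> simp [newBits, finLayout]

theorem standard_newBits (c : Bool) (s : OldState β a b) : Standard o (newBits c s) :=
  ⟨by rw [newBits_coin, newBits_coinNeg], newBits_anc c s, newBits_ans c s, newBits_chain c s⟩

theorem oldPart_newBits (c : Bool) (s : OldState β a b) : oldPart s.1.1 (newBits c s) = s := by
  simp [oldPart, newBits]

theorem newBits_oldPart {v : NewWire a b → Bool} (hv : Standard o v) (x : β) :
    newBits (v (finLayout a b o).coin) (oldPart x v) = v := by
  funext y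
  refine newWire_cases o (P := fun y => newBits (v (finLayout a b o).coin) (oldPart x v) y = v y)
    ?_ ?_ ?_ ?_ ?_ ?_ ?_ ?_ y
  · intro i; simp [newBits, oldPart]
  · intro i; simp [newBits, oldPart]
  · rw [newBits_coin]
  · rw [newBits_coinNeg, hv.1]
  · rw [newBits_anc, hv.2.1]
  · rw [newBits_ans, hv.2.2.1]
  · intro i; simp [newBits, oldPart]
  · intro i; rw [newBits_chain, hv.2.2.2]

/-- The outcomes that let the halved verifier accept. -/
def Accepting (o : Fin a ⊕ Fin b) (c : Bool) (s : OldState β a b) : Prop :=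
  if c then s.2.2 = fun _ => false else Sum.elim s.2.1 s.2.2 o = true

instance (o : Fin a ⊕ Fin b) (c : Bool) : DecidablePred (Accepting (β := β) o c) := fun _ =>
  inferInstanceAs (Decidable (if c then _ else _))

/-- The state is supported on standard basis states, which `newBits` identifies with pairs of a coin
value and an original state; on these the answer is `Accepting`. -/
theorem weight_answer (φ : Bool → OldState β a b → ℂ) :
    weight (fun j : NewState β a b => Sum.elim j.2.1 j.2.2 (finLayout a b o).newOut = true)
      (joint fun x => run (finLayout a b o).answer (lifted o φ x)) =
    weight (Accepting o false) (φ false) + weight (Accepting o true) (φ true) := by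
  have h := finLayout_proper a b o
  choose f hf hf' using h.maps_answer
  rw [weight_joint]
  simp only [sum_run_eq hf (fun v => v (finLayout a b o).newOut = true)]
  have hsum : weight (Accepting o false) (φ false) + weight (Accepting o true) (φ true) =
      ∑ p : Bool × OldState β a b, if Accepting o p.1 p.2 then ‖φ p.1 p.2‖ ^ 2 else 0 := by
    rw [Fintype.sum_prod_type, Fintype.sum_bool, add_comm]
    rfl
  rw [hsum, ← Fintype.sum_prod_type']
  symm
  refine Fintype.sum_of_injective (fun p : Bool × OldState β a b =>
    (p.2.1.1, newBits p.1 p.2)) ?_ _ _ ?_ ?_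
  · rintro ⟨c, s⟩ ⟨c', s'⟩ hcs
    obtain ⟨h₁, h₂⟩ := Prod.mk.inj hcs
    have h₃ := congrFun h₂ (finLayout a b o).coin
    have h₄ : oldPart s.1.1 (newBits c s) = oldPart s'.1.1 (newBits c' s') := by rw [h₁, h₂]
    rw [newBits_coin, newBits_coin] at h₃
    rw [oldPart_newBits, oldPart_newBits] at h₄
    exact Prod.ext h₃ h₄
  · rintro ⟨x, v⟩ hv
    have : ¬ Standard o v := fun hs => hv ⟨(v (finLayout a b o).coin, oldPart x v),
      Prod.ext rfl (newBits_oldPart hs x)⟩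
    simp [lifted, this]
  · rintro ⟨c, s⟩
    have h₁ := hf' (newBits c s) (newBits_ans c s) (newBits_chain c s)
      (by rw [newBits_coin, newBits_coinNeg])
    have h₂ : (finLayout a b o).oldOut = (finLayout a b o).old o := rfl
    simp only [newBits_coin, newBits_old, h₂, Sum.elim_inr] at h₁
    have h₃ : f (newBits c s) (finLayout a b o).newOut = true ↔ Accepting o c s := by
      rw [h₁, Accepting]
      cases c
      · simp
      · simp [funext_iff]
    simp only [h₃, lifted, standard_newBits, newBits_coin, oldPart_newBits, if_true]

/-- The branches evolve independently, because each controlled circuit acts in one of them only. At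
least one round is required, since the answer is computed in the last. -/
theorem weight_rounds {k : ℕ} (Us : List (Matrix (β × Bits (a + (b + 1)))
    (β × Bits (a + (b + 1))) ℂ)) (Fs Bs : List (Circuit (Fin a ⊕ Fin b)))
    (hU : Us.length = k + 1) (hF : Fs.length = k + 1) (hB : Bs.length = k + 1)
    (φ : Bool → OldState β a b → ℂ) :
    weight (fun j : NewState β a b => Sum.elim j.2.1 j.2.2 (finLayout a b o).newOut = true)
      (alternate (Us.map (opP _)) (((finLayout a b o).rounds Fs Bs).map fun L =>
        opM β (circuitOf L).mat) (joint (lifted o φ))) =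
    weight (Accepting o false) (alternate (Us.map fun U => opP _ (regrouped U))
        (Fs.map fun C => opM _ C.mat) (φ false)) +
      weight (Accepting o true) (alternate (Us.map fun U => opP _ (regrouped U))
        (Bs.map fun C => opM _ C.matᴴ) (φ true)) := by
  induction k generalizing Us Fs Bs φ with
  | zero =>
    obtain ⟨U, rfl⟩ := List.length_eq_one_iff.1 hU
    obtain ⟨F, rfl⟩ := List.length_eq_one_iff.1 hF
    obtain ⟨B, rfl⟩ := List.length_eq_one_iff.1 hB
    simp only [Layout.rounds, List.map_cons, List.map_nil, alternate, List.isEmpty_nil, if_true]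
    rw [opP_joint_lifted, opM_joint]
    simp only [← run.eq_1, run_append, run_forth_lifted, run_back_lifted, weight_answer]
    simp
  | succ k ih =>
    obtain ⟨U, Us, rfl⟩ := List.exists_cons_of_length_eq_add_one hU
    obtain ⟨F, Fs, rfl⟩ := List.exists_cons_of_length_eq_add_one hF
    obtain ⟨B, Bs, rfl⟩ := List.exists_cons_of_length_eq_add_one hB
    have hne : Fs.isEmpty = false := by
      cases Fs
      · simp at hF
      · rfl
    simp only [List.length_cons, Nat.add_right_cancel_iff] at hU hF hB
    simp only [Layout.rounds, List.map_cons, alternate, hne, Bool.false_eq_true, if_false,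
      List.append_nil]
    rw [opP_joint_lifted, opM_joint]
    simp only [← run.eq_1, run_append, run_forth_lifted, run_back_lifted]
    rw [ih Us Fs Bs hU hF hB]
    simp

end Halved

/-! ### The state after the first message and the coin toss -/

section Start

variable {a b : ℕ} {β : Type} [Fintype β] [DecidableEq β] {o : Fin a ⊕ Fin b}

/-- The verifier's private qubits are zero. -/
def started (ψ : β × Bits (a + (b + 1)) → ℂ) (x : β) (v : NewWire a b → Bool) : ℂ :=
  if v ∘ Sum.inr = fun _ => false then ψ (x, v ∘ Sum.inl) else 0

/-- The state after the verifier has received the first message. -/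
def received (ψ : β × Bits (a + (b + 1)) → ℂ) (s : OldState β a b) : ℂ :=
  if ∀ i : Fin b, s.1.2 i.castSucc = false then
    ψ (s.1.1, Fin.append s.2.1 (Fin.snoc (α := fun _ => Bool) s.2.2 (s.1.2 (Fin.last b)))) else 0

/-- Flip the qubit that transports the coin. -/
def flipCoin (r : Bits (b + 1)) : Bits (b + 1) := update r (Fin.last b) (! r (Fin.last b))

theorem flipCoin_flipCoin (r : Bits (b + 1)) : flipCoin (flipCoin r) = r := by
  simp [flipCoin]

theorem inr_eq_zero_iff (v : NewWire a b → Bool) : (v ∘ Sum.inr = fun _ => false) ↔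
    (v (finLayout a b o).coin = false ∧ v (finLayout a b o).coinNeg = false ∧
      v (finLayout a b o).anc = false ∧ v (finLayout a b o).ans = false ∧
      (∀ i, v ((finLayout a b o).chain i) = false)) ∧
      ∀ i, v ((finLayout a b o).old (.inr i)) = false := by
  constructor
  · intro h
    have : ∀ i, v (.inr i) = false := congrFun h
    exact ⟨⟨this _, this _, this _, this _, fun _ => this _⟩, fun _ => this _⟩
  · rintro ⟨⟨h₁, h₂, h₃, h₄, h₅⟩, h₆⟩
    have := newWire_cases (P := fun x => ∀ i, x = .inr i → v x = false) o
      (by simp) (by simp) (fun _ _ => h₁) (fun _ _ => h₂) (fun _ _ => h₃) (fun _ _ => h₄)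
      (fun i _ _ => h₆ i) (fun i _ _ => h₅ i)
    funext i
    exact this _ i rfl

theorem run_receive_started (ψ : β × Bits (a + (b + 1)) → ℂ) (x : β) (v : NewWire a b → Bool) :
    run (finLayout a b o).receive (started ψ x) v =
      if v (finLayout a b o).coin = false ∧ v (finLayout a b o).coinNeg = false ∧
        v (finLayout a b o).anc = false ∧ v (finLayout a b o).ans = false ∧
        (∀ i, v ((finLayout a b o).chain i) = false) then received ψ (oldPart x v) else 0 := by
  have h := finLayout_proper a b o
  obtain ⟨v₀, hm, h₁, h₂, h₃⟩ := h.maps_receive v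
  have e₁ : v₀ (finLayout a b o).coin = v (finLayout a b o).coin :=
    h₃ _ (by simp [finLayout]) fun i => (h.old_coin _).symm
  have e₂ : v₀ (finLayout a b o).coinNeg = v (finLayout a b o).coinNeg :=
    h₃ _ (by simp [finLayout]) fun i => (h.old_coinNeg _).symm
  have e₃ : v₀ (finLayout a b o).anc = v (finLayout a b o).anc :=
    h₃ _ (by simp [finLayout]) fun i => (h.old_anc _).symm
  have e₄ : v₀ (finLayout a b o).ans = v (finLayout a b o).ans :=
    h₃ _ (by simp [finLayout]) fun i => (h.old_ans _).symm
  have e₅ : ∀ i, v₀ ((finLayout a b o).chain i) = v ((finLayout a b o).chain i) := fun i =>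
    h₃ _ (by simp [finLayout]) fun j => (h.old_chain _ _).symm
  have e₆ : v₀ (finLayout a b o).coinMsg = v (finLayout a b o).coinMsg :=
    h₃ _ (by intro i; simp [finLayout, Fin.ext_iff]; omega) fun i => (h.old_coinMsg _).symm
  rw [hm (started ψ x), started]
  simp only [inr_eq_zero_iff (o := o), e₁, e₂, e₃, e₄, e₅, h₂]
  rw [ite_and]
  refine if_congr Iff.rfl ?_ rfl
  rw [received]
  refine ite_congr rfl (fun hs => ?_) fun _ => rfl
  congr 2
  funext i
  refine Fin.addCases (fun i => ?_) (fun i => ?_) i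
  · simp only [Function.comp_apply, Fin.append_left]
    refine h₃ _ (by intro j; simp [finLayout, Fin.ext_iff]; omega) (by simp [finLayout])
  · simp only [Function.comp_apply, Fin.append_right]
    refine Fin.lastCases ?_ (fun i => ?_) i
    · simp only [Fin.snoc_last]
      exact e₆
    · simp only [Fin.snoc_castSucc]
      -- The snapshot qubit is 0 now, so before the two CNOTs it held what the private qubit holds
      -- now.
      have := h₁ i
      rw [show v ((finLayout a b o).snap i) = false from hs i, Bool.false_xor] at this
      exact this

/-- Since the coin starts at 0, the Hadamard gate has a single contribution, and both coin values
get the same amplitude up to the factor 1/√2. -/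
theorem run_toss (χ : (NewWire a b → Bool) → ℂ) (hχ : ∀ v, v (finLayout a b o).coin = true → χ v = 0)
    (v : NewWire a b → Bool) : run (finLayout a b o).toss χ v =
      ((Real.sqrt 2 : ℝ) : ℂ)⁻¹ * χ (update (update (update v (finLayout a b o).coinNeg
        (! xor (v (finLayout a b o).coin) (v (finLayout a b o).coinNeg)))
        (finLayout a b o).coinMsg (xor (v (finLayout a b o).coin) (v (finLayout a b o).coinMsg)))
        (finLayout a b o).coin false) := by
  have h := finLayout_proper a b o
  have hmn : (finLayout a b o).coinMsg ≠ (finLayout a b o).coinNeg := by simp [finLayout]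
  simp only [Layout.toss, run_append, run_cx h.coin_coinNeg, run_pauliX, update_self, update_idem,
    run_cons_cons, run_h, run_cx h.coin_coinMsg, update_of_ne h.coin_coinNeg,
    update_of_ne h.coin_coinMsg, update_of_ne hmn]
  rw [hχ (update _ _ true) (by simp), mul_zero, add_zero, div_eq_inv_mul]

/-- The coin is added to a message qubit, so the branches differ exactly by a flip of that qubit,
whatever the prover put there. -/
theorem run_receive_toss (ψ : β × Bits (a + (b + 1)) → ℂ) (x : β) :
    run ((finLayout a b o).receive ++ (finLayout a b o).toss) (started ψ x) =
      lifted o (fun c => ((Real.sqrt 2 : ℝ) : ℂ)⁻¹ • fun s => received ψ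
        ((s.1.1, if c then flipCoin s.1.2 else s.1.2), s.2)) x := by
  have h := finLayout_proper a b o
  funext v
  rw [run_append, run_toss _ fun v hv => by rw [run_receive_started, if_neg (by simp [hv])],
    run_receive_started]
  set v' := update (update (update v (finLayout a b o).coinNeg
        (! xor (v (finLayout a b o).coin) (v (finLayout a b o).coinNeg)))
        (finLayout a b o).coinMsg (xor (v (finLayout a b o).coin) (v (finLayout a b o).coinMsg)))
        (finLayout a b o).coin false with hv'
  have e : ∀ x, x ≠ (finLayout a b o).coin → x ≠ (finLayout a b o).coinMsg →
      x ≠ (finLayout a b o).coinNeg → v' x = v x := by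
    intro x h₁ h₂ h₃
    rw [hv', update_of_ne h₁, update_of_ne h₂, update_of_ne h₃]
  have e₁ : v' (finLayout a b o).coin = false := by simp [hv']
  have e₂ : v' (finLayout a b o).coinNeg =
      ! xor (v (finLayout a b o).coin) (v (finLayout a b o).coinNeg) := by
    rw [hv', update_of_ne h.coin_coinNeg.symm, update_of_ne (by simp [finLayout]), update_self]
  have e₃ : v' (finLayout a b o).anc = v (finLayout a b o).anc :=
    e _ h.coin_anc.symm (by simp [finLayout]) h.coinNeg_anc.symm
  have e₄ : v' (finLayout a b o).ans = v (finLayout a b o).ans :=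
    e _ h.coin_ans.symm (by simp [finLayout]) h.coinNeg_ans.symm
  have e₅ : ∀ i, v' ((finLayout a b o).chain i) = v ((finLayout a b o).chain i) := fun i =>
    e _ (h.chain_coin i) (by simp [finLayout]) (by simp [finLayout, Fin.ext_iff]; omega)
  have e₆ : v' (finLayout a b o).coinMsg =
      xor (v (finLayout a b o).coin) (v (finLayout a b o).coinMsg) := by
    rw [hv', update_of_ne h.coin_coinMsg.symm, update_self]
  have e₇ : oldPart x v' = ((x, if v (finLayout a b o).coin then flipCoin (oldPart x v).1.2
      else (oldPart x v).1.2), (oldPart x v).2) := by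
    refine Prod.ext (Prod.ext rfl ?_) (Prod.ext ?_ ?_)
    · funext i
      refine Fin.lastCases ?_ (fun i => ?_) i
      · refine e₆.trans ?_
        cases v (finLayout a b o).coin
        · simp [oldPart, finLayout]
        · simp [oldPart, finLayout, flipCoin]
      · refine (e ((finLayout a b o).snap i) (by simp [finLayout])
          (by simp [finLayout, Fin.ext_iff]; omega) (by simp [finLayout])).trans ?_
        cases v (finLayout a b o).coin
        · simp [oldPart, finLayout]
        · simp only [if_true, flipCoin]
          rw [update_of_ne (Fin.castSucc_lt_last i).ne]
          rfl
    · funext i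
      exact e _ (by simp [finLayout]) (h.old_coinMsg (.inl i)) (by simp [finLayout])
    · funext i
      exact e _ (h.old_coin (.inr i)) (by simp [finLayout]) (h.old_coinNeg (.inr i))
  have e₈ : (v' (finLayout a b o).coin = false ∧ v' (finLayout a b o).coinNeg = false ∧
      v' (finLayout a b o).anc = false ∧ v' (finLayout a b o).ans = false ∧
      (∀ i, v' ((finLayout a b o).chain i) = false)) ↔ Standard o v := by
    rw [e₁, e₂, e₃, e₄, Standard]
    simp only [e₅, true_and]
    -- The negated coin started at 0 exactly when it now is the negation of the coin.
    refine and_congr_left fun _ => ?_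
    cases v (finLayout a b o).coin <;> cases v (finLayout a b o).coinNeg <;> simp
  rw [lifted, mul_ite, mul_zero]
  refine if_congr e₈ ?_ rfl
  rw [e₇]
  rfl

/-- Receiving moves the amplitudes along an injection of basis states and puts zero elsewhere. -/
theorem total_received (ψ : β × Bits (a + (b + 1)) → ℂ) : total (received ψ) = total ψ := by
  symm
  refine Fintype.sum_of_injective (fun p : β × Bits (a + (b + 1)) =>
    (((p.1, Fin.snoc (α := fun _ => Bool) (fun _ => false) (p.2 (Fin.natAdd a (Fin.last b)))),
      fun i => p.2 (Fin.castAdd _ i), fun i => p.2 (Fin.natAdd a i.castSucc)) : OldState β a b))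
    ?_ _ _ ?_ ?_
  · rintro ⟨x, μ⟩ ⟨x', μ'⟩ h
    simp only [Prod.mk.injEq] at h
    obtain ⟨⟨h₁, h₂⟩, h₃, h₄⟩ := h
    refine Prod.ext h₁ ?_
    funext i
    refine Fin.addCases (fun i => congrFun h₃ i) (fun i => ?_) i
    refine Fin.lastCases ?_ (fun i => congrFun h₄ i) i
    simpa using congrFun h₂ (Fin.last b)
  · rintro ⟨⟨x, r⟩, μ, w⟩ h
    have : ¬ ∀ i : Fin b, r i.castSucc = false := by
      intro hr
      refine h ⟨(x, Fin.append μ (Fin.snoc (α := fun _ => Bool) w (r (Fin.last b)))), ?_⟩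
      refine Prod.ext (Prod.ext rfl ?_) (Prod.ext ?_ ?_)
      · funext i
        refine Fin.lastCases ?_ (fun i => ?_) i
        · simp only [Fin.snoc_last, Fin.append_right]
        · simp [hr i]
      · funext i; simp
      · funext i; simp
    simp [received, this]
  · rintro ⟨x, μ⟩
    simp only [received, Fin.snoc_castSucc, implies_true, if_true, Fin.snoc_last]
    congr 4
    funext i
    refine Fin.addCases (fun i => ?_) (fun i => ?_) i
    · simp
    · rw [Fin.append_right]
      refine Fin.lastCases ?_ (fun i => ?_) i <;> simp

/-- The operator that flips the qubit that transports the coin. -/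
def flipMat (β : Type) [DecidableEq β] (a b : ℕ) :
    Matrix ((β × Bits (b + 1)) × Bits a) ((β × Bits (b + 1)) × Bits a) ℂ :=
  (1 : Matrix _ _ ℂ).submatrix (((Equiv.refl β).prodCongr
    (Involutive.toPerm flipCoin flipCoin_flipCoin)).prodCongr (Equiv.refl _)) (Equiv.refl _)

theorem flipMat_mem : flipMat β a b ∈ unitaryGroup ((β × Bits (b + 1)) × Bits a) ℂ := by
  rw [mem_unitaryGroup_iff, star_eq_conjTranspose, flipMat, conjTranspose_submatrix,
    submatrix_mul_equiv, conjTranspose_one, Matrix.one_mul, submatrix_one_equiv]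

theorem opP_flipMat_mulVec (φ : OldState β a b → ℂ) :
    opP (Bits b) (flipMat β a b) *ᵥ φ = fun s => φ ((s.1.1, flipCoin s.1.2), s.2) := by
  funext ⟨⟨x, r⟩, μ, w⟩
  rw [opP_mulVec, flipMat, submatrix_mulVec_equiv, one_mulVec]
  rfl

end Start

theorem weight_congr {S : Type} [Fintype S] {p q : S → Prop} [DecidablePred p] [DecidablePred q]
    (h : ∀ s, p s ↔ q s) (ψ : S → ℂ) : weight p ψ = weight q ψ :=
  Finset.sum_congr rfl fun s _ => if_congr (h s) rfl rfl

/-- The acceptance probability of the actions in a list. -/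
theorem acceptProb_eq {M : ℕ} (hM : Odd M) (A : Actions) (P : Prover A.qM ((M + 1) / 2))
    {L : List (Matrix (Bits P.qQ × Bits A.qM) (Bits P.qQ × Bits A.qM) ℂ)}
    (hL : (List.ofFn fun j => (P.act j).1) = L) :
    acceptProb M A P = weight (fun s => Sum.elim s.2.1 s.2.2 A.outQubit = true)
      (alternate (L.map (opP (Bits A.qW))) ((A.circuits.map Circuit.mat).map (opM _))
        (zeroState _ _ _)) := by
  have h₁ : (List.ofFn fun j => liftProver A.qW (P.act j).1) = L.map (opP (Bits A.qW)) := by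
    rw [← hL, List.map_ofFn]
    rfl
  have h₂ : A.circuits.map (liftVerifier P.qQ) = (A.circuits.map Circuit.mat).map (opM _) := by
    rw [List.map_map]
    rfl
  have h₃ : finalState M A P = alternate (L.map (opP (Bits A.qW)))
      ((A.circuits.map Circuit.mat).map (opM _)) (zeroState _ _ _) := by
    rw [finalState]
    simp only [h₁, h₂]
    rw [if_pos hM]
  rw [← h₃]
  rfl

/-- The probability that the halved verifier accepts. -/
theorem acceptProb_halve (A : Actions) {m : ℕ} (hA : A.circuits.length = 2 * (m + 1) + 1)
    (P : Prover A.halve.qM ((2 * (m + 1) + 1 + 1) / 2))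
    {U : Matrix (Bits P.qQ × Bits (A.qM + (A.qW + 1))) (Bits P.qQ × Bits (A.qM + (A.qW + 1))) ℂ}
    {Us : List (Matrix (Bits P.qQ × Bits (A.qM + (A.qW + 1)))
      (Bits P.qQ × Bits (A.qM + (A.qW + 1))) ℂ)}
    (hP : (List.ofFn fun j => (P.act j).1) = U :: Us) :
    acceptProb (2 * (m + 1) + 1) A.halve P = (1 / 2) *
      (weight (Accepting A.outQubit false) (alternate (Us.map fun U => opP _ (regrouped U))
        ((A.circuits.drop (m + 2)).map fun C => opM _ C.mat)
          (opM _ (A.circuits.getD (m + 1) []).mat *ᵥ received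
            (U *ᵥ Pi.single (fun _ => false, fun _ => false) 1))) +
      weight (Accepting A.outQubit true) (alternate (Us.map fun U => opP _ (regrouped U))
        ((A.circuits.take (m + 1)).reverse.map fun C => opM _ C.matᴴ)
          (opP _ (flipMat _ _ _) *ᵥ received
            (U *ᵥ Pi.single (fun _ => false, fun _ => false) 1)))) := by
  have hlen : (2 * (m + 1) + 1 + 1) / 2 = Us.length + 1 := by
    have := congrArg List.length hP
    rw [List.length_ofFn] at this
    exact this
  have hm : A.circuits.length / 2 = m + 1 := by omega
  set ψ := U *ᵥ Pi.single ((fun _ => false, fun _ => false) :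
    Bits P.qQ × Bits (A.qM + (A.qW + 1))) 1 with hψ
  -- The prover's first move leaves the verifier's private qubits at zero.
  have h₃ : opP (Bits (4 + (A.qW + (A.qW + 1)))) U *ᵥ
      zeroState P.qQ (A.qM + (A.qW + 1)) (4 + (A.qW + (A.qW + 1))) = joint (started ψ) := by
    funext ⟨x, μ, ν⟩
    rw [opP_mulVec, joint, started, Sum.elim_comp_inl, Sum.elim_comp_inr, hψ]
    split_ifs with hν
    · subst hν
      congr 2
      funext p
      simp [zeroState, Pi.single_apply, Prod.ext_iff]
    · simp [mulVec, dotProduct, zeroState, Pi.single_apply, hν]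
  have hout : A.halve.outQubit = (finLayout A.qM A.qW A.outQubit).newOut :=
    A.halve.outQubit_of_pos _
  have hstate : alternate ((U :: Us).map (opP (Bits (4 + (A.qW + (A.qW + 1))))))
      (((((finLayout A.qM A.qW A.outQubit).halved A.circuits).map circuitOf).map Circuit.mat).map
        (opM (Bits P.qQ))) (zeroState P.qQ (A.qM + (A.qW + 1)) (4 + (A.qW + (A.qW + 1)))) =
      alternate (Us.map (opP _))
      (((finLayout A.qM A.qW A.outQubit).rounds (A.circuits.drop (m + 2))
        (A.circuits.take (m + 1)).reverse).map fun L => opM _ (circuitOf L).mat)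
      (joint (lifted A.outQubit fun c => ((Real.sqrt 2 : ℝ) : ℂ)⁻¹ •
        if c then opP _ (flipMat _ _ _) *ᵥ received ψ
          else opM _ (A.circuits.getD (m + 1) []).mat *ᵥ received ψ)) := by
    rw [List.map_map, List.map_map, Layout.halved, hm, List.map_cons, List.map_cons, alternate, h₃]
    simp only [Function.comp_def]
    rw [opM_joint]
    simp only [← run.eq_1, run_append _ (Layout.forth _ _), run_receive_toss, run_forth_lifted]
    congr 2
    funext x
    congr 1
    funext c
    cases c
    · simp [mulVec_smul]
    · simp [opP_flipMat_mulVec]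
  have hw : acceptProb (2 * (m + 1) + 1) A.halve P =
      weight (fun j : NewState (Bits P.qQ) A.qM A.qW => Sum.elim j.2.1 j.2.2
        (finLayout A.qM A.qW A.outQubit).newOut = true)
      (alternate ((U :: Us).map (opP (Bits (4 + (A.qW + (A.qW + 1))))))
      (((((finLayout A.qM A.qW A.outQubit).halved A.circuits).map circuitOf).map Circuit.mat).map
        (opM (Bits P.qQ))) (zeroState P.qQ (A.qM + (A.qW + 1)) (4 + (A.qW + (A.qW + 1))))) := by
    rw [← hout]
    exact acceptProb_eq ⟨_, rfl⟩ A.halve P hP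
  -- The squared amplitude of a coin value is the factor 1/2 in the statement.
  have hn : ‖((Real.sqrt 2 : ℝ) : ℂ)⁻¹‖ ^ 2 = 1 / 2 := by
    rw [norm_inv, Complex.norm_real, inv_pow, Real.norm_eq_abs, sq_abs, Real.sq_sqrt (by norm_num)]
    norm_num
  rw [hw, hstate, weight_rounds (k := m) _ _ _ (by omega) (by simp; omega) (by simp; omega)]
  simp only [alternate_eq, mulVec_smul, weight_smul, hn, if_true, Bool.false_eq_true, if_false]
  ring

/-! ### Provers with an arbitrary finite private register -/

theorem exists_actions {n : Type} [Fintype n] [DecidableEq n] {l : ℕ} (L : List (Matrix n n ℂ))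
    (hL : ∀ U ∈ L, U ∈ unitaryGroup n ℂ) (h : L.length = l) :
    ∃ act : Fin l → unitaryGroup n ℂ, (List.ofFn fun j => (act j).1) = L := by
  subst h
  exact ⟨fun j => ⟨L.get j, hL _ (List.get_mem _ _)⟩, List.ofFn_get L⟩

section Reindex

variable {α β : Type} [Fintype α] [DecidableEq α] [Fintype β] [DecidableEq β] {a b : ℕ}

theorem opP_reindex (e : β ≃ α) (U : Matrix (α × Bits a) (α × Bits a) ℂ)
    (ψ : α × Bits a × Bits b → ℂ) :
    opP (Bits b) (U.submatrix (e.prodCongr (Equiv.refl _)) (e.prodCongr (Equiv.refl _))) *ᵥ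
      (fun s => ψ (e s.1, s.2)) = fun s => (opP (Bits b) U *ᵥ ψ) (e s.1, s.2) := by
  funext ⟨x, μ, w⟩
  rw [opP_mulVec, opP_mulVec, submatrix_mulVec_equiv]
  simp [Function.comp_def]

theorem opM_reindex (e : β ≃ α) (M : Matrix (Fin a ⊕ Fin b → Bool) (Fin a ⊕ Fin b → Bool) ℂ)
    (ψ : α × Bits a × Bits b → ℂ) :
    opM β M *ᵥ (fun s => ψ (e s.1, s.2)) = fun s => (opM α M *ᵥ ψ) (e s.1, s.2) := by
  funext ⟨x, μ, w⟩
  rw [opM_mulVec, opM_mulVec]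

theorem alternate_reindex (e : β ≃ α) (Us : List (Matrix (α × Bits a) (α × Bits a) ℂ))
    (Ms : List (Matrix (Fin a ⊕ Fin b → Bool) (Fin a ⊕ Fin b → Bool) ℂ))
    (ψ : α × Bits a × Bits b → ℂ) :
    alternate ((Us.map fun U => U.submatrix (e.prodCongr (Equiv.refl _))
      (e.prodCongr (Equiv.refl _))).map (opP (Bits b))) (Ms.map (opM β))
      (fun s => ψ (e s.1, s.2)) =
    fun s => alternate (Us.map (opP (Bits b))) (Ms.map (opM α)) ψ (e s.1, s.2) := by
  induction Us generalizing Ms ψ with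
  | nil => simp [alternate]
  | cons U Us ih =>
    cases Ms with
    | nil => simp [alternate]
    | cons M Ms =>
      simp only [List.map_cons, alternate]
      rw [opP_reindex, opM_reindex, ih]

/-- A prover may use any private register with `2 ^ n` states, and any of them as the initial one. -/
theorem exists_prover {M n : ℕ} (hM : Odd M) (A : Actions) (e : Bits n ≃ α)
    (Us : List (Matrix (α × Bits A.qM) (α × Bits A.qM) ℂ))
    (hU : ∀ U ∈ Us, U ∈ unitaryGroup (α × Bits A.qM) ℂ) (hlen : Us.length = (M + 1) / 2) :
    ∃ P : Prover A.qM ((M + 1) / 2), acceptProb M A P =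
      weight (fun s => Sum.elim s.2.1 s.2.2 A.outQubit = true)
        (alternate (Us.map (opP (Bits A.qW))) ((A.circuits.map Circuit.mat).map (opM _))
          (Pi.single (e fun _ => false, fun _ => false, fun _ => false) 1)) := by
  obtain ⟨act, hact⟩ := exists_actions (l := (M + 1) / 2) (Us.map fun U =>
    U.submatrix (e.prodCongr (Equiv.refl (Bits A.qM))) (e.prodCongr (Equiv.refl (Bits A.qM)))) (by
      intro U' hU'
      obtain ⟨U, h, rfl⟩ := List.mem_map.1 hU'
      have h' := mem_unitaryGroup_iff.1 (hU U h)
      rw [mem_unitaryGroup_iff, star_eq_conjTranspose, conjTranspose_submatrix,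
        submatrix_mul_equiv, ← star_eq_conjTranspose, h', submatrix_one_equiv]) (by simpa using hlen)
  refine ⟨⟨n, act⟩, ?_⟩
  rw [acceptProb_eq hM A ⟨n, act⟩ hact]
  have h0 : zeroState n A.qM A.qW = fun s => (Pi.single (e fun _ => false, fun _ => false,
      fun _ => false) 1 : α × Bits A.qM × Bits A.qW → ℂ) (e s.1, s.2) := by
    funext s
    simp [zeroState, Pi.single_apply, Prod.ext_iff]
  rw [h0, alternate_reindex, weight, weight]
  exact (e.prodCongr (Equiv.refl (Bits A.qM × Bits A.qW))).sum_comp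
    fun s : α × Bits A.qM × Bits A.qW => if Sum.elim s.2.1 s.2.2 A.outQubit = true then
      ‖alternate (Us.map (opP (Bits A.qW))) ((A.circuits.map Circuit.mat).map (opM _))
          (Pi.single (e fun _ => false, fun _ => false, fun _ => false) 1) s‖ ^ 2 else 0

theorem opP_single (U : Matrix (α × Bits a) (α × Bits a) ℂ) (x : α) (μ : Bits a) (w : Bits b) :
    opP (Bits b) U *ᵥ Pi.single (x, μ, w) 1 =
      fun s => if s.2.2 = w then (U *ᵥ Pi.single (x, μ) 1) (s.1, s.2.1) else 0 := by
  funext ⟨y, μ', w'⟩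
  rw [opP_mulVec]
  by_cases h : w' = w
  · subst h
    simp only [if_true]
    congr 2
    funext p
    simp [Pi.single_apply, Prod.ext_iff]
  · simp [h, mulVec, dotProduct, Pi.single_apply]

end Reindex

/-- The circuits before, in, and after the middle. -/
theorem circuits_split (A : Actions) {m : ℕ} (hA : A.circuits.length = 2 * m + 1) :
    A.circuits = (A.circuits.take m).reverse.reverse ++
      A.circuits.getD m [] :: A.circuits.drop (m + 1) := by
  have h : m < A.circuits.length := by omega
  rw [List.reverse_reverse, List.getD_eq_getElem _ _ h, ← List.drop_eq_getElem_cons h,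
    List.take_append_drop]

/-! ### Soundness -/

/-- By `weight_add_weight_le` it suffices to bound the accepting weight of X₀X₁†ξ for ξ with zero
private register. This vector is realised, after normalisation, by a prover of the original verifier
that prepares ξ, undoes its moves of the backward branch, and then makes those of the forward
branch. -/
theorem acceptProb_halve_le (A : Actions) {m : ℕ} (hA : A.circuits.length = 2 * (m + 1) + 1)
    {t : ℝ} (ht : 0 ≤ t) (h : ∀ P : Prover A.qM ((4 * (m + 1) + 1 + 1) / 2),
      acceptProb (4 * (m + 1) + 1) A P ≤ t)
    (P : Prover A.halve.qM ((2 * (m + 1) + 1 + 1) / 2)) :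
    acceptProb (2 * (m + 1) + 1) A.halve P ≤ (1 + Real.sqrt t) / 2 := by
  obtain ⟨L, hL⟩ : ∃ L : List (Matrix (Bits P.qQ × Bits (A.qM + (A.qW + 1)))
    (Bits P.qQ × Bits (A.qM + (A.qW + 1))) ℂ), (List.ofFn fun j => (P.act j).1) = L := ⟨_, rfl⟩
  have hlen : L.length = m + 2 := by
    have := congrArg List.length hL
    rw [List.length_ofFn] at this
    refine this.symm.trans ?_
    omega
  have hLU : ∀ U ∈ L, U ∈ unitaryGroup (Bits P.qQ × Bits (A.qM + (A.qW + 1))) ℂ := by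
    intro U hU
    rw [← hL] at hU
    obtain ⟨j, rfl⟩ := List.mem_ofFn.1 hU
    exact (P.act j).2
  obtain ⟨U, L', rfl⟩ := List.exists_cons_of_length_eq_add_one hlen
  obtain ⟨U₁, Us, rfl⟩ := List.exists_cons_of_length_eq_add_one (Nat.succ.inj hlen)
  have hlen' : Us.length = m := by simpa using hlen
  rw [acceptProb_halve A hA P hL]
  have hr : ∀ V ∈ U₁ :: Us, regrouped V ∈
      unitaryGroup ((Bits P.qQ × Bits (A.qW + 1)) × Bits A.qM) ℂ := by
    intro V hV
    have h' := mem_unitaryGroup_iff.1 (hLU V (List.mem_cons_of_mem _ hV))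
    rw [mem_unitaryGroup_iff, star_eq_conjTranspose, regrouped, conjTranspose_submatrix,
      submatrix_mul_equiv, ← star_eq_conjTranspose, h', submatrix_one_equiv]
  set Ps := (U₁ :: Us).map fun V => opP (Bits A.qW) (regrouped V) with hPs
  have hPsU : ∀ Q ∈ Ps, Q ∈ unitaryGroup (OldState (Bits P.qQ) A.qM A.qW) ℂ := by
    intro Q hQ
    obtain ⟨V, hV, rfl⟩ := List.mem_map.1 hQ
    exact opP_mem (hr V hV)
  set Bs := (A.circuits.take (m + 1)).reverse with hBs
  have hBlen : Bs.length = m + 1 := by simp [hBs]; omega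
  set φ := received (U *ᵥ Pi.single ((fun _ => false, fun _ => false) :
    Bits P.qQ × Bits (A.qM + (A.qW + 1))) 1) with hφ
  have hφ1 : total φ = 1 := by
    rw [hφ, total_received, total_mulVec (hLU U List.mem_cons_self)]
    rw [total, Finset.sum_eq_single (fun _ => false, fun _ => false)]
    · simp
    · intro p _ hp; simp [Pi.single_apply, hp]
    · simp
  set F : Matrix (OldState (Bits P.qQ) A.qM A.qW) (OldState (Bits P.qQ) A.qM A.qW) ℂ :=
    opP (Bits A.qW) (flipMat (Bits P.qQ) A.qM A.qW) with hF
  set V := opM (Bits P.qQ × Bits (A.qW + 1)) (A.circuits.getD (m + 1) []).mat with hV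
  set Fs := (A.circuits.drop (m + 2)).map fun C =>
    opM (Bits P.qQ × Bits (A.qW + 1)) C.mat with hFs
  set Bm := Bs.map fun C => opM (Bits P.qQ × Bits (A.qW + 1)) C.matᴴ with hBm
  have hX₀ : altMat Ps Fs * V ∈ unitaryGroup (OldState (Bits P.qQ) A.qM A.qW) ℂ := by
    refine mul_mem (altMat_mem hPsU ?_) (opM_mem _)
    intro M hM
    obtain ⟨C, -, rfl⟩ := List.mem_map.1 hM
    exact opM_mem C
  have hX₁ : altMat Ps Bm * F ∈ unitaryGroup (OldState (Bits P.qQ) A.qM A.qW) ℂ := by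
    refine mul_mem (altMat_mem hPsU ?_) (opP_mem flipMat_mem)
    intro M hM
    obtain ⟨C, -, rfl⟩ := List.mem_map.1 hM
    rw [← opM_conjTranspose]
    exact conjTranspose_mem_unitaryGroup (opM_mem C)
  have key := weight_add_weight_le hX₀ hX₁ hφ1 (p := Accepting A.outQubit false)
    (q := Accepting A.outQubit true) ht ?_
  · rw [alternate_eq, alternate_eq, mulVec_mulVec, mulVec_mulVec]
    linarith
  intro ξ hξ
  have hξ0 : ∀ s, s.2.2 ≠ (fun _ => false) → ξ s = 0 := fun s hs => hξ s (by simpa [Accepting])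
  -- A zero vector cannot be normalised and is treated separately.
  rcases (total_nonneg ξ).eq_or_lt with hN | hN
  · have : ξ = 0 := by
      funext s
      have := (Finset.sum_eq_zero_iff_of_nonneg (s := Finset.univ) (f := fun s => ‖ξ s‖ ^ 2)
        fun _ _ => sq_nonneg _).1 hN.symm s
        (Finset.mem_univ s)
      simpa using this
    simp [this, weight, total]
  set N := total ξ with hNdef
  -- Since the private register is zero in ξ, the normalised state lives on registers that the
  -- original prover controls in its first move.
  set ξ₀ : (Bits P.qQ × Bits (A.qW + 1)) × Bits A.qM → ℂ :=
    fun p => ((Real.sqrt N : ℝ) : ℂ)⁻¹ * ξ (p.1, p.2, fun _ => false) with hξ₀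
  have hsN : ((Real.sqrt N : ℝ) : ℂ) ≠ 0 := by
    rw [Ne, Complex.ofReal_eq_zero]
    exact (Real.sqrt_pos.2 hN).ne'
  have hnN : ‖((Real.sqrt N : ℝ) : ℂ)‖ ^ 2 = N := by
    rw [Complex.norm_real, Real.norm_eq_abs, sq_abs, Real.sq_sqrt hN.le]
  have hξ₀1 : total ξ₀ = 1 := by
    have e₁ : total ξ₀ = N⁻¹ * ∑ p : (Bits P.qQ × Bits (A.qW + 1)) × Bits A.qM,
        ‖ξ (p.1, p.2, fun _ => false)‖ ^ 2 := by
      simp only [total, hξ₀, norm_mul, mul_pow, norm_inv, inv_pow, hnN, Finset.mul_sum]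
    have e₂ : (∑ p : (Bits P.qQ × Bits (A.qW + 1)) × Bits A.qM,
        ‖ξ (p.1, p.2, fun _ => false)‖ ^ 2) = N := by
      simp only [hNdef, total, Fintype.sum_prod_type]
      refine Finset.sum_congr rfl fun x _ => Finset.sum_congr rfl fun r _ =>
        Finset.sum_congr rfl fun μ _ => ?_
      rw [Finset.sum_eq_single (fun _ => false)]
      · intro w _ hw
        rw [hξ0 _ hw]; simp
      · simp
    rw [e₁, e₂, inv_mul_cancel₀ hN.ne']
  -- The simulating prover keeps the snapshot and coin qubits of the message register in its own
  -- register. The identification may send the all-zero string anywhere; its image serves as initial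
  -- state.
  have e : Bits (P.qQ + (A.qW + 1)) ≃ Bits P.qQ × Bits (A.qW + 1) :=
    (Fin.appendEquiv P.qQ (A.qW + 1)).symm
  obtain ⟨U₀, hU₀, hU₀ξ⟩ := exists_unitary_mulVec_single (e fun _ => false, fun _ => false) hξ₀1
  -- The flip by the revealed coin acts on a qubit that now belongs to the prover, so it can be
  -- absorbed into the first move of the backward branch.
  set R := (regrouped U₁ * flipMat (Bits P.qQ) A.qM A.qW) :: Us.map regrouped with hR
  have hRU : ∀ Q ∈ R, Q ∈ unitaryGroup ((Bits P.qQ × Bits (A.qW + 1)) × Bits A.qM) ℂ := by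
    rw [hR, List.forall_mem_cons]
    refine ⟨mul_mem (hr _ List.mem_cons_self) flipMat_mem, fun Q hQ => ?_⟩
    obtain ⟨W, hW, rfl⟩ := List.mem_map.1 hQ
    exact hr W (List.mem_cons_of_mem _ hW)
  obtain ⟨P', hP'⟩ := exists_prover (M := 4 * (m + 1) + 1) ⟨2 * (m + 1), by ring⟩ A e
    (U₀ :: ((R.map conjTranspose).reverse ++ (U₁ :: Us).map regrouped)) (by
      simp only [List.forall_mem_cons, List.forall_mem_append]
      refine ⟨hU₀, fun Q hQ => ?_, fun Q hQ => ?_⟩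
      · rw [List.mem_reverse] at hQ
        obtain ⟨W, hW, rfl⟩ := List.mem_map.1 hQ
        exact conjTranspose_mem_unitaryGroup (hRU W hW)
      · obtain ⟨W, hW, rfl⟩ := List.mem_map.1 hQ
        exact hr W hW) (by simp [hR, hlen']; omega)
  have hle := h P'
  rw [hP'] at hle
  have hBmlen : Bs.length = (R.map (opP (Bits A.qW))).length := by simp [hR, hlen', hBlen]
  have hstate : alternate ((U₀ :: ((R.map conjTranspose).reverse ++ (U₁ :: Us).map regrouped)).map
      (opP (Bits A.qW))) ((A.circuits.map Circuit.mat).map (opM (Bits P.qQ × Bits (A.qW + 1))))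
      (Pi.single (e fun _ => false, fun _ => false, fun _ => false) 1) =
      ((Real.sqrt N : ℝ) : ℂ)⁻¹ • ((altMat Ps Fs * V) *ᵥ ((altMat Ps Bm * F)ᴴ *ᵥ ξ)) := by
    have e₁ : (U₀ :: ((R.map conjTranspose).reverse ++ (U₁ :: Us).map regrouped)).map
        (opP (Bits A.qW)) = opP (Bits A.qW) U₀ ::
          (((R.map (opP (Bits A.qW))).map conjTranspose).reverse ++ Ps) := by
      simp only [List.map_cons, List.map_append, List.map_reverse, List.map_map, hPs]
      congr 3
      refine List.map_congr_left fun Q _ => ?_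
      simp [opP_conjTranspose]
    have e₂ : (A.circuits.map Circuit.mat).map (opM (Bits P.qQ × Bits (A.qW + 1))) =
        (Bs.map fun C => opM (Bits P.qQ × Bits (A.qW + 1)) C.mat).reverse ++ V :: Fs := by
      conv_lhs => rw [circuits_split A hA]
      simp [hBs, hV, hFs, List.map_map, Function.comp_def]
    have e₃ : (Bs.map fun C => opM (Bits P.qQ × Bits (A.qW + 1)) C.mat).map conjTranspose = Bm := by
      simp [hBm, List.map_map, Function.comp_def, opM_conjTranspose]
    -- The absorbed flip comes out again at the right end of the product, being applied first.
    have e₄ : altMat (R.map (opP (Bits A.qW))) Bm = altMat Ps Bm * F := by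
      obtain ⟨B, Bm', hB⟩ := List.exists_cons_of_length_eq_add_one
        (show Bm.length = m + 1 by simp [hBm, hBlen])
      rw [hB, hR, hPs, hF]
      simp only [List.map_cons, altMat, opP_mul, List.map_map, Matrix.mul_assoc]
      rfl
    have e₅ : opP (Bits A.qW) U₀ *ᵥ Pi.single (e fun _ => false, fun _ => false, fun _ => false) 1 =
        ((Real.sqrt N : ℝ) : ℂ)⁻¹ • ξ := by
      rw [opP_single, hU₀ξ]
      funext ⟨x, μ, w⟩
      by_cases hw : w = fun _ => false
      · subst hw; simp [hξ₀]
      · simp [hw, hξ0 (x, μ, w) hw]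
    rw [e₁, e₂, alternate_reverse (by simpa using hBmlen.symm), e₃, e₄, e₅, alternate_eq,
      mulVec_smul, mulVec_smul, mulVec_smul, mulVec_mulVec]
  rw [hstate, weight_smul, norm_inv, inv_pow, hnN] at hle
  have := mul_le_mul_of_nonneg_left hle hN.le
  rw [mul_inv_cancel_left₀ hN.ne'] at this
  rw [weight_congr (q := fun s => Sum.elim s.2.1 s.2.2 A.outQubit = true)
    fun s => by simp [Accepting]]
  linarith

/-! ### Completeness -/

section Honest

variable {a b : ℕ} {β : Type} [Fintype β] [DecidableEq β]

/-- The first message of the honest prover: a state of the original prover and verifier. -/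
def snapshot (χ : β × Bits a × Bits b → ℂ) (p : β × Bits (a + (b + 1))) : ℂ :=
  if p.2 (Fin.natAdd a (Fin.last b)) = false then
    χ (p.1, fun i => p.2 (Fin.castAdd _ i), fun i => p.2 (Fin.natAdd a i.castSucc)) else 0

theorem received_snapshot (χ : β × Bits a × Bits b → ℂ) :
    received (snapshot χ) = withReg (fun _ => false) χ := by
  funext ⟨⟨x, r⟩, μ, w⟩
  have h : (r = fun _ => false) ↔ (∀ i : Fin b, r i.castSucc = false) ∧ r (Fin.last b) = false := by
    constructor
    · rintro rfl; simp
    · rintro ⟨h₁, h₂⟩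
      funext i
      exact Fin.lastCases h₂ h₁ i
  simp only [received, snapshot, withReg, h, ite_and, Fin.append_right, Fin.append_left,
    Fin.snoc_last, Fin.snoc_castSucc]

theorem opP_flipMat_withReg (r : Bits (b + 1)) (χ : β × Bits a × Bits b → ℂ) :
    opP (Bits b) (flipMat β a b) *ᵥ withReg r χ = withReg (flipCoin r) χ := by
  rw [opP_flipMat_mulVec]
  funext s
  refine if_congr ⟨fun h => ?_, fun h => ?_⟩ rfl rfl
  · rw [← h, flipCoin_flipCoin]
  · change flipCoin s.1.2 = r
    rw [h, flipCoin_flipCoin]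

/-- The action of the honest prover: depending on the coin, continue or rewind the original
interaction. -/
def choice (p : Matrix (β × Bits a) (β × Bits a) ℂ × Matrix (β × Bits a) (β × Bits a) ℂ)
    (r : Bits (b + 1)) : Matrix (β × Bits a) (β × Bits a) ℂ :=
  if r (Fin.last b) then p.2 else p.1

theorem regrouped_symm (U : Matrix ((β × Bits (b + 1)) × Bits a) ((β × Bits (b + 1)) × Bits a) ℂ) :
    regrouped (U.submatrix (regroup β a b).symm (regroup β a b).symm) = U := by
  simp [regrouped, submatrix_submatrix]

end Honest

/-- The honest snapshot is the original state just before the middle circuit. With coin 0 the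
original run is completed; with coin 1 every move is inverted and the state after the first move
reappears. -/
theorem le_acceptProb_halve (A : Actions) {m : ℕ} (hA : A.circuits.length = 2 * (m + 1) + 1)
    (P : Prover A.qM ((4 * (m + 1) + 1 + 1) / 2)) (hP : 1 ≤ acceptProb (4 * (m + 1) + 1) A P) :
    ∃ P' : Prover A.halve.qM ((2 * (m + 1) + 1 + 1) / 2),
      1 ≤ acceptProb (2 * (m + 1) + 1) A.halve P' := by
  obtain ⟨L, hL⟩ : ∃ L : List (Matrix (Bits P.qQ × Bits A.qM) (Bits P.qQ × Bits A.qM) ℂ),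
    (List.ofFn fun j => (P.act j).1) = L := ⟨_, rfl⟩
  have hlen : L.length = 2 * (m + 1) + 1 := by
    rw [← hL, List.length_ofFn]
    omega
  have hLU : ∀ U ∈ L, U ∈ unitaryGroup (Bits P.qQ × Bits A.qM) ℂ := by
    intro U hU
    rw [← hL] at hU
    obtain ⟨j, rfl⟩ := List.mem_ofFn.1 hU
    exact (P.act j).2
  rw [acceptProb_eq ⟨2 * (m + 1), by ring⟩ A P hL] at hP
  obtain ⟨p₀, L', rfl⟩ := List.exists_cons_of_length_eq_add_one hlen
  have hlen' : L'.length = 2 * (m + 1) := by simpa using hlen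
  -- `Fw` are the moves after the middle circuit; `Bw` are the inverses of the moves before it,
  -- latest first, without the very first move.
  set Fw := L'.drop (m + 1) with hFw
  set Bw := ((L'.take (m + 1)).map conjTranspose).reverse with hBw
  have hFwlen : Fw.length = m + 1 := by simp [hFw]; omega
  have hBwlen : Bw.length = m + 1 := by simp [hBw]; omega
  have hFwU : ∀ U ∈ Fw, U ∈ unitaryGroup (Bits P.qQ × Bits A.qM) ℂ := fun U hU =>
    hLU U (List.mem_cons_of_mem _ (List.mem_of_mem_drop hU))
  have hBwU : ∀ U ∈ Bw, U ∈ unitaryGroup (Bits P.qQ × Bits A.qM) ℂ := by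
    intro U hU
    rw [hBw, List.mem_reverse] at hU
    obtain ⟨W, hW, rfl⟩ := List.mem_map.1 hU
    exact conjTranspose_mem_unitaryGroup (hLU W (List.mem_cons_of_mem _ (List.mem_of_mem_take hW)))
  have hL' : L' = (Bw.map conjTranspose).reverse ++ Fw := by
    simp [hBw, hFw, List.map_reverse, List.map_map, Function.comp_def]
  set Bs := (A.circuits.take (m + 1)).reverse with hBs
  have hBslen : Bs.length = m + 1 := by simp [hBs]; omega
  set W := altMat (Bw.map (opP (Bits A.qW))) (Bs.map fun C => opM (Bits P.qQ) C.matᴴ) with hW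
  have hWU : W ∈ unitaryGroup (Bits P.qQ × Bits A.qM × Bits A.qW) ℂ := by
    refine altMat_mem (fun Q hQ => ?_) fun M hM => ?_
    · obtain ⟨U, hU, rfl⟩ := List.mem_map.1 hQ
      exact opP_mem (hBwU U hU)
    · obtain ⟨C, -, rfl⟩ := List.mem_map.1 hM
      rw [← opM_conjTranspose]
      exact conjTranspose_mem_unitaryGroup (opM_mem C)
  set σ := opP (Bits A.qW) p₀ *ᵥ zeroState P.qQ A.qM A.qW with hσ
  have hp₀ : p₀ ∈ unitaryGroup (Bits P.qQ × Bits A.qM) ℂ := hLU p₀ List.mem_cons_self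
  have hσ1 : total σ = 1 := by
    rw [hσ, total_mulVec (opP_mem hp₀), total, zeroState,
      Finset.sum_eq_single (fun _ => false, fun _ => false, fun _ => false)]
    · simp
    · intro p _ hp; simp [Pi.single_apply, hp]
    · simp
  have hσ0 : ∀ s, s.2.2 ≠ (fun _ => false : Bits A.qW) → σ s = 0 := by
    intro s hs
    rw [hσ, zeroState, opP_single]
    exact if_neg hs
  -- `W` is the rewinding, so its adjoint carries the state σ after the first move to the state
  -- before the middle circuit.
  set χ := Wᴴ *ᵥ σ with hχ
  have hχ1 : total χ = 1 := by
    rw [hχ, total_mulVec (conjTranspose_mem_unitaryGroup hWU), hσ1]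
  have hψ1 : total (snapshot χ) = 1 := by
    rw [← total_received, received_snapshot, total_withReg, hχ1]
  obtain ⟨U₀, hU₀, hU₀χ⟩ := exists_unitary_mulVec_single (fun _ => false, fun _ => false) hψ1
  set Cs : List (Bits (A.qW + 1) → Matrix (Bits P.qQ × Bits A.qM) (Bits P.qQ × Bits A.qM) ℂ) :=
    (Fw.zip Bw).map choice with hCs
  set Us : List (Matrix (Bits P.qQ × Bits (A.qM + (A.qW + 1)))
    (Bits P.qQ × Bits (A.qM + (A.qW + 1))) ℂ) := Cs.map fun c =>
      (controlled c).submatrix (regroup _ _ _).symm (regroup _ _ _).symm with hUs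
  have hUsU : ∀ U ∈ U₀ :: Us, U ∈ unitaryGroup (Bits P.qQ × Bits (A.qM + (A.qW + 1))) ℂ := by
    rw [List.forall_mem_cons]
    refine ⟨hU₀, fun U hU => ?_⟩
    obtain ⟨c, hc, rfl⟩ := List.mem_map.1 hU
    obtain ⟨⟨F, B⟩, hp, rfl⟩ := List.mem_map.1 hc
    have hc : controlled (choice (b := A.qW) (F, B)) ∈ unitaryGroup _ ℂ :=
      controlled_mem fun r => by
        unfold choice
        split_ifs
        · exact hBwU B (List.of_mem_zip hp).2
        · exact hFwU F (List.of_mem_zip hp).1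
    have h' := mem_unitaryGroup_iff.1 hc
    rw [mem_unitaryGroup_iff, star_eq_conjTranspose, conjTranspose_submatrix,
      submatrix_mul_equiv, ← star_eq_conjTranspose, h', submatrix_one_equiv]
  obtain ⟨act, hact⟩ := exists_actions (l := (2 * (m + 1) + 1 + 1) / 2) (U₀ :: Us) hUsU (by
    simp [hUs, hCs, hFwlen, hBwlen]; omega)
  refine ⟨⟨P.qQ, act⟩, ?_⟩
  rw [acceptProb_halve A hA ⟨P.qQ, act⟩ hact]
  have hreg : (Us.map fun U => opP (Bits A.qW) (regrouped U)) =
      Cs.map fun c => opP (Bits A.qW) (controlled c) := by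
    simp only [hUs, List.map_map, Function.comp_def, regrouped_symm]
  have hc₀ : (Cs.map fun c => opP (Bits A.qW) (c fun _ => false)) = Fw.map (opP (Bits A.qW)) := by
    simp only [hCs, List.map_map]
    conv_rhs => rw [← List.map_fst_zip (l₁ := Fw) (l₂ := Bw) (by omega), List.map_map]
    exact List.map_congr_left fun p _ => by simp [choice]
  have hc₁ : (Cs.map fun c => opP (Bits A.qW) (c (flipCoin fun _ => false))) =
      Bw.map (opP (Bits A.qW)) := by
    simp only [hCs, List.map_map]
    conv_rhs => rw [← List.map_snd_zip (l₁ := Fw) (l₂ := Bw) (by omega), List.map_map]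
    exact List.map_congr_left fun p _ => by simp [choice, flipCoin]
  have hm₀ : ((A.circuits.drop (m + 2)).map fun C => opM (Bits P.qQ × Bits (A.qW + 1)) C.mat) =
      ((A.circuits.drop (m + 2)).map Circuit.mat).map (opM (Bits P.qQ × Bits (A.qW + 1))) := by
    rw [List.map_map]
    rfl
  have hm₁ : (Bs.map fun C => opM (Bits P.qQ × Bits (A.qW + 1)) C.matᴴ) =
      (Bs.map fun C => C.matᴴ).map (opM (Bits P.qQ × Bits (A.qW + 1))) := by
    simp [List.map_map]
  -- Rewinding recovers σ, where the private register is still zero because only the prover has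
  -- acted.
  have hχW : alternate (Bw.map (opP (Bits A.qW))) ((Bs.map fun C => C.matᴴ).map (opM (Bits P.qQ)))
      χ = σ := by
    rw [List.map_map, alternate_eq]
    exact mulVec_conjTranspose_mulVec hWU σ
  have hold : alternate (((p₀ :: L').map (opP (Bits A.qW))))
      ((A.circuits.map Circuit.mat).map (opM (Bits P.qQ))) (zeroState P.qQ A.qM A.qW) =
      alternate (Fw.map (opP (Bits A.qW)))
        (((A.circuits.drop (m + 2)).map Circuit.mat).map (opM (Bits P.qQ)))
        (opM (Bits P.qQ) (A.circuits.getD (m + 1) []).mat *ᵥ χ) := by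
    have e₁ : (p₀ :: L').map (opP (Bits A.qW)) = opP (Bits A.qW) p₀ ::
        (((Bw.map (opP (Bits A.qW))).map conjTranspose).reverse ++ Fw.map (opP (Bits A.qW))) := by
      rw [hL']
      simp [List.map_map, Function.comp_def, opP_conjTranspose]
    have e₂ : (A.circuits.map Circuit.mat).map (opM (Bits P.qQ)) =
        (Bs.map fun C => opM (Bits P.qQ) C.mat).reverse ++
          opM (Bits P.qQ) (A.circuits.getD (m + 1) []).mat ::
            ((A.circuits.drop (m + 2)).map Circuit.mat).map (opM (Bits P.qQ)) := by
      conv_lhs => rw [circuits_split A hA]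
      simp [hBs, List.map_map, Function.comp_def]
    have e₃ : (Bs.map fun C => opM (Bits P.qQ) C.mat).map conjTranspose =
        Bs.map fun C => opM (Bits P.qQ) C.matᴴ := by
      simp [List.map_map, Function.comp_def, opM_conjTranspose]
    rw [e₁, e₂, alternate_reverse (by simp [hBwlen, hBslen]), e₃]
  have hw₀ : weight (Accepting A.outQubit false) (alternate
      (Us.map fun U => opP (Bits A.qW) (regrouped U))
        ((A.circuits.drop (m + 2)).map fun C => opM _ C.mat)
          (opM _ (A.circuits.getD (m + 1) []).mat *ᵥ received
            (U₀ *ᵥ Pi.single (fun _ => false, fun _ => false) 1))) =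
      weight (fun s => Sum.elim s.2.1 s.2.2 A.outQubit = true) (alternate
        (((p₀ :: L').map (opP (Bits A.qW))))
        ((A.circuits.map Circuit.mat).map (opM (Bits P.qQ))) (zeroState P.qQ A.qM A.qW)) := by
    rw [hU₀χ, received_snapshot, hreg, hm₀, opM_withReg, alternate_withReg, hc₀, hold,
      ← weight_withReg (fun _ => false : Bits (A.qW + 1)) _
        (fun q : Bits A.qM × Bits A.qW => Sum.elim q.1 q.2 A.outQubit = true)]
    exact weight_congr (fun s => by simp [Accepting]) _
  have hw₁ : weight (Accepting A.outQubit true) (alternate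
      (Us.map fun U => opP (Bits A.qW) (regrouped U)) (Bs.map fun C => opM _ C.matᴴ)
          (opP (Bits A.qW) (flipMat (Bits P.qQ) A.qM A.qW) *ᵥ received
            (U₀ *ᵥ Pi.single (fun _ => false, fun _ => false) 1))) = 1 := by
    rw [hU₀χ, received_snapshot, hreg, hm₁, opP_flipMat_withReg, alternate_withReg, hc₁, hχW]
    refine (weight_congr (q := fun s => s.2.2 = (fun _ => false : Bits A.qW))
      (fun s => by simp [Accepting]) _).trans ?_
    rw [weight_withReg _ _ (fun q : Bits A.qM × Bits A.qW => q.2 = (fun _ => false : Bits A.qW)),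
      ← hσ1]
    exact weight_eq_total hσ0
  have h := add_le_add hP hw₁.symm.le
  rw [← hw₀] at h
  refine le_trans (by norm_num) (mul_le_mul_of_nonneg_left h (by norm_num : (0 : ℝ) ≤ 1 / 2))
/-! ### The number of actions -/

theorem length_rounds {nM nW : ℕ} {ι : Type} (l : Layout nM nW ι) {k : ℕ}
    {Fs Bs : List (Circuit (Fin nM ⊕ Fin nW))} (hF : Fs.length = k) (hB : Bs.length = k) :
    (l.rounds Fs Bs).length = k := by
  induction k generalizing Fs Bs with
  | zero => rw [List.length_eq_zero_iff.1 hF, Layout.rounds]; rfl; simp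
  | succ k ih =>
    obtain ⟨F, Fs, rfl⟩ := List.exists_cons_of_length_eq_add_one hF
    obtain ⟨B, Bs, rfl⟩ := List.exists_cons_of_length_eq_add_one hB
    rw [Layout.rounds, List.length_cons, ih (Nat.succ.inj hF) (Nat.succ.inj hB)]

theorem Actions.length_halve (A : Actions) {k : ℕ} (hA : A.circuits.length = 2 * k + 1) :
    A.halve.circuits.length = k + 1 := by
  refine (List.length_map circuitOf).trans ?_
  rw [Layout.halved, List.length_cons,
    length_rounds (k := k) _ (by rw [List.length_drop]; omega)
      (by rw [List.length_reverse, List.length_take]; omega)]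

end UQIP

end

/-! ### The halving theorem -/

theorem mainTheorem8 (m : ℕ → ℕ) (s : ℕ → ℝ)
    (hm : UQIP.LogspaceComputable m)
    (hm_pos : ∀ n, 1 ≤ m n)
    (hm_poly : ∃ p : Polynomial ℕ, ∀ n, m n ≤ p.eval n)
    (hs : ∀ n, 0 ≤ s n ∧ s n ≤ 1) :
    UQIP.QIPUL (fun n => 4 * m n + 1) (fun _ => 1) s ⊆
      UQIP.QIPUL (fun n => 2 * m n + 1) (fun _ => 1) (fun n => (1 + Real.sqrt (s n)) / 2) := by
  rintro I ⟨V, hV, hyes, hno⟩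
  have hlen : ∀ x ∈ I.yes ∪ I.no, (V x).circuits.length = 2 * m x.length + 1 := by
    intro x hx
    rw [hV.messages x hx]
    omega
  refine ⟨fun x => (V x).halve, ⟨?_, ?_, ?_, ?_⟩, ?_, ?_⟩
  · exact UQIP.logspaceComputableOn_halve hV.uniform fun x hx =>
      ⟨m x.length, hm_pos _, hlen x hx⟩
  · obtain ⟨qM, qW, h⟩ := hV.registers
    refine ⟨fun n => qM n + (qW n + 1), fun n => 4 + (qW n + (qW n + 1)), fun x hx => ?_⟩
    obtain ⟨h₁, h₂⟩ := h x hx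
    change (V x).qM + ((V x).qW + 1) = _ ∧ 4 + ((V x).qW + ((V x).qW + 1)) = _
    rw [h₁, h₂]
    exact ⟨rfl, rfl⟩
  · obtain ⟨C, h⟩ := hV.qubits
    -- The new registers hold qM + 3·qW + 6 qubits.
    refine ⟨3 * C + 6, fun x hx => ?_⟩
    have := h x hx
    change (V x).qM + ((V x).qW + 1) + (4 + ((V x).qW + ((V x).qW + 1))) ≤ _
    rw [add_mul, mul_assoc]
    omega
  · intro x hx
    rw [(V x).length_halve (hlen x hx)]
    omega
  · intro x hx
    have hP := hyes x hx
    have hA := hlen x (.inl hx)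
    have hpos := hm_pos x.length
    beta_reduce at hP ⊢
    generalize m x.length = M at hP hA hpos ⊢
    -- The lemmas on acceptance probabilities are stated for m = k + 1, that is, with at least one
    -- round after the first action.
    obtain ⟨k, rfl⟩ := Nat.exists_eq_add_of_le' hpos
    obtain ⟨P, hP⟩ := hP
    exact UQIP.le_acceptProb_halve (V x) hA P hP
  · intro x hx
    have hP := hno x hx
    have hA := hlen x (.inr hx)
    have hpos := hm_pos x.length
    beta_reduce at hP ⊢
    generalize m x.length = M at hP hA hpos ⊢
    obtain ⟨k, rfl⟩ := Nat.exists_eq_add_of_le' hpos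
    exact UQIP.acceptProb_halve_le (V x) hA (hs _).1 hP
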